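/- **Sublinear time spectral density estimation for graphs.** Let $G=(V,E)$ be an unweighted, undirected graph on $n\ge 1$ vertices, with degrees $d_i$, adjacency matrix $A_G$ and degree matrix $D$. Let $A = D^{-1/2}A_GD^{-1/2}$ be its normalized adjacency matrix (rows and columns of isolated vertices are zero), with eigenvalues $\lambda_1,\dots,\lambda_n\in[-1,1]$ and spectral density $s=\frac1n\sum_{i=1}^n\delta_{\lambda_i}$. For probability distributions $q,s$ on $[-1,1]$ let $$W_1(q,s)=\sup\Big\{\int f\,dq-\int f\,ds \;:\; f:\mathbb R\to\mathbb R,\ |f(x)-f(y)|\le|x-y|\ \forall x,y\Big\}$$ be the Wasserstein-1 distance. Consider randomized programs on a real RAM (unit cost arithmetic and comparisons, square roots, and draws of uniformly random integers below a given bound) that know $n$ and access $G$ only by the following operations: 1) sample a uniformly random vertex in constant time; 2) sample a uniformly random neighbor of any given vertex in constant time; 3) read the degree $d_i$ of any given vertex $i$ in constant time, and read off all its neighbors, in an arbitrary order, in time $O(1+d_i)$. There are a randomized program and constants $C,k$ such that for all $n\ge 1$, all such $G$ and all $\epsilon,\delta\in(0,1)$ (with $\epsilon,\delta$ given to the program)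 the following holds. The expected running time is at most $$C\,n\left(\frac{1+\log(1/\delta)}{\epsilon}\right)^{k},$$ that is, $O(n\,\mathrm{poly}(\log(1/\delta)/\epsilon))$ for $\delta\le 1/2$. The program outputs, with probability $1$, a probability density function $q:[-1,1]\to\mathbb R_{\ge 0}$, and $W_1(q,s)\le\epsilon$ with probability at least $1-\delta$. Here $q$ is output as a list of coefficients $c_0,\dots,c_{m-1}$ and is $q(x)=\frac{1}{\pi\sqrt{1-x^2}}\sum_{k<m}c_kT_k(x)$, where $T_k$ are the Chebyshev polynomials of the first kind. -/

import Mathlib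

open MeasureTheory
open scoped ENNReal NNReal

noncomputable section

/-! ## Spectral densities, probability densities on `[-1, 1]`, and the Wasserstein-1 distance -/

namespace SpectralDensity

open Classical in
/-- The normalized adjacency matrix `D^{-1/2} A D^{-1/2}` of a graph on `n` vertices, where `D` is
the diagonal matrix of degrees. The diagonal entry of `D^{-1/2}` at an isolated vertex is `0`, so
rows and columns of isolated vertices vanish. -/
def normalizedAdjacency {n : ℕ} (G : SimpleGraph (Fin n)) : Matrix (Fin n) (Fin n) ℝ :=
  Matrix.diagonal (fun i => (√(G.degree i : ℝ))⁻¹) * G.adjMatrix ℝ *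
    Matrix.diagonal (fun i => (√(G.degree i : ℝ))⁻¹)

open Classical in
theorem normalizedAdjacency_isHermitian {n : ℕ} (G : SimpleGraph (Fin n)) :
    (normalizedAdjacency G).IsHermitian := by
  have hA : (G.adjMatrix ℝ).IsHermitian := by
    rw [Matrix.IsHermitian, Matrix.conjTranspose_eq_transpose_of_trivial]
    exact SimpleGraph.transpose_adjMatrix G
  rw [Matrix.IsHermitian, normalizedAdjacency, Matrix.conjTranspose_mul, Matrix.conjTranspose_mul,
    hA.eq, Matrix.diagonal_conjTranspose, Matrix.mul_assoc]
  simp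

/-- The spectral density `(1/n) ∑ i, δ(x - λ i)` of a Hermitian `n × n` matrix, as a measure. -/
def spectralDensity {n : ℕ} {A : Matrix (Fin n) (Fin n) ℝ} (hA : A.IsHermitian) : Measure ℝ :=
  (n : ℝ≥0∞)⁻¹ • ∑ i, Measure.dirac (hA.eigenvalues i)

/-- `q` is a probability density function on `[-1, 1]`. -/
def IsDensity (q : ℝ → ℝ) : Prop :=
  (∀ x ∈ Set.Icc (-1 : ℝ) 1, 0 ≤ q x) ∧ IntegrableOn q (Set.Icc (-1) 1) ∧
    ∫ x in Set.Icc (-1 : ℝ) 1, q x = 1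

/-- The measure on `[-1, 1]` with density `q`. -/
def densityMeasure (q : ℝ → ℝ) : Measure ℝ :=
  (volume.restrict (Set.Icc (-1) 1)).withDensity (fun x => ENNReal.ofReal (q x))

/-- The Wasserstein-1 distance, in its dual form: the supremum of `∫ f dμ - ∫ f dν` over all
1-Lipschitz `f : ℝ → ℝ`. It is used for probability measures supported on `[-1, 1]` only, for
which all these integrals converge. -/
def wasserstein1 (μ ν : Measure ℝ) : ℝ≥0∞ :=
  ⨆ (f : ℝ → ℝ) (_ : LipschitzWith 1 f), ENNReal.ofReal (∫ x, f x ∂μ - ∫ x, f x ∂ν)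

end SpectralDensity

/-! ## A randomized real RAM with sample access to a graph

Programs are finite pieces of syntax. They work on integer and real variables, and on integer and
real arrays; finitely many of them are named by a given program, and the cells of an array are
addressed by computed integers. There is no conversion from reals to integers (no rounding), and
the only integer operations are addition, truncated subtraction and multiplication. -/

namespace RAM

/-- Integer expressions: literals, variables, array cells, arithmetic. -/
inductive NExp : Type
  | lit (k : ℕ)
  | var (x : ℕ)
  | cell (a : ℕ) (i : NExp)
  | add (e f : NExp)
  | sub (e f : NExp)
  | mul (e f : NExp)

/-- Real expressions: integers read as reals, variables, array cells, arithmetic, square roots. -/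
inductive RExp : Type
  | ofInt (e : NExp)
  | var (x : ℕ)
  | cell (a : ℕ) (i : NExp)
  | add (e f : RExp)
  | sub (e f : RExp)
  | mul (e f : RExp)
  | div (e f : RExp)
  | sqrt (e : RExp)

/-- Tests. -/
inductive BExp : Type
  | nlt (e f : NExp)
  | rlt (e f : RExp)
  | neg (b : BExp)
  | conj (b c : BExp)

/-- Elementary instructions. -/
inductive Instr : Type
  /-- integer variable `x` := `e` -/
  | nset (x : ℕ) (e : NExp)
  /-- real variable `x` := `e` -/
  | rset (x : ℕ) (e : RExp)
  /-- cell `i` of integer array `a` := `e` -/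
  | nstore (a : ℕ) (i e : NExp)
  /-- cell `i` of real array `a` := `e` -/
  | rstore (a : ℕ) (i : NExp) (e : RExp)
  /-- integer variable `x` := a uniformly random element of `{0, …, e - 1}` -/
  | rand (x : ℕ) (e : NExp)
  /-- integer variable `x` := a uniformly random vertex -/
  | randVertex (x : ℕ)
  /-- integer variable `x` := a uniformly random neighbor of vertex `e` -/
  | randNeighbor (x : ℕ) (e : NExp)
  /-- integer variable `x` := the degree of vertex `e` -/
  | degree (x : ℕ) (e : NExp)
  /-- write all neighbors of vertex `e` to the first cells of integer array `a` -/
  | neighbors (a : ℕ) (e : NExp)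

/-- Programs. -/
inductive Prog : Type
  | instr (c : Instr)
  | seq (p q : Prog)
  | cond (b : BExp) (p q : Prog)
  | loop (b : BExp) (p : Prog)

/-- The memory. -/
structure Store : Type where
  nvar : ℕ → ℕ
  rvar : ℕ → ℝ
  narr : ℕ → ℕ → ℕ
  rarr : ℕ → ℕ → ℝ

def NExp.eval (σ : Store) : NExp → ℕ
  | .lit k => k
  | .var x => σ.nvar x
  | .cell a i => σ.narr a (i.eval σ)
  | .add e f => e.eval σ + f.eval σ
  | .sub e f => e.eval σ - f.eval σ
  | .mul e f => e.eval σ * f.eval σ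

def RExp.eval (σ : Store) : RExp → ℝ
  | .ofInt e => (e.eval σ : ℝ)
  | .var x => σ.rvar x
  | .cell a i => σ.rarr a (i.eval σ)
  | .add e f => e.eval σ + f.eval σ
  | .sub e f => e.eval σ - f.eval σ
  | .mul e f => e.eval σ * f.eval σ
  | .div e f => e.eval σ / f.eval σ
  | .sqrt e => √(e.eval σ)

def BExp.eval (σ : Store) : BExp → Prop
  | .nlt e f => e.eval σ < f.eval σ
  | .rlt e f => e.eval σ < f.eval σ
  | .neg b => ¬ b.eval σ
  | .conj b c => b.eval σ ∧ c.eval σ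

def Store.setN (σ : Store) (x v : ℕ) : Store :=
  { σ with nvar := Function.update σ.nvar x v }

def Store.setR (σ : Store) (x : ℕ) (v : ℝ) : Store :=
  { σ with rvar := Function.update σ.rvar x v }

def Store.setNCell (σ : Store) (a i v : ℕ) : Store :=
  { σ with narr := Function.update σ.narr a (Function.update (σ.narr a) i v) }

def Store.setRCell (σ : Store) (a i : ℕ) (v : ℝ) : Store :=
  { σ with rarr := Function.update σ.rarr a (Function.update (σ.rarr a) i v) }

/-- Overwrite the first cells of integer array `a` with the entries of a list. -/
def Store.setNList (σ : Store) (a : ℕ) (l : List ℕ) : Store :=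
  { σ with narr := Function.update σ.narr a (fun k => l.getD k (σ.narr a k)) }

/-- The uniform distribution on `{0, …, m - 1}` (concentrated at `0` if `m = 0`). -/
def uniformBelow : ℕ → PMF ℕ
  | 0 => PMF.pure 0
  | m + 1 => (PMF.uniformOfFintype (Fin (m + 1))).map Fin.val

/-- `L` is an adjacency list representation of `G`: for each vertex, its neighbors, each once and
in an arbitrary order. -/
def IsAdjacencyList {n : ℕ} (G : SimpleGraph (Fin n)) (L : Fin n → List (Fin n)) : Prop :=
  ∀ i, (L i).Nodup ∧ ∀ j, j ∈ L i ↔ G.Adj i j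

/-- The neighbors of the vertex with number `v` (none if there is no such vertex). -/
def nbrs {n : ℕ} (L : Fin n → List (Fin n)) (v : ℕ) : List ℕ :=
  if h : v < n then (L ⟨v, h⟩).map Fin.val else []

/-- The effect of an elementary instruction. (`randNeighbor` returns `0` when asked for a neighbor
of an isolated vertex.) -/
def Instr.exec {n : ℕ} (L : Fin n → List (Fin n)) (σ : Store) : Instr → PMF Store
  | .nset x e => PMF.pure (σ.setN x (e.eval σ))
  | .rset x e => PMF.pure (σ.setR x (e.eval σ))
  | .nstore a i e => PMF.pure (σ.setNCell a (i.eval σ) (e.eval σ))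
  | .rstore a i e => PMF.pure (σ.setRCell a (i.eval σ) (e.eval σ))
  | .rand x e => (uniformBelow (e.eval σ)).map (fun v => σ.setN x v)
  | .randVertex x => (uniformBelow n).map (fun v => σ.setN x v)
  | .randNeighbor x e => (uniformBelow (nbrs L (e.eval σ)).length).map
      (fun k => σ.setN x ((nbrs L (e.eval σ)).getD k 0))
  | .degree x e => PMF.pure (σ.setN x (nbrs L (e.eval σ)).length)
  | .neighbors a e => PMF.pure (σ.setNList a (nbrs L (e.eval σ)))

/-- The time taken by an elementary instruction: reading off the neighbors of a vertex of degree `d`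
takes time `1 + d`, everything else takes time `1`. (The expressions that occur in a program have
bounded size, so this is the number of arithmetic operations and memory accesses up to a constant
factor depending on the program only.) -/
def Instr.cost {n : ℕ} (L : Fin n → List (Fin n)) (σ : Store) : Instr → ℕ
  | .neighbors _ e => 1 + (nbrs L (e.eval σ)).length
  | _ => 1

/-- A configuration: what remains to be executed, the memory, and the time used so far. -/
structure Config : Type where
  todo : List Prog
  store : Store
  time : ℕ

open Classical in
/-- One step of the machine. A configuration with nothing left to execute has halted. -/
def step {n : ℕ} (L : Fin n → List (Fin n)) : Config → PMF Config
  | ⟨[], σ, t⟩ => PMF.pure ⟨[], σ, t⟩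
  | ⟨.instr c :: k, σ, t⟩ => (c.exec L σ).map (fun σ' => ⟨k, σ', t + c.cost L σ⟩)
  | ⟨.seq p q :: k, σ, t⟩ => PMF.pure ⟨p :: q :: k, σ, t + 1⟩
  | ⟨.cond b p q :: k, σ, t⟩ => PMF.pure ⟨(if b.eval σ then p else q) :: k, σ, t + 1⟩
  | ⟨.loop b p :: k, σ, t⟩ =>
      PMF.pure ⟨if b.eval σ then p :: .loop b p :: k else k, σ, t + 1⟩

/-- The distribution of the configuration after `m` steps. -/
def runFor {n : ℕ} (L : Fin n → List (Fin n)) (c : Config) : ℕ → PMF Config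
  | 0 => PMF.pure c
  | m + 1 => (runFor L c m).bind (step L)

/-- The initial memory: the number `n` of vertices in integer variable `0`, the parameters `ε` and
`δ` in the real variables `0` and `1`, and zeros elsewhere. -/
def inputStore (n : ℕ) (ε δ : ℝ) : Store where
  nvar := fun x => if x = 0 then n else 0
  rvar := fun x => if x = 0 then ε else if x = 1 then δ else 0
  narr := fun _ _ => 0
  rarr := fun _ _ => 0

/-- The initial configuration. -/
def start (P : Prog) (n : ℕ) (ε δ : ℝ) : Config := ⟨[P], inputStore n ε δ, 0⟩

/-- The expected running time of program `P`: the time used in `m` steps increases with `m`, and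
every step before halting takes time at least `1`, so the supremum over `m` of the expectations is
the expected total time, infinite if `P` fails to halt with positive probability. -/
def expectedTime (P : Prog) {n : ℕ} (L : Fin n → List (Fin n)) (ε δ : ℝ) : ℝ≥0∞ :=
  ⨆ m, ∑' c, runFor L (start P n ε δ) m c * (c.time : ℝ≥0∞)

/-- The probability that program `P` halts with a memory in `S`. -/
def haltProb (P : Prog) {n : ℕ} (L : Fin n → List (Fin n)) (ε δ : ℝ) (S : Set Store) : ℝ≥0∞ :=
  ⨆ m, (runFor L (start P n ε δ) m).toOuterMeasure {c | c.todo = [] ∧ c.store ∈ S}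

/-- The function that a final memory represents: integer variable `0` holds a number `m`, the cells
`c 0, …, c (m - 1)` of real array `0` are coefficients, and the function is
`(1 / (π √(1 - x²))) ∑ k < m, c k T k (x)` with `T k` the Chebyshev polynomials of the first
kind. -/
def output (σ : Store) : ℝ → ℝ := fun x =>
  (∑ k ∈ Finset.range (σ.nvar 0), σ.rarr 0 k * (Polynomial.Chebyshev.T ℝ (k : ℤ)).eval x) /
    (Real.pi * √(1 - x ^ 2))

end RAM

end

/-! Write `A` for the normalized adjacency matrix, `b_{m,j}(x)` for the Bernstein polynomial in the
variable `(1 + x) / 2`, and `μ_j = tr b_{m,j}(A) / n`.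

Reduction to `m + 1` numbers. For `x ∈ [-1, 1]` the values `b_{m,j}(x)`, `j ≤ m`, are a probability
distribution on the nodes `2j/m - 1` with mean `x` and variance at most `1/m`. Averaging over the
spectrum, the masses `μ_j` at the nodes form a measure within `1/√m` of the spectral density
(`sum_bernsteinMass_mul_le`). Smoothing an atom with the Fejér kernel in Chebyshev polynomials,
which is nonnegative with total mass `π` and second moment exactly `π/m` about the atom, costs
another `1/√m` (`integral_mul_fejerKernel_le`) and gives a density of the required form. With `m` of
order `1/ε²` it remains to estimate the `μ_j` with total error of order `ε`.

Estimating `μ_j`. For a uniformly random vertex `v`, the entry `b_{m,j}(A)_{vv}` has mean `μ_j`. The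
vectors `b_{t,j}(A) e_v` satisfy `b_{t+1,j+1} = (b_{t,j} + b_{t,j+1})/2 + A (b_{t,j} -
b_{t,j+1})/2`. If `y` is a random neighbor of `i`, then `√(d_i/d_y) z_y` has mean `(A z)_i`, so each
entry of the product with `A` is replaced by an average of `m` such samples. The recurrence is
linear, so the result is unbiased (`expect_iter_layerStep`). It is also stable. The exact step
averages neighboring rows with the positive semidefinite weights `(1 ± A)/2` and does not increase
the sum of squares of all rows, and the sampling noise adds at most a fraction `1/m` of that sum
(`expect_energy_layerStep`). After `m` layers the second moment is at most `(1 + 1/m)^m ≤ 3`. One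
trial takes `O(n m³)` operations.

Concentration. Only second moments are controlled, so each trial is clipped at `B`, at the price of
a bias `3/B`. An exponential moment bound over `N` trials then gives failure probability
exponentially small in `N/B²` (`expect_bad_le`).

The output is a density for every outcome of the draws: its zeroth coefficient is set to `1` and the
weights are nonnegative with sum at most `1`. The number of steps depends only on the input
parameters and not on the draws, so the whole run is a finite tree of uniform draws, and the lemmas
on `Block` identify program fragments with such trees. -/

noncomputable section

/-! ## Finite random experiments -/

/-- A finite random experiment: a tree of uniform draws, with outcomes at the leaves. -/
inductive Sampler (α : Type) : Type
  | pure (a : α)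
  | node (m : ℕ) (k : Fin (m + 1) → Sampler α)

namespace Sampler

variable {α β γ : Type}

def bind : Sampler α → (α → Sampler β) → Sampler β
  | .pure a, f => f a
  | .node m k, f => .node m (fun i => (k i).bind f)

def map (f : α → β) (t : Sampler α) : Sampler β := t.bind (fun a => .pure (f a))

/-- The expectation of a function of the outcome. -/
def expect : Sampler α → (α → ℝ) → ℝ
  | .pure a, f => f a
  | .node m k, f => (∑ i, (k i).expect f) / (m + 1)

/-- All possible outcomes satisfy `P`. -/
def All : Sampler α → (α → Prop) → Prop
  | .pure a, P => P a
  | .node _ k, P => ∀ i, (k i).All P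

def toPMF : Sampler α → PMF α
  | .pure a => PMF.pure a
  | .node m k => (PMF.uniformOfFintype (Fin (m + 1))).bind (fun i => (k i).toPMF)

@[simp] theorem pure_bind (a : α) (f : α → Sampler β) : (pure a).bind f = f a := rfl

@[simp] theorem map_pure (a : α) (f : α → β) : (pure a).map f = pure (f a) := rfl

@[simp] theorem expect_pure (a : α) (f : α → ℝ) : (pure a).expect f = f a := rfl

@[simp] theorem All_pure (a : α) (P : α → Prop) : (pure a).All P ↔ P a := Iff.rfl

theorem bind_assoc (t : Sampler α) (f : α → Sampler β) (g : β → Sampler γ) :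
    (t.bind f).bind g = t.bind (fun a => (f a).bind g) := by
  induction t with
  | pure a => rfl
  | node m k ih => simp only [bind, ih]

theorem bind_pure (t : Sampler α) : t.bind pure = t := by
  induction t with
  | pure a => rfl
  | node m k ih => simp only [bind, ih]

theorem map_bind (t : Sampler α) (f : α → Sampler β) (g : β → γ) :
    (t.bind f).map g = t.bind (fun a => (f a).map g) := bind_assoc _ _ _

theorem bind_map (t : Sampler α) (f : α → β) (g : β → Sampler γ) :
    (t.map f).bind g = t.bind (fun a => g (f a)) := bind_assoc _ _ _

theorem map_map (t : Sampler α) (f : α → β) (g : β → γ) :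
    (t.map f).map g = t.map (fun a => g (f a)) := bind_assoc _ _ _

theorem expect_bind (t : Sampler α) (f : α → Sampler β) (g : β → ℝ) :
    (t.bind f).expect g = t.expect (fun a => (f a).expect g) := by
  induction t with
  | pure a => rfl
  | node m k ih => simp only [bind, expect, ih]

theorem expect_map (t : Sampler α) (f : α → β) (g : β → ℝ) :
    (t.map f).expect g = t.expect (fun a => g (f a)) := expect_bind _ _ _

theorem All_bind {t : Sampler α} {f : α → Sampler β} {P : α → Prop} {Q : β → Prop}
    (h : t.All P) (hf : ∀ a, P a → (f a).All Q) : (t.bind f).All Q := by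
  induction t with
  | pure a => exact hf a h
  | node m k ih => exact fun i => ih i (h i)

theorem All_map_iff {t : Sampler α} {f : α → β} {Q : β → Prop} :
    (t.map f).All Q ↔ t.All (fun a => Q (f a)) := by
  induction t with
  | pure a => rfl
  | node m k ih => exact forall_congr' ih

theorem All.mono {t : Sampler α} {P Q : α → Prop} (h : t.All P) (hPQ : ∀ a, P a → Q a) :
    t.All Q := by
  induction t with
  | pure a => exact hPQ a h
  | node m k ih => exact fun i => ih i (h i)

theorem All.and {t : Sampler α} {P Q : α → Prop} (h : t.All P) (h' : t.All Q) :
    t.All (fun a => P a ∧ Q a) := by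
  induction t with
  | pure a => exact ⟨h, h'⟩
  | node m k ih => exact fun i => ih i (h i) (h' i)

theorem All_of_forall {t : Sampler α} {P : α → Prop} (h : ∀ a, P a) : t.All P := by
  induction t with
  | pure a => exact h a
  | node m k ih => exact fun i => ih i

theorem bind_congr {t : Sampler α} {f g : α → Sampler β} {P : α → Prop}
    (h : t.All P) (hfg : ∀ a, P a → f a = g a) : t.bind f = t.bind g := by
  induction t with
  | pure a => exact hfg a h
  | node m k ih => simp only [bind, fun i => ih i (h i)]

theorem expect_congr {t : Sampler α} {f g : α → ℝ} {P : α → Prop}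
    (h : t.All P) (hfg : ∀ a, P a → f a = g a) : t.expect f = t.expect g := by
  induction t with
  | pure a => exact hfg a h
  | node m k ih => simp only [expect, fun i => ih i (h i)]

theorem expect_mono {t : Sampler α} {f g : α → ℝ} {P : α → Prop}
    (h : t.All P) (hfg : ∀ a, P a → f a ≤ g a) : t.expect f ≤ t.expect g := by
  induction t with
  | pure a => exact hfg a h
  | node m k ih =>
    simp only [expect]
    gcongr with i
    exact ih i (h i)

theorem expect_le_expect {t : Sampler α} {f g : α → ℝ} (hfg : ∀ a, f a ≤ g a) :
    t.expect f ≤ t.expect g :=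
  expect_mono (P := fun _ => True) (All_of_forall fun _ => trivial) fun a _ => hfg a

theorem expect_const (t : Sampler α) (c : ℝ) : t.expect (fun _ => c) = c := by
  induction t with
  | pure a => rfl
  | node m k ih =>
    simp only [expect, ih, Finset.sum_const, Finset.card_univ, Fintype.card_fin, nsmul_eq_mul]
    push_cast
    field_simp

theorem expect_add (t : Sampler α) (f g : α → ℝ) :
    t.expect (fun a => f a + g a) = t.expect f + t.expect g := by
  induction t with
  | pure a => rfl
  | node m k ih => simp only [expect, ih, Finset.sum_add_distrib, add_div]

theorem expect_const_mul (t : Sampler α) (c : ℝ) (f : α → ℝ) :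
    t.expect (fun a => c * f a) = c * t.expect f := by
  induction t with
  | pure a => rfl
  | node m k ih => simp only [expect, ih, ← Finset.mul_sum, mul_div_assoc]

theorem expect_sub (t : Sampler α) (f g : α → ℝ) :
    t.expect (fun a => f a - g a) = t.expect f - t.expect g := by
  have h := expect_add t f (fun a => (-1) * g a)
  rw [expect_const_mul] at h
  simpa [sub_eq_add_neg] using h

theorem expect_sum {ι : Type*} (t : Sampler α) (s : Finset ι) (f : ι → α → ℝ) :
    t.expect (fun a => ∑ i ∈ s, f i a) = ∑ i ∈ s, t.expect (f i) := by
  classical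
  induction s using Finset.induction_on with
  | empty => simpa using expect_const t 0
  | insert i s hi ih => simp only [Finset.sum_insert hi, expect_add, ih]

theorem expect_nonneg {t : Sampler α} {f : α → ℝ} (h : ∀ a, 0 ≤ f a) : 0 ≤ t.expect f := by
  simpa [expect_const] using expect_le_expect (t := t) (f := fun _ => 0) h

theorem toPMF_bind (t : Sampler α) (f : α → Sampler β) :
    (t.bind f).toPMF = t.toPMF.bind (fun a => (f a).toPMF) := by
  induction t with
  | pure a => simp [bind, toPMF]
  | node m k ih => simp only [bind, toPMF, ih, PMF.bind_bind]

theorem toPMF_map (t : Sampler α) (f : α → β) : (t.map f).toPMF = t.toPMF.map f :=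
  toPMF_bind _ _

theorem toPMF_bind_congr {t : Sampler α} {f g : α → PMF β} {P : α → Prop}
    (h : t.All P) (hfg : ∀ a, P a → f a = g a) : t.toPMF.bind f = t.toPMF.bind g := by
  induction t with
  | pure a => simpa [toPMF] using hfg a h
  | node m k ih => simp only [toPMF, PMF.bind_bind, fun i => ih i (h i)]

-- The bridge between real expectations over a tree, where all estimates are made, and the `PMF`
-- probabilities in `haltProb`.
open Classical in
theorem toOuterMeasure_toPMF (t : Sampler α) (S : Set α) :
    t.toPMF.toOuterMeasure S = ENNReal.ofReal (t.expect (fun a => if a ∈ S then 1 else 0)) := by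
  induction t with
  | pure a =>
    simp only [toPMF, PMF.toOuterMeasure_pure_apply, expect]
    split_ifs <;> simp
  | node m k ih =>
    simp only [toPMF, PMF.toOuterMeasure_bind_apply, expect, ih, tsum_fintype,
      PMF.uniformOfFintype_apply, Fintype.card_fin]
    rw [← Finset.mul_sum, ← ENNReal.ofReal_sum_of_nonneg, div_eq_inv_mul,
      ENNReal.ofReal_mul (by positivity), ENNReal.ofReal_inv_of_pos (by positivity)]
    · congr 2
      rw [← Nat.cast_succ, ENNReal.ofReal_natCast]
    · intro i _
      exact expect_nonneg fun a => by split_ifs <;> norm_num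

/-- Run `k 0`, …, `k (N - 1)` in turn. -/
def iter : ℕ → (ℕ → α → Sampler α) → α → Sampler α
  | 0, _, a => pure a
  | N + 1, k, a => (iter N k a).bind (k N)

@[simp] theorem iter_zero (k : ℕ → α → Sampler α) (a : α) : iter 0 k a = pure a := rfl

theorem iter_succ (N : ℕ) (k : ℕ → α → Sampler α) (a : α) :
    iter (N + 1) k a = (iter N k a).bind (k N) := rfl

/-- A running loop performs its first round first, so matching it with `iter` requires peeling off
round `0` instead of round `N`. -/
theorem iter_succ' (N : ℕ) (k : ℕ → α → Sampler α) (a : α) :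
    iter (N + 1) k a = (k 0 a).bind (iter N (fun i => k (i + 1))) := by
  induction N generalizing a with
  | zero => exact (bind_pure (k 0 a)).symm
  | succ N ih =>
    rw [iter_succ, ih, bind_assoc]
    rfl

theorem iter_add (M N : ℕ) (k : ℕ → α → Sampler α) (a : α) :
    iter (M + N) k a = (iter M k a).bind (iter N (fun i => k (M + i))) := by
  induction N with
  | zero => exact (bind_pure (iter M k a)).symm
  | succ N ih =>
    rw [← add_assoc, iter_succ, ih, bind_assoc]
    rfl

theorem iter_congr {N : ℕ} {k k' : ℕ → α → Sampler α} (h : ∀ i < N, k i = k' i) (a : α) :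
    iter N k a = iter N k' a := by
  induction N with
  | zero => rfl
  | succ N ih =>
    rw [iter_succ, iter_succ, ih fun i hi => h i (by omega), h N (by omega)]

/-- Two nested loops are one loop over pairs of indices. -/
theorem iter_iter (J I : ℕ) (k : ℕ → ℕ → α → Sampler α) (a : α) :
    iter J (fun j => iter I (k j)) a = iter (J * I) (fun c => k (c / I) (c % I)) a := by
  induction J with
  | zero => simp
  | succ J ih =>
    rw [iter_succ, ih, Nat.succ_mul, iter_add]
    congr 1
    funext b
    refine iter_congr (fun i hi => ?_) b
    have : 0 < I := by omega
    rw [Nat.mul_comm, Nat.mul_add_div this, Nat.div_eq_of_lt hi, Nat.mul_add_mod,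
      Nat.mod_eq_of_lt hi, add_zero]

theorem All_iter {N : ℕ} {k : ℕ → α → Sampler α} {a : α} {P : ℕ → α → Prop} (h0 : P 0 a)
    (h : ∀ i < N, ∀ b, P i b → (k i b).All (P (i + 1))) : (iter N k a).All (P N) := by
  induction N with
  | zero => exact h0
  | succ N ih => exact All_bind (ih fun i hi => h i (by omega)) (h N (by omega))

theorem iter_map {N : ℕ} {k : ℕ → β → Sampler β} {k' : ℕ → α → Sampler α} {f : α → β}
    (h : ∀ i < N, ∀ a, k i (f a) = (k' i a).map f) (a : α) :
    iter N k (f a) = (iter N k' a).map f := by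
  induction N with
  | zero => rfl
  | succ N ih =>
    rw [iter_succ, ih fun i hi => h i (by omega), bind_map, iter_succ, map_bind]
    congr 1
    funext b
    exact h N (by omega) b

end Sampler

/-! ## Running programs -/

namespace RAM

variable {n : ℕ} {L : Fin n → List (Fin n)}

theorem runFor_add (c : Config) (a b : ℕ) :
    runFor L c (a + b) = (runFor L c a).bind (fun c' => runFor L c' b) := by
  induction b with
  | zero => simp [runFor]
  | succ b ih => rw [← add_assoc, runFor, ih, PMF.bind_bind]; rfl

theorem runFor_one (c : Config) : runFor L c 1 = step L c := by
  simp [runFor]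

/-- Program `p`, started with memory `σ`, takes exactly `m` steps, in time `m`, and leaves a memory
distributed according to `T`. -/
def Runs (L : Fin n → List (Fin n)) (p : Prog) (σ : Store) (m : ℕ) (T : Sampler Store) : Prop :=
  ∀ k t, runFor L ⟨p :: k, σ, t⟩ m = T.toPMF.map (fun σ' => ⟨k, σ', t + m⟩)

/-- The count `m'` must be the same for every outcome of `p`. This uniformity is what lets runs
compose with a deterministic number of steps. -/
theorem Runs.bind_run {p : Prog} {σ : Store} {m m' : ℕ} {T : Sampler Store}
    {U : Store → Sampler Store} {q : Prog} (hp : Runs L p σ m T)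
    (hq : T.All (fun σ' => Runs L q σ' m' (U σ'))) (k : List Prog) (t : ℕ) :
    runFor L ⟨p :: q :: k, σ, t⟩ (m + m') =
      (T.bind U).toPMF.map (fun σ' => ⟨k, σ', t + (m + m')⟩) := by
  rw [runFor_add, hp, PMF.bind_map, Sampler.toPMF_bind, PMF.map_bind]
  refine Sampler.toPMF_bind_congr hq fun σ' h => ?_
  simp only [Function.comp_apply, h k (t + m), add_assoc]

theorem Runs.seq {p q : Prog} {σ : Store} {m m' : ℕ} {T : Sampler Store}
    {U : Store → Sampler Store} (hp : Runs L p σ m T)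
    (hq : T.All (fun σ' => Runs L q σ' m' (U σ'))) :
    Runs L (.seq p q) σ (1 + (m + m')) (T.bind U) := by
  intro k t
  rw [runFor_add, runFor_one, step, PMF.pure_bind, hp.bind_run hq]
  simp only [add_assoc]

theorem Runs.loop_true {p : Prog} {b : BExp} {σ : Store} {m m' : ℕ} {T : Sampler Store}
    {U : Store → Sampler Store} (hb : b.eval σ) (hp : Runs L p σ m T)
    (hq : T.All (fun σ' => Runs L (.loop b p) σ' m' (U σ'))) :
    Runs L (.loop b p) σ (1 + (m + m')) (T.bind U) := by
  intro k t
  rw [runFor_add, runFor_one, step, PMF.pure_bind, if_pos hb, hp.bind_run hq]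
  simp only [add_assoc]

theorem Runs.loop_false {p : Prog} {b : BExp} {σ : Store} (hb : ¬ b.eval σ) :
    Runs L (.loop b p) σ 1 (.pure σ) := by
  intro k t
  rw [runFor_one, step, if_neg hb]
  simp [Sampler.toPMF, PMF.pure_map]

theorem Runs.instr {c : Instr} {σ : Store} {T : Sampler Store} (hc : c.cost L σ = 1)
    (hT : c.exec L σ = T.toPMF) : Runs L (.instr c) σ 1 T := by
  intro k t
  rw [runFor_one, step, hT, hc]

/-- The contents of all real arrays. -/
abbrev Mem : Type := ℕ → ℕ → ℝ

/-- Write `v` into cell `i` of array `x`. -/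
def upd (a : Mem) (x i : ℕ) (v : ℝ) : Mem := Function.update a x (Function.update (a x) i v)

theorem upd_self (a : Mem) (x i : ℕ) (v : ℝ) : upd a x i v x i = v := by simp [upd]

theorem upd_array_ne (a : Mem) {x y : ℕ} (i : ℕ) (v : ℝ) (h : y ≠ x) : upd a x i v y = a y := by
  simp [upd, h]

theorem upd_cell_ne (a : Mem) (x : ℕ) {i j : ℕ} (v : ℝ) (h : j ≠ i) :
    upd a x i v x j = a x j := by
  simp [upd, h]

theorem upd_apply (a : Mem) (x i : ℕ) (v : ℝ) (y j : ℕ) :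
    upd a x i v y j = if y = x ∧ j = i then v else a y j := by
  by_cases h : y = x
  · subst h
    by_cases h' : j = i <;> simp [upd, h']
  · simp [upd, h]

theorem upd_upd (a : Mem) (x i : ℕ) (v w : ℝ) : upd (upd a x i v) x i w = upd a x i w := by
  simp [upd]

/-- Integer variables below `K` are the same. -/
def Agree (K : ℕ) (σ σ' : Store) : Prop := ∀ x < K, σ'.nvar x = σ.nvar x

theorem Agree.refl (K : ℕ) (σ : Store) : Agree K σ σ := fun _ _ => rfl

theorem Agree.trans {K : ℕ} {σ σ' σ'' : Store} (h : Agree K σ σ') (h' : Agree K σ' σ'') :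
    Agree K σ σ'' := fun x hx => (h' x hx).trans (h x hx)

theorem Agree.mono {K K' : ℕ} {σ σ' : Store} (h : Agree K σ σ') (hK : K' ≤ K) : Agree K' σ σ' :=
  fun x hx => h x (by omega)

theorem Agree.setN {K x : ℕ} (σ : Store) (v : ℕ) (h : K ≤ x) : Agree K σ (σ.setN x v) := by
  intro y hy
  simp [Store.setN, show y ≠ x by omega]

/-- Program `p`, started with memory `σ`, takes exactly `m` steps, in time `m`, does not change the
integer variables below `K`, and leaves real arrays distributed according to `T`. -/
def Block (L : Fin n → List (Fin n)) (K : ℕ) (p : Prog) (σ : Store) (m : ℕ) (T : Sampler Mem) :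
    Prop :=
  ∃ U : Sampler Store, Runs L p σ m U ∧ U.All (Agree K σ) ∧ U.map Store.rarr = T

theorem Block.mono {K K' : ℕ} {p : Prog} {σ : Store} {m : ℕ} {T : Sampler Mem}
    (h : Block L K p σ m T) (hK : K' ≤ K) : Block L K' p σ m T := by
  obtain ⟨U, hU, hA, hT⟩ := h
  exact ⟨U, hU, hA.mono fun σ' h => h.mono hK, hT⟩

/-- The law of `q` depends on the store only through its real arrays, so a choice of store-level
trees for `q` can be projected to array-level trees after composing. -/
theorem Block.bind_aux {K m' : ℕ} {q : Prog} {σ : Store} {V : Sampler Store}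
    (hV : V.All (Agree K σ)) {k : Mem → Sampler Mem}
    (hq : ∀ σ', Agree K σ σ' → Block L K q σ' m' (k σ'.rarr)) :
    ∃ U : Store → Sampler Store, V.All (fun σ' => Runs L q σ' m' (U σ')) ∧
      (V.bind U).All (Agree K σ) ∧ (V.bind U).map Store.rarr = (V.map Store.rarr).bind k := by
  have : Nonempty (Sampler Store) := ⟨.pure σ⟩
  choose! U hU using hq
  refine ⟨U, hV.mono fun σ' h => (hU σ' h).1,
    Sampler.All_bind hV fun σ' h => (hU σ' h).2.1.mono fun σ'' h' => h.trans h', ?_⟩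
  rw [Sampler.map_bind, Sampler.bind_map]
  exact Sampler.bind_congr hV fun σ' h => (hU σ' h).2.2

theorem Block.seq {K m m' : ℕ} {p q : Prog} {σ : Store} {T : Sampler Mem} {k : Mem → Sampler Mem}
    (hp : Block L K p σ m T) (hq : ∀ σ', Agree K σ σ' → Block L K q σ' m' (k σ'.rarr)) :
    Block L K (.seq p q) σ (1 + (m + m')) (T.bind k) := by
  obtain ⟨V, hV, hA, rfl⟩ := hp
  obtain ⟨U, hU, hA', hT⟩ := Block.bind_aux hA hq
  exact ⟨V.bind U, hV.seq hU, hA', hT⟩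

theorem Block.rstore (K a : ℕ) (i : NExp) (e : RExp) (σ : Store) :
    Block L K (.instr (.rstore a i e)) σ 1 (.pure (upd σ.rarr a (i.eval σ) (e.eval σ))) :=
  ⟨.pure (σ.setRCell a (i.eval σ) (e.eval σ)), Runs.instr rfl rfl, fun _ _ => rfl, rfl⟩

/-- An instruction that draws an integer variable, followed by a block that uses it. -/
theorem Block.draw {K m x : ℕ} {c : Instr} {q : Prog} {σ : Store} {V : Sampler ℕ}
    {k : ℕ → Sampler Mem} (hK : K ≤ x) (hc : c.cost L σ = 1)
    (hV : c.exec L σ = V.toPMF.map (σ.setN x))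
    (hq : ∀ y, Block L K q (σ.setN x y) m (k y)) :
    Block L K (.seq (.instr c) q) σ (1 + (1 + m)) (V.bind k) := by
  choose U hU using hq
  refine ⟨V.bind U, ?_, ?_, ?_⟩
  · have h : Runs L (.instr c) σ 1 (V.map (σ.setN x)) :=
      Runs.instr hc (hV.trans (Sampler.toPMF_map _ _).symm)
    have h' := h.seq (q := q) (m' := m) (U := fun σ' => U (σ'.nvar x)) ?_
    · rw [Sampler.bind_map] at h'
      simpa [Store.setN] using h'
    · rw [Sampler.All_map_iff]
      exact Sampler.All_of_forall fun y => by simpa [Store.setN] using (hU y).1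
  · exact Sampler.All_bind (P := fun _ => True) (Sampler.All_of_forall fun _ => trivial)
      fun y _ => (hU y).2.1.mono fun σ' h => (Agree.setN σ y hK).trans h
  · rw [Sampler.map_bind]
    exact congrArg V.bind (funext fun y => (hU y).2.2)

theorem Block.assign {K m x v : ℕ} {c : Instr} {q : Prog} {σ : Store}
    {T : Sampler Mem} (hK : K ≤ x) (hc : c.cost L σ = 1)
    (hV : c.exec L σ = PMF.pure (σ.setN x v)) (hq : Block L K q (σ.setN x v) m T) :
    Block L K (.seq (.instr c) q) σ (1 + (1 + m)) T := by
  obtain ⟨U, hU, hA, hT⟩ := hq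
  refine ⟨U, ?_, hA.mono fun σ' h => (Agree.setN σ v hK).trans h, hT⟩
  exact Runs.seq (T := .pure (σ.setN x v)) (U := fun _ => U) (Runs.instr hc hV) hU

/-- `for x = 0, …, e - 1 do p`. -/
def forLoop (x : ℕ) (e : NExp) (p : Prog) : Prog :=
  .seq (.instr (.nset x (.lit 0)))
    (.loop (.nlt (.var x) e) (.seq p (.instr (.nset x (.add (.var x) (.lit 1))))))

/-- Induction on the number `r` of remaining rounds, with the counter at `i = N - r`. The body keeps
the variables up to and including the counter, hence `Block` at level `x + 1`. -/
theorem Block.loop_counter {x m N : ℕ} {e : NExp} {p : Prog} {σ₀ : Store}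
    {k : ℕ → Mem → Sampler Mem} (he : ∀ σ, Agree x σ₀ σ → e.eval σ = N)
    (hp : ∀ i < N, ∀ σ, Agree x σ₀ σ → σ.nvar x = i → Block L (x + 1) p σ m (k i σ.rarr))
    (r : ℕ) : ∀ (i : ℕ) (σ : Store), i + r = N → Agree x σ₀ σ → σ.nvar x = i →
      Block L x (.loop (.nlt (.var x) e) (.seq p (.instr (.nset x (.add (.var x) (.lit 1)))))) σ
        (r * (m + 3) + 1) (Sampler.iter r (fun j => k (i + j)) σ.rarr) := by
  induction r with
  | zero =>
    intro i σ hi hA hx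
    rw [zero_mul, zero_add]
    refine ⟨.pure σ, Runs.loop_false ?_, Agree.refl _ _, rfl⟩
    simp only [BExp.eval, NExp.eval, he σ hA]
    omega
  | succ r ih =>
    intro i σ hi hA hx
    have hb : (BExp.nlt (.var x) e).eval σ := by
      simp only [BExp.eval, NExp.eval, he σ hA]
      omega
    obtain ⟨V, hV, hVA, hVT⟩ := hp i (by omega) σ hA hx
    let W : Sampler Store := V.bind (fun σ' => .pure (σ'.setN x (σ'.nvar x + 1)))
    have hW : Runs L (.seq p (.instr (.nset x (.add (.var x) (.lit 1))))) σ (1 + (m + 1)) W :=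
      hV.seq (Sampler.All_of_forall fun σ' => Runs.instr rfl rfl)
    have hWA : W.All (fun σ' => Agree x σ σ' ∧ σ'.nvar x = i + 1) := by
      refine Sampler.All_bind hVA fun σ' h => ⟨?_, ?_⟩
      · exact (h.mono (Nat.le_succ x)).trans (Agree.setN _ _ le_rfl)
      · simp [Store.setN, h x (Nat.lt_succ_self x), hx]
    have hWT : W.map Store.rarr = k i σ.rarr := by
      rw [← hVT]
      exact Sampler.map_bind _ _ _
    have key : ∀ σ', Agree x σ σ' ∧ σ'.nvar x = i + 1 → ∃ U : Sampler Store,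
        Runs L (.loop (.nlt (.var x) e) (.seq p (.instr (.nset x (.add (.var x) (.lit 1))))))
          σ' (r * (m + 3) + 1) U ∧ U.All (Agree x σ') ∧
        U.map Store.rarr = Sampler.iter r (fun j => k (i + 1 + j)) σ'.rarr :=
      fun σ' h => ih (i + 1) σ' (by omega) (hA.trans h.1) h.2
    have : Nonempty (Sampler Store) := ⟨.pure σ⟩
    choose! U hU using key
    refine ⟨W.bind U, ?_, ?_, ?_⟩
    · have h := hW.loop_true hb (hWA.mono fun σ' h => (hU σ' h).1)
      -- Per round: one step each for the loop test, for unfolding `seq` and for the increment,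
      -- besides the `m` steps of the body.
      rwa [show 1 + (1 + (m + 1) + (r * (m + 3) + 1)) = (r + 1) * (m + 3) + 1 by ring] at h
    · exact Sampler.All_bind hWA fun σ' h => (hU σ' h).2.1.mono fun σ'' h' => h.1.trans h'
    · rw [Sampler.map_bind, Sampler.iter_succ', add_zero, ← hWT, Sampler.bind_map]
      refine Sampler.bind_congr hWA fun σ' h => ?_
      rw [(hU σ' h).2.2]
      congr 1
      funext j
      rw [show i + 1 + j = i + (j + 1) by ring]

theorem Block.forLoop {x m N : ℕ} {e : NExp} {p : Prog} {σ : Store}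
    {k : ℕ → Mem → Sampler Mem} (he : ∀ σ', Agree x σ σ' → e.eval σ' = N)
    (hp : ∀ i < N, ∀ σ', Agree x σ σ' → σ'.nvar x = i → Block L (x + 1) p σ' m (k i σ'.rarr)) :
    Block L x (RAM.forLoop x e p) σ (1 + (1 + (N * (m + 3) + 1))) (Sampler.iter N k σ.rarr) := by
  refine Block.assign (v := 0) le_rfl rfl rfl ?_
  have h := Block.loop_counter he hp N 0 (σ.setN x 0) (zero_add N) (Agree.setN _ _ le_rfl)
    (by simp [Store.setN])
  simp only [zero_add] at h
  exact h

end RAM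

/-! ## The program -/

namespace Sampler

/-- A uniformly random element of `{0, …, m - 1}`, or `0` if `m = 0`. -/
def uniform : ℕ → Sampler ℕ
  | 0 => .pure 0
  | m + 1 => .node m (fun i => .pure i.val)

theorem toPMF_uniform (m : ℕ) : (uniform m).toPMF = RAM.uniformBelow m := by
  cases m <;> rfl

end Sampler

namespace RAM

variable {n : ℕ} {L : Fin n → List (Fin n)}

theorem Block.cast {K m m' : ℕ} {p : Prog} {σ : Store} {T T' : Sampler Mem}
    (h : Block L K p σ m T) (hm : m = m') (hT : T = T') : Block L K p σ m' T' := by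
  subst hm hT
  exact h

/-- The number `n` of vertices, the degree `m`, the number `N` of trials and the clipping bound `B`
are in their places. -/
def Ready (n m N B : ℕ) (σ : Store) : Prop :=
  σ.nvar 0 = n ∧ σ.nvar 3 = m ∧ σ.nvar 4 = N ∧ σ.nvar 5 = B

theorem Ready.agree {m N B K : ℕ} {σ σ' : Store} (h : Ready n m N B σ)
    (hA : Agree K σ σ') (hK : 6 ≤ K := by norm_num) : Ready n m N B σ' := by
  obtain ⟨h0, h3, h4, h5⟩ := h
  exact ⟨(hA 0 (by omega)).trans h0, (hA 3 (by omega)).trans h3, (hA 4 (by omega)).trans h4,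
    (hA 5 (by omega)).trans h5⟩

/-- The number of neighbors of the vertex with number `v`. -/
def deg (L : Fin n → List (Fin n)) (v : ℕ) : ℕ := (nbrs L v).length

/-- A random neighbor of the vertex with number `v`. -/
def pick (L : Fin n → List (Fin n)) (v : ℕ) : Sampler ℕ :=
  (Sampler.uniform (deg L v)).map (fun k => (nbrs L v).getD k 0)

/-- The contribution of the random neighbor `y` of `i` to cell `i` of the row that follows the rows
`u (p + ·)` and `u (n + p + ·)`. -/
def gain (L : Fin n → List (Fin n)) (m : ℕ) (u : ℕ → ℝ) (p i y : ℕ) : ℝ :=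
  √((deg L i : ℝ) / deg L y) * (u (p + y) - u (n + (p + y))) / (2 * m)

def sampleStep (L : Fin n → List (Fin n)) (m j i : ℕ) (a : Mem) : Sampler Mem :=
  (pick L i).bind fun y =>
    .pure (upd a 2 (n + (j * n + i)) (a 2 (n + (j * n + i)) + gain L m (a 1) (j * n) i y))

def cellStep (L : Fin n → List (Fin n)) (m j i : ℕ) (a : Mem) : Sampler Mem :=
  Sampler.iter m (fun _ => sampleStep L m j i)
    (upd a 2 (n + (j * n + i)) ((a 1 (j * n + i) + a 1 (n + (j * n + i))) / 2))

def copyStep (n : ℕ) (c : ℕ) (a : Mem) : Sampler Mem :=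
  .pure (upd a 1 (n + c) (a 2 (n + c)))

/-- Row `j + 1` of array `1` occupies the cells `n + (j * n + i)` and holds the estimate of
`b_{t,j}(A) e_v`; row `0` stays zero and stands for `b_{t,-1}`. Array `2` is a buffer, so that a
whole layer is computed from the old one before anything is overwritten. -/
def layerStep (L : Fin n → List (Fin n)) (m : ℕ) (a : Mem) : Sampler Mem :=
  (Sampler.iter (m + 1) (fun j => Sampler.iter n (fun i => cellStep L m j i)) a).bind
    (Sampler.iter ((m + 1) * n) (copyStep n))

/-- `x` cut off at `B` and `-B`. -/
def clip (B x : ℝ) : ℝ := (|x + B| - |x - B|) / 2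

def clearStep (c : ℕ) (a : Mem) : Sampler Mem := .pure (upd a 1 c 0)

def addStep (n B v j : ℕ) (a : Mem) : Sampler Mem :=
  .pure (upd a 3 j (a 3 j + clip B (a 1 (n + (j * n + v)))))

/-- Rows `0` to `m + 1` are cleared and row `1` is set to the unit vector of `v`, which is
`b_{0,0}(A) e_v`. After `m` layers the diagonal entries at `v` are clipped and accumulated in array
`3`. -/
def trialStep (L : Fin n → List (Fin n)) (m B : ℕ) (a : Mem) : Sampler Mem :=
  (Sampler.uniform n).bind fun v =>
    (Sampler.iter ((m + 2) * n) clearStep a).bind fun a =>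
      (Sampler.pure (upd a 1 (n + v) 1)).bind fun a =>
        (Sampler.iter m (fun _ => layerStep L m) a).bind fun a =>
          Sampler.iter (m + 1) (addStep n B v) a

def totalStep (j : ℕ) (a : Mem) : Sampler Mem := .pure (upd a 4 0 (a 4 0 + |a 3 j|))

/-- Array `5` holds the values of the Chebyshev polynomials at the current node, produced by the
three-term recurrence; array `0` collects the coefficients over all nodes. -/
def chebStep (m j k : ℕ) (a : Mem) : Sampler Mem :=
  (Sampler.pure (upd a 0 (k + 1) (a 0 (k + 1) +
      2 * (1 - ((k + 1 : ℕ) : ℝ) / m) * (|a 3 j| / a 4 0) * a 5 (k + 1)))).bind fun a =>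
    .pure (upd a 5 (k + 2) (2 * (2 * j / m - 1) * a 5 (k + 1) - a 5 k))

def nodeStep (m j : ℕ) (a : Mem) : Sampler Mem :=
  (Sampler.pure (upd a 5 0 1)).bind fun a =>
    (Sampler.pure (upd a 5 1 (2 * j / m - 1))).bind fun a =>
      Sampler.iter (m - 1) (chebStep m j) a

def outputStep (m : ℕ) (a : Mem) : Sampler Mem :=
  (Sampler.iter (m + 1) totalStep a).bind fun a =>
    (Sampler.pure (upd a 0 0 1)).bind fun a => Sampler.iter (m + 1) (nodeStep m) a

/-- The index of cell `y` of row `j` (integer variable `11`). -/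
def rowCell (y : ℕ) : NExp := .add (.mul (.var 11) (.var 0)) (.var y)

def sampleProg : Prog :=
  .seq (.instr (.randNeighbor 14 (.var 12))) <|
  .seq (.instr (.degree 15 (.var 12))) <|
  .seq (.instr (.degree 16 (.var 14))) <|
  .instr (.rstore 2 (.add (.var 0) (rowCell 12))
    (.add (.cell 2 (.add (.var 0) (rowCell 12)))
      (.div (.mul (.sqrt (.div (.ofInt (.var 15)) (.ofInt (.var 16))))
          (.sub (.cell 1 (rowCell 14)) (.cell 1 (.add (.var 0) (rowCell 14)))))
        (.mul (.ofInt (.lit 2)) (.ofInt (.var 3))))))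

def cellProg : Prog :=
  .seq (.instr (.rstore 2 (.add (.var 0) (rowCell 12))
    (.div (.add (.cell 1 (rowCell 12)) (.cell 1 (.add (.var 0) (rowCell 12))))
      (.ofInt (.lit 2)))))
    (forLoop 13 (.var 3) sampleProg)

def layerProg : Prog :=
  .seq (forLoop 11 (.add (.var 3) (.lit 1)) (forLoop 12 (.var 0) cellProg))
    (forLoop 11 (.mul (.add (.var 3) (.lit 1)) (.var 0))
      (.instr (.rstore 1 (.add (.var 0) (.var 11)) (.cell 2 (.add (.var 0) (.var 11))))))

def absExp (e : RExp) : RExp := .sqrt (.mul e e)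

def clipExp (e : RExp) : RExp :=
  .div (.sub (absExp (.add e (.ofInt (.var 5)))) (absExp (.sub e (.ofInt (.var 5)))))
    (.ofInt (.lit 2))

def trialProg : Prog :=
  .seq (.instr (.randVertex 9)) <|
  .seq (forLoop 10 (.mul (.add (.var 3) (.lit 2)) (.var 0))
    (.instr (.rstore 1 (.var 10) (.ofInt (.lit 0))))) <|
  .seq (.instr (.rstore 1 (.add (.var 0) (.var 9)) (.ofInt (.lit 1)))) <|
  .seq (forLoop 10 (.var 3) layerProg) <|
  forLoop 10 (.add (.var 3) (.lit 1))
    (.instr (.rstore 3 (.var 10) (.add (.cell 3 (.var 10))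
      (clipExp (.cell 1 (.add (.var 0) (.add (.mul (.var 10) (.var 0)) (.var 9))))))))

/-- The node `2 j / m - 1`, with `j` in integer variable `8`. -/
def nodeExp : RExp :=
  .sub (.div (.mul (.ofInt (.lit 2)) (.ofInt (.var 8))) (.ofInt (.var 3))) (.ofInt (.lit 1))

def chebProg : Prog :=
  .seq (.instr (.rstore 0 (.add (.var 9) (.lit 1)) (.add (.cell 0 (.add (.var 9) (.lit 1)))
    (.mul (.mul (.mul (.ofInt (.lit 2))
        (.sub (.ofInt (.lit 1)) (.div (.ofInt (.add (.var 9) (.lit 1))) (.ofInt (.var 3)))))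
      (.div (absExp (.cell 3 (.var 8))) (.cell 4 (.lit 0))))
      (.cell 5 (.add (.var 9) (.lit 1))))))) <|
  .instr (.rstore 5 (.add (.var 9) (.lit 2))
    (.sub (.mul (.mul (.ofInt (.lit 2)) nodeExp) (.cell 5 (.add (.var 9) (.lit 1))))
      (.cell 5 (.var 9))))

def nodeProg : Prog :=
  .seq (.instr (.rstore 5 (.lit 0) (.ofInt (.lit 1)))) <|
  .seq (.instr (.rstore 5 (.lit 1) nodeExp)) <|
  forLoop 9 (.sub (.var 3) (.lit 1)) chebProg

def outputProg : Prog :=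
  .seq (forLoop 8 (.add (.var 3) (.lit 1))
    (.instr (.rstore 4 (.lit 0) (.add (.cell 4 (.lit 0)) (absExp (.cell 3 (.var 8))))))) <|
  .seq (.instr (.rstore 0 (.lit 0) (.ofInt (.lit 1)))) <|
  forLoop 8 (.add (.var 3) (.lit 1)) nodeProg

def mainProg : Prog := .seq (forLoop 8 (.var 4) trialProg) outputProg

/-! ### Program fragments realize the sampled steps, with exact step counts -/

variable {m N B : ℕ}

theorem eval_absExp (σ : Store) (e : RExp) : (absExp e).eval σ = |e.eval σ| := by
  simp [absExp, RExp.eval, Real.sqrt_mul_self_eq_abs]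

theorem eval_clipExp {σ : Store} (h : Ready n m N B σ) (e : RExp) :
    (clipExp e).eval σ = clip B (e.eval σ) := by
  simp [clipExp, RExp.eval, NExp.eval, eval_absExp, clip, h.2.2.2]

theorem block_sampleProg {σ : Store} {j i : ℕ} (h : Ready n m N B σ) (hj : σ.nvar 11 = j)
    (hi : σ.nvar 12 = i) : Block L 14 sampleProg σ 7 (sampleStep L m j i σ.rarr) := by
  refine Block.draw (m := 5) (V := pick L i) le_rfl rfl ?_ fun y => ?_
  · simp [Instr.exec, NExp.eval, hi, pick, Sampler.toPMF_map, Sampler.toPMF_uniform, deg,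
      PMF.map_comp, Function.comp_def]
  refine Block.assign (K := 14) (x := 15) (m := 3) (v := deg L i) (by norm_num) rfl ?_ ?_
  · simp [Instr.exec, NExp.eval, Store.setN, deg, hi]
  refine Block.assign (K := 14) (x := 16) (m := 1) (v := deg L y) (by norm_num) rfl ?_ ?_
  · simp [Instr.exec, NExp.eval, Store.setN, deg]
  refine (Block.rstore _ _ _ _ _).cast rfl ?_
  simp [NExp.eval, RExp.eval, rowCell, Store.setN, hj, hi, h.1, h.2.1, gain]

theorem block_cellProg {σ : Store} {j i : ℕ} (h : Ready n m N B σ) (hj : σ.nvar 11 = j)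
    (hi : σ.nvar 12 = i) : Block L 13 cellProg σ (10 * m + 5) (cellStep L m j i σ.rarr) := by
  refine (Block.seq (m := 1) (m' := 1 + (1 + (m * (7 + 3) + 1)))
    (k := Sampler.iter m (fun _ => sampleStep L m j i)) (Block.rstore _ _ _ _ _)
    fun σ' hA => Block.forLoop (fun σ'' hA' => ?_) fun _ _ σ'' hA' _ => ?_).cast (by ring) ?_
  · exact (h.agree (hA.trans hA')).2.1
  · exact block_sampleProg (h.agree (hA.trans hA')) (((hA.trans hA') 11 (by norm_num)).trans hj)
      (((hA.trans hA') 12 (by norm_num)).trans hi)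
  · simp [NExp.eval, RExp.eval, rowCell, hj, hi, h.1, cellStep]

def layerCost (n m : ℕ) : ℕ := (m + 1) * (n * (10 * m + 8) + 6) + (m + 1) * n * 4 + 7

theorem block_layerProg {σ : Store} (h : Ready n m N B σ) :
    Block L 11 layerProg σ (layerCost n m) (layerStep L m σ.rarr) := by
  refine (Block.seq (m := 1 + (1 + ((m + 1) * (1 + (1 + (n * (10 * m + 5 + 3) + 1)) + 3) + 1)))
    (m' := 1 + (1 + ((m + 1) * n * (1 + 3) + 1)))
    (T := Sampler.iter (m + 1) (fun j => Sampler.iter n (fun i => cellStep L m j i)) σ.rarr)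
    (k := Sampler.iter ((m + 1) * n) (copyStep n)) (Block.forLoop ?_ fun j _ σ' hA hj => ?_)
    fun σ' hA => Block.forLoop ?_ fun c _ σ'' hA' hc => ?_).cast ?_ rfl
  · intro σ' hA
    simp [NExp.eval, (h.agree hA).2.1]
  · refine Block.forLoop (fun σ'' hA' => ?_) fun i _ σ'' hA' hi => ?_
    · exact ((h.agree hA).agree hA').1
    · exact block_cellProg ((h.agree hA).agree hA') ((hA' 11 (by norm_num)).trans hj) hi
  · intro σ'' hA'
    have h' := (h.agree hA).agree hA'
    simp [NExp.eval, h'.1, h'.2.1]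
  · have h' := (h.agree hA).agree hA'
    refine (Block.rstore _ _ _ _ _).cast rfl ?_
    simp [NExp.eval, RExp.eval, h'.1, hc, copyStep]
  · simp only [layerCost]
    ring

def trialCost (n m : ℕ) : ℕ := (m + 2) * n * 4 + m * (layerCost n m + 3) + (m + 1) * 4 + 15

theorem block_trialProg {σ : Store} (h : Ready n m N B σ) :
    Block L 9 trialProg σ (trialCost n m) (trialStep L m B σ.rarr) := by
  refine (Block.draw (V := Sampler.uniform n) (m := (1 + ((1 + (1 + ((m + 2) * n * (1 + 3) + 1))) + (1 + (1 + (1 +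
      ((1 + (1 + (m * (layerCost n m + 3) + 1))) +
        (1 + (1 + ((m + 1) * (1 + 3) + 1))))))))))
    le_rfl rfl ?_ fun v => ?_).cast ?_ rfl
  · simp [Instr.exec, Sampler.toPMF_uniform]
  · have h₀ : Ready n m N B (σ.setN 9 v) := h.agree (Agree.setN (K := 9) σ v le_rfl)
    have hv₀ : (σ.setN 9 v).nvar 9 = v := by simp [Store.setN]
    refine Block.mono (K := 10) ?_ (by norm_num)
    refine Block.seq (K := 10) ((Block.forLoop (N := (m + 2) * n) (k := clearStep) ?_
      fun c _ σ' hA hc => ?_)) fun σ₁ hA₁ => ?_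
    · intro σ' hA
      simp [NExp.eval, (h₀.agree hA).1, (h₀.agree hA).2.1]
    · refine (Block.rstore _ _ _ _ _).cast rfl ?_
      simp [NExp.eval, RExp.eval, hc, clearStep]
    have h₁ := h₀.agree hA₁
    have hv₁ := (hA₁ 9 (by norm_num)).trans hv₀
    refine Block.seq (K := 10) ((Block.rstore _ _ _ _ _).cast rfl ?_) fun σ₂ hA₂ => ?_
    · simp [NExp.eval, RExp.eval, h₁.1, hv₁]
    have h₂ := h₁.agree hA₂
    have hv₂ := (hA₂ 9 (by norm_num)).trans hv₁
    refine Block.seq (K := 10) (Block.forLoop ?_ fun _ _ σ' hA _ => ?_) fun σ₃ hA₃ => ?_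
    · exact fun σ' hA => (h₂.agree hA).2.1
    · exact block_layerProg (h₂.agree hA)
    have h₃ := h₂.agree hA₃
    have hv₃ := (hA₃ 9 (by norm_num)).trans hv₂
    refine Block.forLoop ?_ fun j _ σ' hA hj => ?_
    · intro σ' hA
      simp [NExp.eval, (h₃.agree hA).2.1]
    · have h₄ := h₃.agree hA
      have hv₄ := (hA 9 (by norm_num)).trans hv₃
      refine (Block.rstore _ _ _ _ _).cast rfl ?_
      simp [NExp.eval, RExp.eval, eval_clipExp h₄, h₄.1, hv₄, hj, addStep]
  · simp only [trialCost]
    ring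

theorem eval_nodeExp {σ : Store} {j : ℕ} (h : Ready n m N B σ) (hj : σ.nvar 8 = j) :
    nodeExp.eval σ = 2 * j / m - 1 := by
  simp [nodeExp, RExp.eval, NExp.eval, h.2.1, hj]

theorem block_chebProg {σ : Store} {j k : ℕ} (h : Ready n m N B σ) (hj : σ.nvar 8 = j)
    (hk : σ.nvar 9 = k) : Block L 10 chebProg σ 3 (chebStep m j k σ.rarr) := by
  refine Block.seq (m := 1) (m' := 1) ((Block.rstore _ _ _ _ _).cast rfl ?_) fun σ' hA =>
    (Block.rstore _ _ _ _ _).cast rfl ?_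
  · simp [NExp.eval, RExp.eval, eval_absExp, h.2.1, hj, hk]
  · have h' := h.agree hA
    have hj' := (hA 8 (by norm_num)).trans hj
    have hk' := (hA 9 (by norm_num)).trans hk
    simp [NExp.eval, RExp.eval, eval_nodeExp h' hj', hk']

theorem block_nodeProg {σ : Store} {j : ℕ} (h : Ready n m N B σ) (hj : σ.nvar 8 = j) :
    Block L 9 nodeProg σ ((m - 1) * 6 + 7) (nodeStep m j σ.rarr) := by
  refine (Block.seq (m' := 1 + (1 + (1 + (1 + ((m - 1) * (3 + 3) + 1)))))
    ((Block.rstore _ _ _ _ _).cast rfl ?_) fun σ₁ hA₁ => ?_).cast ?_ rfl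
  · simp [NExp.eval, RExp.eval]
  · refine Block.seq (K := 9) ((Block.rstore _ _ _ _ _).cast rfl ?_) fun σ₂ hA₂ => ?_
    · simp [NExp.eval, eval_nodeExp (h.agree hA₁) ((hA₁ 8 (by norm_num)).trans hj)]
    · have h₂ := (h.agree hA₁).agree hA₂
      have hj₂ := (hA₂ 8 (by norm_num)).trans ((hA₁ 8 (by norm_num)).trans hj)
      refine Block.forLoop ?_ fun k _ σ' hA hk => ?_
      · intro σ' hA
        simp [NExp.eval, (h₂.agree hA).2.1]
      · exact block_chebProg (h₂.agree hA) ((hA 8 (by norm_num)).trans hj₂) hk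
  · ring

def outputCost (m : ℕ) : ℕ := (m + 1) * 4 + (m + 1) * ((m - 1) * 6 + 10) + 9

theorem block_outputProg {σ : Store} (h : Ready n m N B σ) :
    Block L 8 outputProg σ (outputCost m) (outputStep m σ.rarr) := by
  refine (Block.seq (m := 1 + (1 + ((m + 1) * (1 + 3) + 1)))
    (m' := 1 + (1 + (1 + (1 + ((m + 1) * ((m - 1) * 6 + 7 + 3) + 1)))))
    (Block.forLoop ?_ fun j _ σ' hA hj => ?_) fun σ₁ hA₁ => ?_).cast ?_ rfl
  · intro σ' hA
    simp [NExp.eval, (h.agree hA).2.1]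
  · refine (Block.rstore _ _ _ _ _).cast rfl ?_
    simp [NExp.eval, RExp.eval, eval_absExp, hj, totalStep]
  · refine Block.seq (K := 8) ((Block.rstore _ _ _ _ _).cast rfl ?_) fun σ₂ hA₂ => ?_
    · simp [NExp.eval, RExp.eval]
    · have h₂ := (h.agree hA₁).agree hA₂
      refine Block.forLoop ?_ fun j _ σ' hA hj => ?_
      · intro σ' hA
        simp [NExp.eval, (h₂.agree hA).2.1]
      · exact block_nodeProg (h₂.agree hA) hj
  · simp only [outputCost]
    ring

def mainStep (L : Fin n → List (Fin n)) (m N B : ℕ) (a : Mem) : Sampler Mem :=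
  (Sampler.iter N (fun _ => trialStep L m B) a).bind (outputStep m)

theorem block_mainProg {σ : Store} (h : Ready n m N B σ) :
    Block L 8 mainProg σ (N * (trialCost n m + 3) + outputCost m + 4)
      (mainStep L m N B σ.rarr) := by
  refine (Block.seq (m := 1 + (1 + (N * (trialCost n m + 3) + 1))) (m' := outputCost m)
    (T := Sampler.iter N (fun _ => trialStep L m B) σ.rarr)
    (Block.forLoop ?_ fun _ _ σ' hA _ => ?_) fun σ₁ hA₁ => ?_).cast ?_ rfl
  · exact fun σ' hA => (h.agree hA).2.2.1
  · exact block_trialProg (h.agree hA)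
  · exact block_outputProg (h.agree hA₁)
  · ring

end RAM

/-! ## Parameters, halting and running time -/

namespace RAM

variable {n : ℕ} {L : Fin n → List (Fin n)}

/-- The expectation of the time used cannot decrease in a step. -/
theorem tsum_time_le_step (c : Config) :
    (c.time : ℝ≥0∞) ≤ ∑' c', step L c c' * (c'.time : ℝ≥0∞) := by
  have key : ∀ c' ∈ (step L c).support, c.time ≤ c'.time := by
    intro c' hc'
    rcases c with ⟨_ | ⟨p, k⟩, σ, t⟩
    · simp only [step, PMF.mem_support_pure_iff] at hc'
      subst hc'
      exact le_rfl
    · cases p <;> simp only [step, PMF.mem_support_pure_iff, PMF.mem_support_map_iff] at hc'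
      · obtain ⟨_, _, rfl⟩ := hc'
        simp
      all_goals
        subst hc'
        simp
  calc (c.time : ℝ≥0∞) = ∑' c', step L c c' * (c.time : ℝ≥0∞) := by
        rw [ENNReal.tsum_mul_right, PMF.tsum_coe, one_mul]
    _ ≤ _ := by
        refine ENNReal.tsum_le_tsum fun c' => ?_
        by_cases h : c' ∈ (step L c).support
        · gcongr
          exact key c' h
        · simp [(PMF.apply_eq_zero_iff _ _).2 h]

theorem tsum_bind {α : Type*} (μ : PMF α) (κ : α → PMF α) (f : α → ℝ≥0∞) :
    ∑' c, μ.bind κ c * f c = ∑' c, μ c * ∑' c', κ c c' * f c' := by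
  simp only [PMF.bind_apply, ← ENNReal.tsum_mul_right, ← ENNReal.tsum_mul_left]
  rw [ENNReal.tsum_comm]
  simp only [mul_assoc]

theorem monotone_tsum_time (c : Config) :
    Monotone (fun m => ∑' c', runFor L c m c' * (c'.time : ℝ≥0∞)) := by
  refine monotone_nat_of_le_succ fun m => ?_
  simp only [runFor, tsum_bind]
  exact ENNReal.tsum_le_tsum fun c' => by gcongr; exact tsum_time_le_step c'

theorem runFor_halted (σ : Store) (t m : ℕ) :
    runFor L ⟨[], σ, t⟩ m = PMF.pure ⟨[], σ, t⟩ := by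
  induction m with
  | zero => rfl
  | succ m ih => rw [runFor, ih, PMF.pure_bind, step]

section
variable {P : Prog} {ε δ : ℝ} {M : ℕ} {U : Sampler Store}

theorem Runs.runFor_start (h : Runs L P (inputStore n ε δ) M U) (r : ℕ) :
    runFor L (start P n ε δ) (M + r) = U.toPMF.map (fun σ => ⟨[], σ, M⟩) := by
  rw [runFor_add, start, h [] 0, PMF.bind_map]
  simp only [Function.comp_def, runFor_halted, zero_add]
  rfl

theorem Runs.expectedTime_le (h : Runs L P (inputStore n ε δ) M U) :
    expectedTime P L ε δ ≤ M := by
  refine iSup_le fun m => (monotone_tsum_time _ (Nat.le_add_left m M)).trans ?_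
  simp only [h.runFor_start]
  calc _ ≤ ∑' c, (U.toPMF.map (fun σ => (⟨[], σ, M⟩ : Config))) c * (M : ℝ≥0∞) := by
        refine ENNReal.tsum_le_tsum fun c => ?_
        by_cases hc : c ∈ (U.toPMF.map (fun σ => (⟨[], σ, M⟩ : Config))).support
        · obtain ⟨σ, _, rfl⟩ := (PMF.mem_support_map_iff _ _ _).1 hc
          exact le_rfl
        · simp [(PMF.apply_eq_zero_iff _ _).2 hc]
    _ = M := by rw [ENNReal.tsum_mul_right, PMF.tsum_coe, one_mul]

open Classical in
theorem Runs.le_haltProb (h : Runs L P (inputStore n ε δ) M U) (S : Set Store) :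
    ENNReal.ofReal (U.expect (fun σ => if σ ∈ S then 1 else 0)) ≤ haltProb P L ε δ S := by
  rw [← Sampler.toOuterMeasure_toPMF]
  refine le_trans (le_of_eq ?_) (le_iSup _ M)
  rw [← Nat.add_zero M, h.runFor_start 0, PMF.toOuterMeasure_map_apply]
  congr 1
  ext σ
  simp

theorem haltProb_le_one (S : Set Store) : haltProb P L ε δ S ≤ 1 := by
  refine iSup_le fun m => ?_
  rw [PMF.toOuterMeasure_apply, ← PMF.tsum_coe (runFor L (start P n ε δ) m)]
  exact ENNReal.tsum_le_tsum fun c => Set.indicator_le_self _ _ _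

end

/-! ### Computing the parameters by counting, in the absence of rounding -/

theorem Runs.while_pure {b : BExp} {p : Prog} {f : Store → Store} {c : ℕ}
    (hp : ∀ σ, Runs L p σ c (.pure (f σ))) (r : ℕ) : ∀ σ : Store,
      (∀ i < r, b.eval (f^[i] σ)) → ¬ b.eval (f^[r] σ) →
      Runs L (.loop b p) σ (r * (c + 1) + 1) (.pure (f^[r] σ)) := by
  induction r with
  | zero =>
    intro σ _ h
    simpa using Runs.loop_false (L := L) (p := p) h
  | succ r ih =>
    intro σ h h'
    have := Runs.loop_true (U := fun σ' => .pure (f^[r] σ')) (h 0 (by omega)) (hp σ)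
      (ih (f σ) (fun i hi => h (i + 1) (by omega)) h')
    rwa [show 1 + (c + (r * (c + 1) + 1)) = (r + 1) * (c + 1) + 1 by ring] at this

/-- Integer variable `1` := the least `a` with `1 ≤ a ε`. -/
def invProg : Prog :=
  .loop (.rlt (.mul (.ofInt (.var 1)) (.var 0)) (.ofInt (.lit 1)))
    (.instr (.nset 1 (.add (.var 1) (.lit 1))))

/-- Integer variable `2` := the least `b` with `2⁻ᵇ ≤ δ`. -/
def logProg : Prog :=
  .seq (.instr (.rset 2 (.ofInt (.lit 1)))) <|
  .loop (.rlt (.var 1) (.var 2))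
    (.seq (.instr (.rset 2 (.div (.var 2) (.ofInt (.lit 2)))))
      (.instr (.nset 2 (.add (.var 2) (.lit 1)))))

theorem runs_invProg (σ : Store) (hσ : σ.nvar 1 = 0) (hε : 0 < σ.rvar 0) :
    Runs L invProg σ (⌈1 / σ.rvar 0⌉₊ * 2 + 1) (.pure (σ.setN 1 ⌈1 / σ.rvar 0⌉₊)) := by
  have hf : ∀ i : ℕ, (fun τ : Store => τ.setN 1 (τ.nvar 1 + 1))^[i] σ = σ.setN 1 i := by
    intro i
    induction i with
    | zero =>
      have h : Function.update σ.nvar 1 0 = σ.nvar := by rw [← hσ, Function.update_eq_self]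
      simp [Store.setN, h]
    | succ i ih => rw [Function.iterate_succ_apply', ih]; simp [Store.setN]
  have h := Runs.while_pure (L := L)
    (b := .rlt (.mul (.ofInt (.var 1)) (.var 0)) (.ofInt (.lit 1)))
    (p := .instr (.nset 1 (.add (.var 1) (.lit 1)))) (f := fun τ => τ.setN 1 (τ.nvar 1 + 1))
    (c := 1) (fun τ => Runs.instr rfl rfl) ⌈1 / σ.rvar 0⌉₊ σ ?_ ?_
  · rw [hf] at h
    exact h
  · intro i hi
    rw [hf]
    simp only [BExp.eval, RExp.eval, NExp.eval, Store.setN, Function.update_self, Nat.cast_one]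
    exact (lt_div_iff₀ hε).1 (Nat.lt_ceil.1 hi)
  · rw [hf]
    simp only [BExp.eval, RExp.eval, NExp.eval, Store.setN, Function.update_self, Nat.cast_one,
      not_lt]
    exact (div_le_iff₀ hε).1 (Nat.le_ceil _)

theorem runs_logProg (σ : Store) (hσ : σ.nvar 2 = 0) (hδ : 0 < σ.rvar 1) :
    ∃ σ', Runs L logProg σ (⌈Real.logb 2 (1 / σ.rvar 1)⌉₊ * 4 + 3) (.pure σ') ∧
      σ'.nvar = Function.update σ.nvar 2 ⌈Real.logb 2 (1 / σ.rvar 1)⌉₊ ∧ σ'.rarr = σ.rarr := by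
  set b := ⌈Real.logb 2 (1 / σ.rvar 1)⌉₊ with hb
  let f : Store → Store := fun τ => (τ.setR 2 (τ.rvar 2 / 2)).setN 2 (τ.nvar 2 + 1)
  have hf : ∀ i : ℕ, f^[i] (σ.setR 2 1) = (σ.setN 2 i).setR 2 ((1 / 2) ^ i) := by
    intro i
    induction i with
    | zero =>
      have h : Function.update σ.nvar 2 0 = σ.nvar := by rw [← hσ, Function.update_eq_self]
      simp [Store.setN, Store.setR, h]
    | succ i ih =>
      rw [Function.iterate_succ_apply', ih]
      simp only [f, Store.setN, Store.setR, Function.update_self, Function.update_idem, pow_succ]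
      norm_num [div_eq_mul_inv]
  have hp : ∀ τ, Runs L (.seq (.instr (.rset 2 (.div (.var 2) (.ofInt (.lit 2)))))
      (.instr (.nset 2 (.add (.var 2) (.lit 1))))) τ 3 (.pure (f τ)) := by
    intro τ
    refine Runs.seq (T := .pure (τ.setR 2 (τ.rvar 2 / 2)))
      (U := fun τ' => .pure (τ'.setN 2 (τ'.nvar 2 + 1))) (Runs.instr rfl ?_) (Runs.instr rfl rfl)
    simp [Instr.exec, RExp.eval, NExp.eval, Sampler.toPMF]
  have hlog : ∀ i : ℕ, σ.rvar 1 < (1 / 2 : ℝ) ^ i ↔ (i : ℝ) < Real.logb 2 (1 / σ.rvar 1) := by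
    intro i
    rw [Real.lt_logb_iff_rpow_lt (by norm_num) (by positivity), Real.rpow_natCast, one_div_pow,
      lt_one_div hδ (by positivity)]
  refine ⟨f^[b] (σ.setR 2 1), ?_, ?_, ?_⟩
  · have h := Runs.while_pure (b := .rlt (.var 1) (.var 2)) hp b (σ.setR 2 1) ?_ ?_
    · have h' : Runs L (.instr (.rset 2 (.ofInt (.lit 1)))) σ 1 (.pure (σ.setR 2 1)) :=
        Runs.instr rfl (by simp [Instr.exec, RExp.eval, NExp.eval, Sampler.toPMF])
      have := h'.seq (U := fun τ => .pure (f^[b] τ)) h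
      rwa [show 1 + (1 + (b * (3 + 1) + 1)) = b * 4 + 3 by ring] at this
    · intro i hi
      rw [hf]
      simp only [BExp.eval, RExp.eval, Store.setN, Store.setR, Function.update_self, ne_eq,
        Nat.reduceEqDiff, not_false_eq_true, Function.update_of_ne]
      exact (hlog i).2 (Nat.lt_ceil.1 hi)
    · rw [hf]
      simp only [BExp.eval, RExp.eval, Store.setN, Store.setR, Function.update_self, ne_eq,
        Nat.reduceEqDiff, not_false_eq_true, Function.update_of_ne, hlog, not_lt]
      exact Nat.le_ceil _
  · rw [hf]
    rfl
  · rw [hf]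
    rfl

/-- The degree of the polynomials, for accuracy `1 / a`. -/
def degreeFor (a : ℕ) : ℕ := 16 * (a * a)

/-- The clipping bound. -/
def boundFor (a : ℕ) : ℕ := 48 * (a * (degreeFor a + 1))

/-- The number of trials, for accuracy `1 / a` and failure probability `2⁻ᵇ`. -/
def trialsFor (a b : ℕ) : ℕ :=
  1024 * ((a * (degreeFor a + 1)) * (a * (degreeFor a + 1))) * (2 * (degreeFor a + 1) + b)

def setupProg : Prog :=
  .seq invProg <| .seq logProg <|
  .seq (.instr (.nset 3 (.mul (.lit 16) (.mul (.var 1) (.var 1))))) <|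
  .seq (.instr (.nset 6 (.mul (.var 1) (.add (.var 3) (.lit 1))))) <|
  .seq (.instr (.nset 5 (.mul (.lit 48) (.var 6)))) <|
  .instr (.nset 4 (.mul (.mul (.lit 1024) (.mul (.var 6) (.var 6)))
    (.add (.mul (.lit 2) (.add (.var 3) (.lit 1))) (.var 2))))

theorem Runs.seq_pure {p q : Prog} {σ σ' : Store} {m m' : ℕ} {T : Sampler Store}
    (hp : Runs L p σ m (.pure σ')) (hq : Runs L q σ' m' T) :
    Runs L (.seq p q) σ (1 + (m + m')) T :=
  Runs.seq (U := fun _ => T) hp hq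

theorem Runs.cast {p : Prog} {σ : Store} {m m' : ℕ} {T : Sampler Store}
    (h : Runs L p σ m T) (hm : m = m') : Runs L p σ m' T := hm ▸ h

theorem runs_nset (σ : Store) (x : ℕ) (e : NExp) :
    Runs L (.instr (.nset x e)) σ 1 (.pure (σ.setN x (e.eval σ))) :=
  Runs.instr rfl rfl

theorem runs_setupProg {ε δ : ℝ} (hε : 0 < ε) (hδ : 0 < δ) {a b : ℕ} (ha : a = ⌈1 / ε⌉₊)
    (hb : b = ⌈Real.logb 2 (1 / δ)⌉₊) :
    ∃ σ, Runs L setupProg (inputStore n ε δ) (a * 2 + b * 4 + 13) (.pure σ) ∧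
      Ready n (degreeFor a) (trialsFor a b) (boundFor a) σ ∧ σ.rarr = fun _ _ => 0 := by
  have h₁ := runs_invProg (L := L) (inputStore n ε δ) rfl hε
  obtain ⟨σ₂, h₂, hn₂, hr₂⟩ :=
    runs_logProg (L := L) ((inputStore n ε δ).setN 1 ⌈1 / ε⌉₊) rfl hδ
  change Runs L invProg _ (⌈1 / ε⌉₊ * 2 + 1) (.pure ((inputStore n ε δ).setN 1 ⌈1 / ε⌉₊)) at h₁
  change Runs L logProg _ (⌈Real.logb 2 (1 / δ)⌉₊ * 4 + 3) _ at h₂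
  change σ₂.nvar = Function.update _ 2 ⌈Real.logb 2 (1 / δ)⌉₊ at hn₂
  rw [← ha] at h₁ h₂ hn₂ hr₂
  rw [← hb] at h₂ hn₂
  refine ⟨_, Runs.cast (Runs.seq_pure h₁ (Runs.seq_pure h₂ (Runs.seq_pure (runs_nset σ₂ _ _)
    (Runs.seq_pure (runs_nset _ _ _) (Runs.seq_pure (runs_nset _ _ _) (runs_nset _ _ _))))))
    (by ring), ?_, hr₂⟩
  simp [Ready, Store.setN, NExp.eval, hn₂, inputStore, degreeFor, trialsFor, boundFor]

/-- The program. -/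
def densityProg : Prog := .seq setupProg (.seq mainProg (.instr (.nset 0 (.var 3))))

def densityCost (n a b : ℕ) : ℕ :=
  trialsFor a b * (trialCost n (degreeFor a) + 3) + outputCost (degreeFor a) + a * 2 + b * 4 + 20

theorem runs_densityProg {ε δ : ℝ} (hε : 0 < ε) (hδ : 0 < δ) {a b : ℕ} (ha : a = ⌈1 / ε⌉₊)
    (hb : b = ⌈Real.logb 2 (1 / δ)⌉₊) :
    ∃ U : Sampler Store, Runs L densityProg (inputStore n ε δ) (densityCost n a b) U ∧
      U.All (fun σ => σ.nvar 0 = degreeFor a) ∧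
      U.map Store.rarr = mainStep L (degreeFor a) (trialsFor a b) (boundFor a) (fun _ _ => 0) := by
  obtain ⟨σ, hσ, hR, hr⟩ := runs_setupProg (L := L) (n := n) hε hδ ha hb
  obtain ⟨V, hV, hA, hT⟩ := block_mainProg (L := L) hR
  refine ⟨V.map (fun τ => τ.setN 0 (τ.nvar 3)), ?_, ?_, ?_⟩
  · have h := hσ.seq_pure (hV.seq (U := fun τ => .pure (τ.setN 0 (τ.nvar 3)))
      (Sampler.All_of_forall fun τ => runs_nset τ 0 (.var 3)))
    have hc : 1 + (a * 2 + b * 4 + 13 + (1 + (trialsFor a b * (trialCost n (degreeFor a) + 3) +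
        outputCost (degreeFor a) + 4 + 1))) = densityCost n a b := by
      simp only [densityCost]
      ring
    rw [hc] at h
    exact h
  -- The final instruction replaces `n` in integer variable `0` by the number of coefficients, as
  -- the output convention demands.
  · rw [Sampler.All_map_iff]
    exact hA.mono fun τ h => by simp [Store.setN, (h 3 (by norm_num)).trans hR.2.1]
  · rw [Sampler.map_map, ← hr, ← hT]
    rfl

end RAM

/-! ## Random neighbors and the normalized adjacency matrix -/

theorem Sampler.expect_uniform {n : ℕ} (hn : 0 < n) (f : ℕ → ℝ) :
    (Sampler.uniform n).expect f = (∑ v : Fin n, f v) / n := by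
  obtain ⟨m, rfl⟩ : ∃ m, n = m + 1 := ⟨n - 1, by omega⟩
  simp [Sampler.uniform, Sampler.expect]

theorem Sampler.sq_expect_le {α : Type} (t : Sampler α) (f : α → ℝ) :
    t.expect f ^ 2 ≤ t.expect (fun a => f a ^ 2) := by
  have h : 0 ≤ t.expect (fun a => (f a - t.expect f) ^ 2) := expect_nonneg fun a => sq_nonneg _
  have h2 : t.expect (fun a => (f a - t.expect f) ^ 2) =
      t.expect (fun a => f a ^ 2) - 2 * t.expect f * t.expect f + t.expect f ^ 2 := by
    have h3 : (fun a => (f a - t.expect f) ^ 2) =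
        fun a => (f a ^ 2 - (2 * t.expect f) * f a) + t.expect f ^ 2 := by
      funext a
      ring
    rw [h3, expect_add, expect_sub, expect_const_mul, expect_const]
  nlinarith

namespace SpectralDensity

variable {n : ℕ} (G : SimpleGraph (Fin n))

open Classical in
theorem normalizedAdjacency_apply (i y : Fin n) : normalizedAdjacency G i y =
    if G.Adj i y then (√(G.degree i : ℝ))⁻¹ * (√(G.degree y : ℝ))⁻¹ else 0 := by
  rw [normalizedAdjacency, Matrix.mul_diagonal, Matrix.diagonal_mul, SimpleGraph.adjMatrix_apply]
  split_ifs <;> simp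

open Classical in
/-- The mean over the random neighbors of `i`, up to a factor `deg i`, of squares of entries. -/
def neighborEnergy (z : Fin n → ℝ) (i : Fin n) : ℝ :=
  ∑ y, if G.Adj i y then z y ^ 2 / G.degree y else 0

/-- After exchanging the sums, the term of `y` is counted once for each of its `deg y` neighbors,
which cancels the division by `deg y`. -/
theorem sum_neighborEnergy_le (z : Fin n → ℝ) : ∑ i, neighborEnergy G z i ≤ ∑ y, z y ^ 2 := by
  classical
  simp only [neighborEnergy]
  rw [Finset.sum_comm]
  refine Finset.sum_le_sum fun y _ => ?_
  rw [← Finset.sum_filter, Finset.sum_const, nsmul_eq_mul]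
  have hcard : (Finset.univ.filter fun i => G.Adj i y).card = G.degree y := by
    rw [← SimpleGraph.card_neighborFinset_eq_degree]
    congr 1
    ext i
    simp [SimpleGraph.adj_comm]
  rw [hcard]
  rcases eq_or_ne (G.degree y) 0 with h | h
  · simpa [h] using sq_nonneg (z y)
  · rw [mul_div_cancel₀ _ (Nat.cast_ne_zero.2 h)]

end SpectralDensity

namespace RAM

open SpectralDensity

variable {n : ℕ} {G : SimpleGraph (Fin n)} {L : Fin n → List (Fin n)}

open Classical in
theorem deg_eq_degree (hL : IsAdjacencyList G L) (i : Fin n) : deg L i = G.degree i := by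
  rw [deg, nbrs, dif_pos i.2, List.length_map, ← SimpleGraph.card_neighborFinset_eq_degree,
    ← List.toFinset_card_of_nodup (hL i).1]
  congr 1
  ext j
  simp [(hL i).2]

open Classical in
theorem expect_pick (hL : IsAdjacencyList G L) (i : Fin n) (hd : G.degree i ≠ 0) (f : ℕ → ℝ) :
    (pick L i).expect f = (∑ y : Fin n, if G.Adj i y then f y else 0) / G.degree i := by
  rw [pick, Sampler.expect_map, deg_eq_degree hL, Sampler.expect_uniform (by omega)]
  congr 1
  rw [← Finset.sum_filter]
  have h1 : (Finset.univ.filter fun y => G.Adj i y) = (L i).toFinset := by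
    ext j
    simp [(hL i).2]
  rw [h1, List.sum_toFinset _ (hL i).1]
  have h2 : ((L i).map fun y : Fin n => f y) = (nbrs L i).map f := by
    simp [nbrs, Function.comp_def]
  have h3 : (nbrs L i).length = G.degree i := deg_eq_degree hL i
  rw [h2, ← h3, ← Fin.sum_univ_fun_getElem]
  simp

theorem pick_of_isolated (i : Fin n) (hd : deg L i = 0) (f : ℕ → ℝ) :
    (pick L i).expect f = f 0 := by
  rw [pick, hd, Sampler.uniform, Sampler.map_pure, Sampler.expect_pure]
  rw [List.getD_eq_default]
  rw [← deg, hd]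

variable {m : ℕ} {u : ℕ → ℝ} {p : ℕ}

theorem sum_adj_of_isolated (i : Fin n) [Fintype (G.neighborSet i)]
    [DecidableRel G.Adj] (hd : G.degree i = 0) (f : Fin n → ℝ) :
    (∑ y, if G.Adj i y then f y else 0) = 0 := by
  refine Finset.sum_eq_zero fun y _ => if_neg fun h => ?_
  have := (G.degree_pos_iff_exists_adj i).2 ⟨y, h⟩
  omega

/-- Importance weighting: a neighbor is drawn with probability `1 / d_i`, and `√(d_i / d_y) / d_i =
1 / √(d_i d_y)` is the matrix entry. For an isolated vertex the square root vanishes, in agreement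
with the zero row. -/
theorem expect_gain (hL : IsAdjacencyList G L) (i : Fin n) :
    (pick L i).expect (gain L m u p i) =
      (∑ y : Fin n, normalizedAdjacency G i y * (u (p + y) - u (n + (p + y)))) / (2 * m) := by
  classical
  have hA : (∑ y : Fin n, normalizedAdjacency G i y * (u (p + y) - u (n + (p + y)))) =
      ∑ y : Fin n, if G.Adj i y then (√(G.degree i : ℝ))⁻¹ * (√(G.degree y : ℝ))⁻¹ *
        (u (p + y) - u (n + (p + y))) else 0 := by
    simp only [normalizedAdjacency_apply, ite_mul, zero_mul]
  rw [hA]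
  rcases eq_or_ne (G.degree i) 0 with hd | hd
  · rw [pick_of_isolated i (by rw [deg_eq_degree hL, hd]), sum_adj_of_isolated i hd]
    simp [gain, deg_eq_degree hL, hd]
  · rw [expect_pick hL i hd, Finset.sum_div, Finset.sum_div]
    refine Finset.sum_congr rfl fun y _ => ?_
    split_ifs with h
    · rw [gain, deg_eq_degree hL, deg_eq_degree hL, Real.sqrt_div (Nat.cast_nonneg _)]
      have h1 : (0 : ℝ) < G.degree i := by positivity
      have h2 := Real.mul_self_sqrt h1.le
      have h3 : √(G.degree i : ℝ) / G.degree i = (√(G.degree i : ℝ))⁻¹ := by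
        have := Real.sqrt_pos.2 h1
        field_simp
        nlinarith
      rw [← h3]
      ring
    · simp

theorem expect_gain_sq (hL : IsAdjacencyList G L) (i : Fin n) :
    (pick L i).expect (fun y => gain L m u p i y ^ 2) =
      neighborEnergy G (fun y => u (p + y) - u (n + (p + y))) i / (2 * m) ^ 2 := by
  classical
  simp only [neighborEnergy]
  rcases eq_or_ne (G.degree i) 0 with hd | hd
  · rw [pick_of_isolated i (by rw [deg_eq_degree hL, hd]), sum_adj_of_isolated i hd]
    simp [gain, deg_eq_degree hL, hd]
  · rw [expect_pick hL i hd, Finset.sum_div, Finset.sum_div]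
    refine Finset.sum_congr rfl fun y _ => ?_
    split_ifs with h
    · rw [gain, deg_eq_degree hL, deg_eq_degree hL, div_pow, mul_pow,
        Real.sq_sqrt (by positivity)]
      have h1 : (G.degree i : ℝ) ≠ 0 := by positivity
      field_simp
    · simp

/-- Jensen's inequality for a single random neighbor: the squared mean of `gain` is at most its
second moment. -/
theorem sq_mulVec_le (hL : IsAdjacencyList G L) (z : Fin n → ℝ) (i : Fin n) :
    (∑ y, normalizedAdjacency G i y * z y) ^ 2 ≤ neighborEnergy G z i := by
  -- Two rows, `z` followed by zeros, so that the difference of rows entering `gain` is `z` itself.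
  let u : ℕ → ℝ := fun c => if h : c < n then z ⟨c, h⟩ else 0
  have hu : ∀ y : Fin n, u (0 + y) - u (n + (0 + y)) = z y := by
    intro y
    simp [u]
  have h := Sampler.sq_expect_le (pick L i) (gain L 1 u 0 i)
  rw [expect_gain hL, expect_gain_sq hL] at h
  simp only [hu, div_pow] at h
  have h2 : (0 : ℝ) < (2 * (1 : ℕ)) ^ 2 := by norm_num
  exact (div_le_div_iff_of_pos_right h2).1 h

/-- Contractivity of the normalized adjacency matrix, obtained from the sampling identity without
spectral theory. Both the energy bound and the bound on the eigenvalues rest on it. -/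
theorem sum_sq_mulVec_le (hL : IsAdjacencyList G L) (z : Fin n → ℝ) :
    ∑ i, (∑ y, normalizedAdjacency G i y * z y) ^ 2 ≤ ∑ i, z i ^ 2 :=
  (Finset.sum_le_sum fun i _ => sq_mulVec_le hL z i).trans (sum_neighborEnergy_le G z)

end RAM

/-! ### Moments of sums of independent draws -/

namespace Sampler

/-- The mean of a sum of independent copies. -/
theorem expect_iter_add {α : Type} (T : Sampler α) (g : α → ℝ) (M : ℕ) (x : ℝ) :
    (iter M (fun _ x => T.bind fun y => .pure (x + g y)) x).expect (fun z => z) =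
      x + M * T.expect g := by
  induction M with
  | zero => simp
  | succ M ih =>
    rw [iter_succ, expect_bind]
    simp only [expect_bind, expect_pure, expect_add, expect_const] at ih ⊢
    rw [ih]
    push_cast
    ring

/-- The second moment of a sum of independent copies. -/
theorem expect_iter_add_sq {α : Type} (T : Sampler α) (g : α → ℝ) (M : ℕ) (x : ℝ) :
    (iter M (fun _ x => T.bind fun y => .pure (x + g y)) x).expect (fun z => z ^ 2) ≤
      (x + M * T.expect g) ^ 2 + M * T.expect (fun y => g y ^ 2) := by
  induction M with
  | zero => simp
  | succ M ih =>
    have h1 := expect_iter_add T g M x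
    rw [iter_succ, expect_bind]
    set S := iter M (fun _ x => T.bind fun y => .pure (x + g y)) x
    have h2 : ∀ z : ℝ, (T.bind fun y => (.pure (z + g y) : Sampler ℝ)).expect (fun z => z ^ 2) =
        z ^ 2 + 2 * T.expect g * z + T.expect (fun y => g y ^ 2) := by
      intro z
      have h3 : (fun y => (pure (z + g y) : Sampler ℝ).expect (fun z => z ^ 2)) =
          fun y => (z ^ 2 + (2 * z) * g y) + g y ^ 2 := by
        funext y
        simp only [expect_pure]
        ring
      rw [expect_bind, h3, expect_add, expect_add, expect_const, expect_const_mul]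
      ring
    simp only [h2]
    rw [expect_add, expect_add, expect_const_mul S _ (fun z => z), expect_const, h1]
    push_cast
    nlinarith [sq_nonneg (T.expect g)]

end Sampler

/-! ## Moments of one trial -/

namespace RAM

open SpectralDensity

variable {n : ℕ} {G : SimpleGraph (Fin n)} {L : Fin n → List (Fin n)} {m : ℕ}

/-- The distribution of the entry that is computed from the rows `u (p + ·)` and `u (n + p + ·)`. -/
def cellLaw (L : Fin n → List (Fin n)) (m : ℕ) (u : ℕ → ℝ) (p i : ℕ) : Sampler ℝ :=
  Sampler.iter m (fun _ x => (pick L i).bind fun y => .pure (x + gain L m u p i y))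
    ((u (p + i) + u (n + (p + i))) / 2)

/-- All samples for an entry modify one cell of array `2` and read only array `1`, so the memory
process is the image of a real-valued random walk. -/
theorem cellStep_eq (j i : ℕ) (a : Mem) :
    cellStep L m j i a = (cellLaw L m (a 1) (j * n) i).map (upd a 2 (n + (j * n + i))) := by
  rw [cellStep, cellLaw]
  refine Sampler.iter_map (f := upd a 2 (n + (j * n + i))) (fun _ _ x => ?_) _
  rw [Sampler.map_bind, sampleStep]
  simp [upd_upd, upd_self, upd_array_ne]

/-- The mean of an entry. -/
def cellMean (G : SimpleGraph (Fin n)) (u : ℕ → ℝ) (p : ℕ) (i : Fin n) : ℝ :=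
  (u (p + i) + u (n + (p + i))) / 2 +
    (∑ y : Fin n, normalizedAdjacency G i y * (u (p + y) - u (n + (p + y)))) / 2

theorem expect_cellLaw (hL : IsAdjacencyList G L) (hm : m ≠ 0) (u : ℕ → ℝ) (p : ℕ) (i : Fin n) :
    (cellLaw L m u p i).expect (fun z => z) = cellMean G u p i := by
  have h : (m : ℝ) ≠ 0 := Nat.cast_ne_zero.2 hm
  rw [cellLaw, Sampler.expect_iter_add, expect_gain hL, cellMean]
  field_simp

/-- Each of the `m` independent samples carries a factor `1 / (2 m)`, so the variances add up to one
`m`-th of that of a single unscaled sample. -/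
theorem expect_cellLaw_sq (hL : IsAdjacencyList G L) (hm : m ≠ 0) (u : ℕ → ℝ) (p : ℕ)
    (i : Fin n) : (cellLaw L m u p i).expect (fun z => z ^ 2) ≤ cellMean G u p i ^ 2 +
      neighborEnergy G (fun y => u (p + y) - u (n + (p + y))) i / (4 * m) := by
  have h : (m : ℝ) ≠ 0 := Nat.cast_ne_zero.2 hm
  refine (Sampler.expect_iter_add_sq _ _ _ _).trans (le_of_eq ?_)
  rw [expect_gain hL, expect_gain_sq hL, cellMean]
  field_simp
  ring

/-- Cells of array `2` are written one after the other, with laws that depend on array `1`. -/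
theorem all_grid (law : ℕ → (ℕ → ℝ) → Sampler ℝ) (N : ℕ) (a : Mem) :
    (Sampler.iter N (fun c a => (law c (a 1)).map (upd a 2 (n + c))) a).All
      (fun b => ∀ x, x ≠ 2 → b x = a x) := by
  refine Sampler.All_iter (P := fun _ (b : Mem) => ∀ x, x ≠ 2 → b x = a x) (fun _ _ => rfl)
    fun c _ b hb => ?_
  rw [Sampler.All_map_iff]
  exact Sampler.All_of_forall fun z x hx => (upd_array_ne _ _ _ hx).trans (hb x hx)

/-- Cell `c` is written in round `c` only, from array `1`, which no round changes. Only the marginal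
law of each cell is needed later; their joint law never enters. -/
theorem expect_grid (law : ℕ → (ℕ → ℝ) → Sampler ℝ) (f : ℝ → ℝ) (N : ℕ) (a : Mem) (c : ℕ)
    (hc : c < N) :
    (Sampler.iter N (fun c a => (law c (a 1)).map (upd a 2 (n + c))) a).expect
      (fun b => f (b 2 (n + c))) = (law c (a 1)).expect f := by
  induction N with
  | zero => omega
  | succ N ih =>
    rw [Sampler.iter_succ, Sampler.expect_bind]
    simp only [Sampler.expect_map]
    rcases Nat.lt_succ_iff_lt_or_eq.1 hc with h | rfl
    · rw [← ih h]
      congr 1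
      funext b
      have : n + c ≠ n + N := by omega
      simp only [upd_cell_ne _ _ _ this, Sampler.expect_const]
    · simp only [upd_self]
      rw [← Sampler.expect_const (Sampler.iter c _ a) ((law c (a 1)).expect f)]
      exact Sampler.expect_congr (all_grid law c a) fun b hb => by rw [hb 1 (by norm_num)]

theorem copy_eq (N : ℕ) (a : Mem) : ∃ b, Sampler.iter N (copyStep n) a = .pure b ∧
    (∀ c < N, b 1 (n + c) = a 2 (n + c)) ∧ (∀ p < n, b 1 p = a 1 p) ∧ ∀ x, x ≠ 1 → b x = a x := by
  induction N with
  | zero => exact ⟨a, rfl, by simp, by simp, by simp⟩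
  | succ N ih =>
    obtain ⟨b, hb, h1, h2, h3⟩ := ih
    refine ⟨upd b 1 (n + N) (b 2 (n + N)), by rw [Sampler.iter_succ, hb]; rfl, ?_, ?_, ?_⟩
    · intro c hc
      rcases Nat.lt_succ_iff_lt_or_eq.1 hc with h | rfl
      · rw [upd_cell_ne _ _ _ (by omega), h1 c h]
      · rw [upd_self, h3 2 (by norm_num)]
    · intro p hp
      rw [upd_cell_ne _ _ _ (by omega), h2 p hp]
    · intro x hx
      rw [upd_array_ne _ _ _ hx, h3 x hx]

/-- Flattening the loops over rows and entries into one loop over cells makes `expect_grid`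
applicable. -/
theorem layerStep_eq (a : Mem) : layerStep L m a =
    (Sampler.iter ((m + 1) * n) (fun c a =>
      (cellLaw L m (a 1) (c / n * n) (c % n)).map (upd a 2 (n + c))) a).bind
        (Sampler.iter ((m + 1) * n) (copyStep n)) := by
  rw [layerStep, Sampler.iter_iter]
  have h : (fun c => cellStep L m (c / n) (c % n)) = fun c a =>
      (cellLaw L m (a 1) (c / n * n) (c % n)).map (upd a 2 (n + c)) := by
    funext c b
    rw [cellStep_eq, Nat.div_add_mod']
  rw [h]

theorem all_layerStep (a : Mem) : (layerStep L m a).All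
    (fun b => (∀ p < n, b 1 p = a 1 p) ∧ ∀ x, x ≠ 1 → x ≠ 2 → b x = a x) := by
  rw [layerStep_eq]
  refine Sampler.All_bind
    (all_grid (n := n) (fun c u => cellLaw L m u (c / n * n) (c % n)) _ a) fun b hb => ?_
  obtain ⟨b', h, -, h2, h3⟩ := copy_eq (n := n) ((m + 1) * n) b
  rw [h]
  exact ⟨fun p hp => (h2 p hp).trans (by rw [hb 1 (by norm_num)]),
    fun x h h' => (h3 x h).trans (hb x h')⟩

theorem expect_layerStep (f : ℝ → ℝ) (a : Mem) {j : ℕ} (hj : j < m + 1) (i : Fin n) :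
    (layerStep L m a).expect (fun b => f (b 1 (n + (j * n + i)))) =
      (cellLaw L m (a 1) (j * n) i).expect f := by
  have hc : j * n + i < (m + 1) * n := by
    have := Nat.mul_le_mul_right n (Nat.succ_le_of_lt hj)
    rw [Nat.succ_mul] at this
    omega
  have hn : 0 < n := i.pos
  have hdiv : (j * n + i) / n = j := by
    rw [Nat.mul_comm, Nat.mul_add_div hn, Nat.div_eq_of_lt i.2, add_zero]
  have hmod : (j * n + i) % n = i := by
    rw [Nat.mul_comm, Nat.mul_add_mod, Nat.mod_eq_of_lt i.2]
  have h := expect_grid (n := n) (fun c u => cellLaw L m u (c / n * n) (c % n)) f _ a _ hc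
  simp only [hdiv, hmod] at h
  rw [layerStep_eq, Sampler.expect_bind, ← h]
  congr 1
  funext b
  obtain ⟨b', hb', h1, -⟩ := copy_eq (n := n) ((m + 1) * n) b
  rw [hb', Sampler.expect_pure, h1 _ hc]

theorem all_iter_layerStep (t : ℕ) (a : Mem) : (Sampler.iter t (fun _ => layerStep L m) a).All
    (fun b => (∀ p < n, b 1 p = a 1 p) ∧ ∀ x, x ≠ 1 → x ≠ 2 → b x = a x) := by
  refine Sampler.All_iter (P := fun _ (b : Mem) =>
    (∀ p < n, b 1 p = a 1 p) ∧ ∀ x, x ≠ 1 → x ≠ 2 → b x = a x)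
    ⟨fun _ _ => rfl, fun _ _ _ => rfl⟩ fun _ _ b hb => (all_layerStep b).mono fun b' h => ?_
  exact ⟨fun p hp => (h.1 p hp).trans (hb.1 p hp), fun x h1 h2 => (h.2 x h1 h2).trans (hb.2 x h1 h2)⟩

/-! ### The second moment -/

/-- With `P = (1 + A) / 2` this is the convexity bound `‖P x + (1 - P) y‖² ≤ ⟨x, P x⟩ + ⟨y, (1 - P)
y⟩`. The gap is `(‖x - y‖² - ‖A (x - y)‖²) / 4`, nonnegative because `A` is a contraction; symmetry
of `A` removes the cross terms. -/
theorem sum_sq_step_le {A : Matrix (Fin n) (Fin n) ℝ} (hA : A.IsHermitian)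
    (hA1 : ∀ z : Fin n → ℝ, ∑ i, (∑ y, A i y * z y) ^ 2 ≤ ∑ i, z i ^ 2) (x y : Fin n → ℝ) :
    ∑ i, ((x i + y i) / 2 + (∑ k, A i k * (x k - y k)) / 2) ^ 2 ≤
      (∑ i, x i ^ 2 + ∑ i, y i ^ 2) / 2 +
        (∑ i, x i * ∑ k, A i k * x k - ∑ i, y i * ∑ k, A i k * y k) / 2 := by
  set a : Fin n → ℝ := fun i => ∑ k, A i k * x k with ha
  set b : Fin n → ℝ := fun i => ∑ k, A i k * y k with hb
  have hab : ∀ i, ∑ k, A i k * (x k - y k) = a i - b i := fun i => by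
    simp only [ha, hb, mul_sub, Finset.sum_sub_distrib]
  have hsym : ∑ i, x i * b i = ∑ i, y i * a i := by
    simp only [ha, hb, Finset.mul_sum]
    rw [Finset.sum_comm]
    refine Finset.sum_congr rfl fun i _ => Finset.sum_congr rfl fun k _ => ?_
    have : A k i = A i k := by simpa using hA.apply i k
    rw [this]
    ring
  have h := hA1 (fun k => x k - y k)
  simp only [hab] at h ⊢
  change _ ≤ _ + (∑ i, x i * a i - ∑ i, y i * b i) / 2
  have key : ∑ i, ((x i + y i) / 2 + (a i - b i) / 2) ^ 2 =
      (∑ i, x i ^ 2 + ∑ i, y i ^ 2) / 2 + (∑ i, x i * a i - ∑ i, y i * b i) / 2 +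
      (∑ i, y i * a i - ∑ i, x i * b i) / 2 +
      (∑ i, (a i - b i) ^ 2 - ∑ i, (x i - y i) ^ 2) / 4 := by
    simp only [← Finset.sum_add_distrib, ← Finset.sum_sub_distrib, Finset.sum_div]
    refine Finset.sum_congr rfl fun i _ => ?_
    ring
  rw [key]
  linarith

/-- Summing the one-step bound, each intermediate row meets `(1 + A) / 2` once and `(1 - A) / 2`
once, which adds up to its squared norm. Row `0` is zero. -/
theorem sum_sum_sq_step_le {A : Matrix (Fin n) (Fin n) ℝ} (hA : A.IsHermitian)
    (hA1 : ∀ z : Fin n → ℝ, ∑ i, (∑ y, A i y * z y) ^ 2 ≤ ∑ i, z i ^ 2) (X : ℕ → Fin n → ℝ)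
    (hX : X 0 = 0) (J : ℕ) :
    ∑ j ∈ Finset.range J, ∑ i, ((X j i + X (j + 1) i) / 2 +
      (∑ k, A i k * (X j k - X (j + 1) k)) / 2) ^ 2 ≤
        ∑ j ∈ Finset.range J, ∑ i, X (j + 1) i ^ 2 := by
  have h : ∑ j ∈ Finset.range J, ∑ i, ((X j i + X (j + 1) i) / 2 +
      (∑ k, A i k * (X j k - X (j + 1) k)) / 2) ^ 2 ≤
        ∑ j ∈ Finset.range J, ∑ i, X (j + 1) i ^ 2 - (∑ i, X J i ^ 2) / 2 -
          (∑ i, X J i * ∑ k, A i k * X J k) / 2 := by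
    induction J with
    | zero => simp [hX]
    | succ J ih =>
      rw [Finset.sum_range_succ, Finset.sum_range_succ]
      have := sum_sq_step_le hA hA1 (X J) (X (J + 1))
      linarith
  -- The last row lacks its share `⟨X_J, (1 + A) X_J⟩ / 2`. This is nonnegative: expand `‖X_J + A
  -- X_J‖²` and use `‖A X_J‖ ≤ ‖X_J‖`.
  have h2 : 0 ≤ ∑ i, (X J i + ∑ k, A i k * X J k) ^ 2 :=
    Finset.sum_nonneg fun i _ => sq_nonneg _
  have h3 : ∑ i, (X J i + ∑ k, A i k * X J k) ^ 2 = ∑ i, X J i ^ 2 +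
      2 * ∑ i, X J i * ∑ k, A i k * X J k + ∑ i, (∑ k, A i k * X J k) ^ 2 := by
    rw [Finset.mul_sum, ← Finset.sum_add_distrib, ← Finset.sum_add_distrib]
    refine Finset.sum_congr rfl fun i _ => ?_
    ring
  have := hA1 (X J)
  linarith

/-- The sum of squares of the rows `1, …, m + 1`. -/
def energy (n m : ℕ) (u : ℕ → ℝ) : ℝ :=
  ∑ j ∈ Finset.range (m + 1), ∑ i : Fin n, u (n + (j * n + i)) ^ 2

/-- The mean of the new layer has at most the old energy. The noise is governed by the differences
of consecutive rows, whose squared norms sum to at most four times the energy; the factor `1 / (4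
m)` turns this into `1 / m`. -/
theorem expect_energy_layerStep (hL : IsAdjacencyList G L) (hm : m ≠ 0) (a : Mem)
    (h0 : ∀ p < n, a 1 p = 0) :
    (layerStep L m a).expect (fun b => energy n m (b 1)) ≤ (1 + 1 / m) * energy n m (a 1) := by
  have hm' : (0 : ℝ) < m := by positivity
  set X : ℕ → Fin n → ℝ := fun j i => a 1 (j * n + i) with hX
  have hX1 : ∀ j (i : Fin n), a 1 (n + (j * n + i)) = X (j + 1) i := by
    intro j i
    simp only [hX]
    congr 1
    ring
  have hX0 : X 0 = 0 := by
    funext i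
    simpa [hX] using h0 i i.2
  set q : ℕ → ℝ := fun j => ∑ i, X j i ^ 2 with hq
  have hq0 : q 0 = 0 := by simp [hq, hX0]
  have hqn : ∀ j, 0 ≤ q j := fun j => Finset.sum_nonneg fun i _ => sq_nonneg _
  have hE : energy n m (a 1) = ∑ j ∈ Finset.range (m + 1), q (j + 1) := by
    simp only [energy, hX1, hq]
  have hshift : ∑ j ∈ Finset.range (m + 1), q j ≤ ∑ j ∈ Finset.range (m + 1), q (j + 1) := by
    rw [Finset.sum_range_succ', hq0, add_zero, Finset.sum_range_succ (fun j => q (j + 1))]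
    linarith [hqn (m + 1)]
  have hcell : (layerStep L m a).expect (fun b => energy n m (b 1)) ≤
      ∑ j ∈ Finset.range (m + 1), ∑ i : Fin n, (cellMean G (a 1) (j * n) i ^ 2 +
        neighborEnergy G (fun y => a 1 (j * n + y) - a 1 (n + (j * n + y))) i / (4 * m)) := by
    simp only [energy, Sampler.expect_sum]
    refine Finset.sum_le_sum fun j hj => Finset.sum_le_sum fun i _ => ?_
    rw [expect_layerStep (fun z => z ^ 2) a (Finset.mem_range.1 hj) i]
    exact expect_cellLaw_sq hL hm _ _ _
  have hmean := sum_sum_sq_step_le (normalizedAdjacency_isHermitian G) (sum_sq_mulVec_le hL) X hX0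
    (m + 1)
  have hnoise : ∀ j, ∑ i, neighborEnergy G (fun y => X j y - X (j + 1) y) i / (4 * m) ≤
      (q j + q (j + 1)) / (2 * m) := by
    intro j
    rw [← Finset.sum_div]
    have h1 := sum_neighborEnergy_le G (fun y => X j y - X (j + 1) y)
    have h2 : ∑ y, (X j y - X (j + 1) y) ^ 2 ≤ 2 * (q j + q (j + 1)) := by
      simp only [hq, ← Finset.sum_add_distrib, Finset.mul_sum]
      refine Finset.sum_le_sum fun y _ => ?_
      nlinarith [sq_nonneg (X j y + X (j + 1) y)]
    calc _ ≤ 2 * (q j + q (j + 1)) / (4 * m) := by gcongr; exact h1.trans h2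
      _ = _ := by field_simp; ring
  have hnoise' : ∑ j ∈ Finset.range (m + 1), (q j + q (j + 1)) / (2 * m) ≤
      1 / m * energy n m (a 1) := by
    rw [← Finset.sum_div, Finset.sum_add_distrib, hE]
    calc _ ≤ (∑ j ∈ Finset.range (m + 1), q (j + 1) + ∑ j ∈ Finset.range (m + 1), q (j + 1)) /
        (2 * m) := by gcongr
      _ = _ := by field_simp; ring
  refine hcell.trans ?_
  simp only [Finset.sum_add_distrib, cellMean, hX1]
  change _ + ∑ j ∈ Finset.range (m + 1), ∑ i,
    neighborEnergy G (fun y => X j y - X (j + 1) y) i / (4 * m) ≤ _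
  have := Finset.sum_le_sum fun j (_ : j ∈ Finset.range (m + 1)) => hnoise j
  have hmean' : ∑ j ∈ Finset.range (m + 1), ∑ i, ((X j i + X (j + 1) i) / 2 +
      (∑ k, normalizedAdjacency G i k * (X j k - X (j + 1) k)) / 2) ^ 2 ≤ energy n m (a 1) := by
    rw [hE]
    exact hmean
  linarith

theorem expect_energy_iter (hL : IsAdjacencyList G L) (hm : m ≠ 0) (a : Mem)
    (h0 : ∀ p < n, a 1 p = 0) (t : ℕ) :
    (Sampler.iter t (fun _ => layerStep L m) a).expect (fun b => energy n m (b 1)) ≤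
      (1 + 1 / m) ^ t * energy n m (a 1) := by
  induction t with
  | zero => simp
  | succ t ih =>
    rw [Sampler.iter_succ, Sampler.expect_bind]
    calc _ ≤ (Sampler.iter t (fun _ => layerStep L m) a).expect
          (fun b => (1 + 1 / m) * energy n m (b 1)) :=
        Sampler.expect_mono (all_iter_layerStep t a) fun b hb =>
          expect_energy_layerStep hL hm b fun p hp => (hb.1 p hp).trans (h0 p hp)
      _ ≤ (1 + 1 / m) * ((1 + 1 / m) ^ t * energy n m (a 1)) := by
        rw [Sampler.expect_const_mul]
        gcongr
      _ = _ := by ring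

end RAM

/-! ## Bernstein polynomials of the normalized adjacency matrix -/

/-- Pascal's rule for the binomial coefficients. -/
theorem bernsteinPolynomial_succ_succ (R : Type*) [CommRing R] (t j : ℕ) :
    bernsteinPolynomial R (t + 1) (j + 1) = Polynomial.X * bernsteinPolynomial R t j +
      (1 - Polynomial.X) * bernsteinPolynomial R t (j + 1) := by
  simp only [bernsteinPolynomial, Nat.choose_succ_succ, Nat.add_sub_add_right]
  rcases Nat.lt_or_ge j t with h | h
  · rw [show t - j = t - (j + 1) + 1 by omega]
    push_cast
    ring
  -- Here the exponent `t - (j + 1)` is truncated, but its binomial coefficient vanishes.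
  · rw [Nat.choose_eq_zero_of_lt (by omega : t < j + 1)]
    push_cast
    ring

theorem bernsteinPolynomial_succ_zero (R : Type*) [CommRing R] (t : ℕ) :
    bernsteinPolynomial R (t + 1) 0 = (1 - Polynomial.X) * bernsteinPolynomial R t 0 := by
  simp [bernsteinPolynomial, pow_succ, mul_comm]

/-- Conjugation by the eigenvector matrix is an algebra automorphism, so it commutes with evaluating
`p`, and the trace does not see it. -/
theorem Matrix.IsHermitian.trace_aeval {ι : Type*} [Fintype ι] [DecidableEq ι]
    {A : Matrix ι ι ℝ} (hA : A.IsHermitian) (p : Polynomial ℝ) :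
    (Polynomial.aeval A p).trace = ∑ i, p.eval (hA.eigenvalues i) := by
  have hdiag : Polynomial.aeval (Matrix.diagonal (hA.eigenvalues)) p =
      Matrix.diagonal (fun i => p.eval (hA.eigenvalues i)) := by
    have h := Polynomial.aeval_algHom_apply (Matrix.diagonalAlgHom (n := ι) (α := ℝ) ℝ)
      hA.eigenvalues p
    rw [Matrix.diagonalAlgHom_apply, Matrix.diagonalAlgHom_apply] at h
    rw [h]
    congr 1
    funext i
    have h2 := Polynomial.aeval_algHom_apply (Pi.evalAlgHom ℝ (fun _ : ι => ℝ) i)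
      hA.eigenvalues p
    rw [Pi.evalAlgHom_apply, Pi.evalAlgHom_apply] at h2
    rw [← h2, Polynomial.aeval_def, Polynomial.eval₂_eq_eval_map]
    simp
  have hspec := hA.spectral_theorem
  have hcoe : (RCLike.ofReal ∘ hA.eigenvalues : ι → ℝ) = hA.eigenvalues := by
    funext i
    simp
  rw [hcoe] at hspec
  set φ := Unitary.conjStarAlgAut ℝ (Matrix ι ι ℝ) hA.eigenvectorUnitary with hφ
  have h1 : Polynomial.aeval A p =
      φ (Polynomial.aeval (Matrix.diagonal hA.eigenvalues) p) := by
    conv_lhs => rw [hspec]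
    exact Polynomial.aeval_algHom_apply φ _ p
  rw [h1, hdiag, hφ, Unitary.conjStarAlgAut_apply, Matrix.trace_mul_comm, ← mul_assoc]
  simp

namespace SpectralDensity

variable {n : ℕ} (G : SimpleGraph (Fin n))

/-- The Bernstein polynomial `b_{t, j}` on `[-1, 1]`, applied to the normalized adjacency matrix. -/
def bernsteinMatrix (t j : ℕ) : Matrix (Fin n) (Fin n) ℝ :=
  Polynomial.aeval ((1 / 2 : ℝ) • (1 + normalizedAdjacency G)) (bernsteinPolynomial ℝ t j)

theorem half_mul_apply (P : Matrix (Fin n) (Fin n) ℝ) (i v : Fin n) :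
    (((1 / 2 : ℝ) • (1 + normalizedAdjacency G)) * P) i v =
      (P i v + ∑ k, normalizedAdjacency G i k * P k v) / 2 := by
  rw [Matrix.smul_mul, add_mul, one_mul, Matrix.smul_apply, Matrix.add_apply, Matrix.mul_apply,
    smul_eq_mul]
  ring

theorem bernsteinMatrix_succ_zero (t : ℕ) (i v : Fin n) :
    bernsteinMatrix G (t + 1) 0 i v = (0 + bernsteinMatrix G t 0 i v) / 2 +
      (∑ k, normalizedAdjacency G i k * (0 - bernsteinMatrix G t 0 k v)) / 2 := by
  rw [bernsteinMatrix, bernsteinPolynomial_succ_zero, map_mul, map_sub, map_one,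
    Polynomial.aeval_X, sub_mul, one_mul, Matrix.sub_apply, half_mul_apply]
  simp only [bernsteinMatrix, zero_sub, mul_neg, Finset.sum_neg_distrib]
  ring

/-- The recurrence in exactly the form of `cellMean`, column `v` being the vector that a trial
started at `v` tracks. -/
theorem bernsteinMatrix_succ_succ (t j : ℕ) (i v : Fin n) :
    bernsteinMatrix G (t + 1) (j + 1) i v =
      (bernsteinMatrix G t j i v + bernsteinMatrix G t (j + 1) i v) / 2 +
      (∑ k, normalizedAdjacency G i k *
        (bernsteinMatrix G t j k v - bernsteinMatrix G t (j + 1) k v)) / 2 := by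
  rw [bernsteinMatrix, bernsteinPolynomial_succ_succ, map_add, map_mul, map_mul, map_sub, map_one,
    Polynomial.aeval_X, sub_mul, one_mul, Matrix.add_apply, Matrix.sub_apply, half_mul_apply,
    half_mul_apply]
  simp only [bernsteinMatrix, mul_sub, Finset.sum_sub_distrib]
  ring

theorem bernsteinMatrix_zero (j : ℕ) (i v : Fin n) :
    bernsteinMatrix G 0 j i v = if j = 0 ∧ i = v then 1 else 0 := by
  rcases Nat.eq_zero_or_pos j with rfl | h
  · simp [bernsteinMatrix, bernsteinPolynomial, Matrix.one_apply]
  · rw [bernsteinMatrix, bernsteinPolynomial.eq_zero_of_lt ℝ h]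
    simp [h.ne']

/-- The mass that the Bernstein approximation of the spectral density has at `2 j / m - 1`. -/
def bernsteinMass (m j : ℕ) : ℝ :=
  (∑ i, (bernsteinPolynomial ℝ m j).eval
    ((1 + (normalizedAdjacency_isHermitian G).eigenvalues i) / 2)) / n

theorem sum_diag_bernsteinMatrix (m j : ℕ) :
    (∑ v : Fin n, bernsteinMatrix G m j v v) / n = bernsteinMass G m j := by
  rw [bernsteinMass]
  congr 1
  have h : (1 / 2 : ℝ) • (1 + normalizedAdjacency G) =
      Polynomial.aeval (normalizedAdjacency G)
        (Polynomial.C (1 / 2 : ℝ) * (1 + Polynomial.X)) := by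
    simp [Algebra.smul_def]
  have h2 := (normalizedAdjacency_isHermitian G).trace_aeval
    ((bernsteinPolynomial ℝ m j).comp (Polynomial.C (1 / 2 : ℝ) * (1 + Polynomial.X)))
  rw [Polynomial.aeval_comp, ← h] at h2
  rw [Matrix.trace] at h2
  simp only [Matrix.diag_apply] at h2
  simp only [bernsteinMatrix, h2, Polynomial.eval_comp]
  refine Finset.sum_congr rfl fun i _ => ?_
  congr 1
  simp
  ring

/-- Contractivity applied to a unit eigenvector. -/
theorem abs_eigenvalues_le_one {L : Fin n → List (Fin n)} (hL : RAM.IsAdjacencyList G L)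
    (i : Fin n) : |(normalizedAdjacency_isHermitian G).eigenvalues i| ≤ 1 := by
  set hA := normalizedAdjacency_isHermitian G
  have h1 := hA.mulVec_eigenvectorBasis i
  set e : Fin n → ℝ := ⇑(hA.eigenvectorBasis i) with he
  have h2 := RAM.sum_sq_mulVec_le hL e
  have h3 : ∀ k, ∑ y, normalizedAdjacency G k y * e y = hA.eigenvalues i * e k := fun k => by
    have := congrFun h1 k
    simpa [Matrix.mulVec, dotProduct] using this
  have h4 : ∑ k, e k ^ 2 = 1 := by
    have := hA.eigenvectorBasis.orthonormal.1 i
    rw [EuclideanSpace.norm_eq, Real.sqrt_eq_one] at this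
    simpa using this
  simp only [h3, mul_pow, ← Finset.mul_sum, h4, mul_one] at h2
  exact (sq_le_one_iff_abs_le_one _).1 h2

end SpectralDensity

namespace RAM

open SpectralDensity

variable {n : ℕ} {G : SimpleGraph (Fin n)} {L : Fin n → List (Fin n)} {m : ℕ}

/-- Given the old layer, the mean of a new entry is linear in it. Hence expectations obey the exact
recurrence of `bernsteinMatrix`, and dependence between entries is irrelevant. -/
theorem expect_iter_layerStep (hL : IsAdjacencyList G L) (hm : m ≠ 0) (a : Mem)
    (h0 : ∀ p < n, a 1 p = 0) (v : Fin n)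
    (h1 : ∀ j < m + 1, ∀ i : Fin n, a 1 (n + (j * n + i)) = if j = 0 ∧ i = v then 1 else 0)
    (t : ℕ) : ∀ j < m + 1, ∀ i : Fin n,
      (Sampler.iter t (fun _ => layerStep L m) a).expect (fun b => b 1 (n + (j * n + i))) =
        bernsteinMatrix G t j i v := by
  induction t with
  | zero =>
    intro j hj i
    rw [Sampler.iter_zero, Sampler.expect_pure, h1 j hj i, bernsteinMatrix_zero]
  | succ t ih =>
    intro j hj i
    have hall := all_iter_layerStep (L := L) (m := m) t a
    rw [Sampler.iter_succ, Sampler.expect_bind]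
    set S := Sampler.iter t (fun _ => layerStep L m) a
    have hcell : ∀ b : Mem, (layerStep L m b).expect (fun b => b 1 (n + (j * n + i))) =
        cellMean G (b 1) (j * n) i := fun b =>
      (expect_layerStep (fun z => z) b hj i).trans (expect_cellLaw hL hm _ _ _)
    simp only [hcell, cellMean]
    have hlin : S.expect (fun b => (b 1 (j * n + i) + b 1 (n + (j * n + i))) / 2 +
        (∑ y : Fin n, normalizedAdjacency G i y * (b 1 (j * n + y) - b 1 (n + (j * n + y)))) / 2) =
        (S.expect (fun b => b 1 (j * n + i)) + S.expect (fun b => b 1 (n + (j * n + i)))) / 2 +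
        (∑ y : Fin n, normalizedAdjacency G i y * (S.expect (fun b => b 1 (j * n + y)) -
          S.expect (fun b => b 1 (n + (j * n + y))))) / 2 := by
      simp only [div_eq_inv_mul, Sampler.expect_add, Sampler.expect_const_mul, Sampler.expect_sum,
        Sampler.expect_sub]
    rw [hlin]
    simp only [ih j hj]
    rcases j with _ | j
    · have hz : ∀ y : Fin n, S.expect (fun b => b 1 (0 * n + y)) = 0 := fun y => by
        rw [← Sampler.expect_const S 0]
        refine Sampler.expect_congr hall fun b hb => ?_
        rw [zero_mul, zero_add, hb.1 y y.2, h0 y y.2]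
      simp only [hz]
      exact (bernsteinMatrix_succ_zero G t i v).symm
    · have hprev : ∀ y : Fin n, S.expect (fun b => b 1 ((j + 1) * n + y)) =
          bernsteinMatrix G t j y v := fun y => by
        rw [← ih j (by omega) y]
        congr 1
        funext b
        congr 1
        ring
      simp only [hprev]
      exact (bernsteinMatrix_succ_succ G t j i v).symm

/-! ### One trial -/

theorem clear_eq (N : ℕ) (a : Mem) : ∃ b, Sampler.iter N clearStep a = .pure b ∧
    (∀ p < N, b 1 p = 0) ∧ ∀ x, x ≠ 1 → b x = a x := by
  induction N with
  | zero => exact ⟨a, rfl, by simp, by simp⟩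
  | succ N ih =>
    obtain ⟨b, hb, h1, h2⟩ := ih
    refine ⟨upd b 1 N 0, by rw [Sampler.iter_succ, hb]; rfl, fun p hp => ?_, fun x hx => ?_⟩
    · rcases Nat.lt_succ_iff_lt_or_eq.1 hp with h | rfl
      · rw [upd_cell_ne _ _ _ (by omega), h1 p h]
      · rw [upd_self]
    · rw [upd_array_ne _ _ _ hx, h2 x hx]

theorem add_eq (B v N : ℕ) (a : Mem) : ∃ b, Sampler.iter N (addStep n B v) a = .pure b ∧
    (∀ j < N, b 3 j = a 3 j + clip B (a 1 (n + (j * n + v)))) ∧ (∀ j, N ≤ j → b 3 j = a 3 j) ∧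
    ∀ x, x ≠ 3 → b x = a x := by
  induction N with
  | zero => exact ⟨a, rfl, by simp, by simp, by simp⟩
  | succ N ih =>
    obtain ⟨b, hb, h1, h2, h3⟩ := ih
    refine ⟨upd b 3 N (b 3 N + clip B (b 1 (n + (N * n + v)))),
      by rw [Sampler.iter_succ, hb]; rfl, fun j hj => ?_, fun j hj => ?_, fun x hx => ?_⟩
    · rcases Nat.lt_succ_iff_lt_or_eq.1 hj with h | rfl
      · rw [upd_cell_ne _ _ _ (by omega), h1 j h]
      · rw [upd_self, h2 j le_rfl, h3 1 (by norm_num)]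
    · rw [upd_cell_ne _ _ _ (by omega), h2 j (by omega)]
    · rw [upd_array_ne _ _ _ hx, h3 x hx]

/-- The distribution of the estimate of `bernsteinMass G m j` that a trial makes. -/
def trialLaw (L : Fin n → List (Fin n)) (m j : ℕ) (a : Mem) : Sampler ℝ :=
  (Sampler.uniform n).bind fun v =>
    (Sampler.iter ((m + 2) * n) clearStep a).bind fun a =>
      (Sampler.iter m (fun _ => layerStep L m) (upd a 1 (n + v) 1)).map
        fun b => b 1 (n + (j * n + v))

theorem expect_trialStep (B : ℕ) (f : ℝ → ℝ) (a : Mem) {j : ℕ} (hj : j < m + 1) :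
    (trialStep L m B a).expect (fun b => f (b 3 j)) =
      (trialLaw L m j a).expect (fun z => f (a 3 j + clip B z)) := by
  rw [trialStep, trialLaw, Sampler.expect_bind, Sampler.expect_bind]
  congr 1
  funext v
  obtain ⟨b, hb, -, h3⟩ := clear_eq ((m + 2) * n) a
  rw [hb, Sampler.pure_bind, Sampler.pure_bind, Sampler.pure_bind, Sampler.expect_bind,
    Sampler.expect_map]
  refine Sampler.expect_congr (all_iter_layerStep m _) fun c hc => ?_
  obtain ⟨d, hd, h4, -⟩ := add_eq (n := n) B v (m + 1) c
  rw [hd, Sampler.expect_pure, h4 j hj, hc.2 3 (by norm_num) (by norm_num), upd_array_ne _ _ _ (by norm_num),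
    h3 3 (by norm_num)]

/-- The output stage adds to arrays `0` and `4`, so it relies on the trials not having touched them.
-/
theorem all_trialStep (B : ℕ) (a : Mem) : (trialStep L m B a).All
    (fun b => ∀ x, x = 0 ∨ x = 4 → b x = a x) := by
  rw [trialStep]
  refine Sampler.All_bind (P := fun _ => True) (Sampler.All_of_forall fun _ => trivial)
    fun v _ => ?_
  obtain ⟨b, hb, -, h3⟩ := clear_eq ((m + 2) * n) a
  rw [hb, Sampler.pure_bind, Sampler.pure_bind]
  refine Sampler.All_bind (all_iter_layerStep m _) fun c hc => ?_
  obtain ⟨d, hd, -, -, h4⟩ := add_eq (n := n) B v (m + 1) c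
  rw [hd, Sampler.All_pure]
  intro x hx
  rw [h4 x (by omega), hc.2 x (by omega) (by omega), upd_array_ne _ _ _ (by omega),
    h3 x (by omega)]

theorem trial_init (a : Mem) (v : Fin n) : ∃ b, Sampler.iter ((m + 2) * n) clearStep a = .pure b ∧
    (∀ p < n, upd b 1 (n + v) 1 1 p = 0) ∧ ∀ j < m + 1, ∀ i : Fin n,
      upd b 1 (n + v) 1 1 (n + (j * n + i)) = if j = 0 ∧ i = v then 1 else 0 := by
  obtain ⟨b, hb, h1, -⟩ := clear_eq ((m + 2) * n) a
  refine ⟨b, hb, fun p hp => ?_, fun j hj i => ?_⟩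
  · rw [upd_cell_ne _ _ _ (by omega)]
    exact h1 p (hp.trans_le (Nat.le_mul_of_pos_left n (by omega)))
  · rw [upd_apply]
    rcases Nat.eq_zero_or_pos j with rfl | hj0
    · have hv : n + (0 * n + (i : ℕ)) = n + v ↔ i = v := by
        rw [zero_mul, zero_add, Nat.add_left_cancel_iff, Fin.ext_iff]
      simp only [hv, true_and]
      split_ifs with h
      · rfl
      · refine h1 _ ?_
        have := i.2
        have : 2 * n ≤ (m + 2) * n := Nat.mul_le_mul_right n (by omega)
        omega
    · have hlt : n ≤ j * n := Nat.le_mul_of_pos_left n hj0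
      have hv := v.2
      rw [if_neg (by omega), if_neg (by omega)]
      refine h1 _ ?_
      have := i.2
      have : (j + 1 + 1) * n ≤ (m + 2) * n := Nat.mul_le_mul_right n (by omega)
      simp only [Nat.succ_mul] at this
      simp only [Nat.succ_mul]
      omega

theorem expect_trialLaw (hL : IsAdjacencyList G L) (hm : m ≠ 0) (hn : 0 < n) {j : ℕ}
    (hj : j < m + 1) (a : Mem) :
    (trialLaw L m j a).expect (fun z => z) = bernsteinMass G m j := by
  rw [trialLaw, Sampler.expect_bind, Sampler.expect_uniform hn, ← sum_diag_bernsteinMatrix]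
  congr 1
  refine Finset.sum_congr rfl fun v _ => ?_
  obtain ⟨b, hb, h0, h1⟩ := trial_init (m := m) a v
  rw [hb, Sampler.pure_bind, Sampler.expect_map]
  exact expect_iter_layerStep hL hm _ h0 v h1 m j hj v

/-- A single squared entry is at most the energy, which starts at `1` for the unit vector and grows
by at most `(1 + 1 / m) ^ m ≤ e` in expectation. -/
theorem expect_trialLaw_sq (hL : IsAdjacencyList G L) (hm : m ≠ 0) (hn : 0 < n) {j : ℕ}
    (hj : j < m + 1) (a : Mem) : (trialLaw L m j a).expect (fun z => z ^ 2) ≤ 3 := by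
  rw [trialLaw, Sampler.expect_bind, Sampler.expect_uniform hn, div_le_iff₀ (by positivity)]
  have h : ∀ v : Fin n, ((Sampler.iter ((m + 2) * n) clearStep a).bind fun a =>
      (Sampler.iter m (fun _ => layerStep L m) (upd a 1 (n + v) 1)).map
        fun b => b 1 (n + (j * n + v))).expect (fun z => z ^ 2) ≤ 3 := by
    intro v
    obtain ⟨b, hb, h0, h1⟩ := trial_init (m := m) a v
    rw [hb, Sampler.pure_bind, Sampler.expect_map]
    have hE : energy n m (upd b 1 (n + v) 1 1) = 1 := by
      rw [energy]
      have : ∀ j ∈ Finset.range (m + 1), ∑ i : Fin n,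
          upd b 1 (n + v) 1 1 (n + (j * n + i)) ^ 2 = if j = 0 then 1 else 0 := by
        intro j hj
        simp only [h1 j (Finset.mem_range.1 hj)]
        by_cases hj0 : j = 0 <;> simp [hj0]
      rw [Finset.sum_congr rfl this]
      simp
    have h2 := expect_energy_iter hL hm _ h0 m
    rw [hE, mul_one] at h2
    refine (Sampler.expect_le_expect fun c => ?_).trans (h2.trans ?_)
    · rw [energy]
      refine le_trans ?_ (Finset.single_le_sum (f := fun j => ∑ i : Fin n,
        c 1 (n + (j * n + i)) ^ 2) (fun j _ => Finset.sum_nonneg fun i _ => sq_nonneg _)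
        (Finset.mem_range.2 hj))
      exact Finset.single_le_sum (f := fun i : Fin n => c 1 (n + (j * n + i)) ^ 2)
        (fun i _ => sq_nonneg _) (Finset.mem_univ v)
    · have hm' : (0 : ℝ) < m := by positivity
      calc (1 + 1 / (m : ℝ)) ^ m ≤ Real.exp (1 / m) ^ m := by
            gcongr
            rw [add_comm]
            exact Real.add_one_le_exp _
        _ = Real.exp 1 := by
            rw [← Real.exp_nat_mul]
            congr 1
            field_simp
        _ ≤ 3 := Real.exp_one_lt_three.le
  calc _ ≤ ∑ _v : Fin n, (3 : ℝ) := Finset.sum_le_sum fun v _ => h v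
    _ = 3 * n := by simp [mul_comm]

end RAM

/-! ## Concentration -/

namespace RAM

theorem abs_clip_le {B : ℝ} (hB : 0 ≤ B) (z : ℝ) : |clip B z| ≤ B := by
  rw [clip, abs_le]
  constructor <;> rcases abs_cases (z + B) with h | h <;> rcases abs_cases (z - B) with h' | h' <;>
    linarith

theorem abs_clip_le_abs {B : ℝ} (hB : 0 ≤ B) (z : ℝ) : |clip B z| ≤ |z| := by
  rw [clip, abs_le]
  constructor <;> rcases abs_cases (z + B) with h | h <;> rcases abs_cases (z - B) with h' | h' <;>
    rcases abs_cases z with h'' | h'' <;> linarith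

/-- Nothing is cut off when `|z| ≤ B`; otherwise the cut-off part is at most `|z| ≤ z ^ 2 / B`. In
expectation the clipping bias is thus controlled by the second moment. -/
theorem abs_clip_sub_le {B : ℝ} (hB : 0 < B) (z : ℝ) : |clip B z - z| ≤ z ^ 2 / B := by
  rw [le_div_iff₀ hB, clip]
  rcases le_or_gt |z| B with h | h
  · obtain ⟨h1, h2⟩ := abs_le.1 h
    rw [abs_of_nonneg (by linarith : 0 ≤ z + B), abs_of_nonpos (by linarith : z - B ≤ 0)]
    ring_nf
    rw [abs_zero, mul_zero]
    exact sq_nonneg z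
  · rcases lt_abs.1 h with h1 | h1
    · rw [abs_of_nonneg (by linarith : 0 ≤ z + B), abs_of_nonneg (by linarith : 0 ≤ z - B),
        abs_of_nonpos (by linarith)]
      nlinarith
    · rw [abs_of_nonpos (by linarith : z + B ≤ 0), abs_of_nonpos (by linarith : z - B ≤ 0),
        abs_of_nonneg (by linarith)]
      nlinarith

/-- Clipping makes `exp u ≤ 1 + u + u ^ 2` available for `u = l (clip B z - μ)`, as `|u| ≤ 1`.
Replacing `clip B z` by `z` in the linear term costs `|l| z ^ 2 / B`, and the quadratic term is at
most `l ^ 2 (2 z ^ 2 + 2)`. -/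
theorem expect_exp_clip_le {T : Sampler ℝ} {μ B l : ℝ} (hT : T.expect (fun z => z) = μ)
    (hT2 : T.expect (fun z => z ^ 2) ≤ 3) (hμ : |μ| ≤ 1) (hB : 0 < B) (hl : |l| * (B + 1) ≤ 1) :
    T.expect (fun z => Real.exp (l * (clip B z - μ))) ≤ Real.exp (3 * |l| / B + 8 * l ^ 2) := by
  have hpt : ∀ z, Real.exp (l * (clip B z - μ)) ≤
      (l * z + (|l| / B + 2 * l ^ 2) * z ^ 2) + (1 - l * μ + 2 * l ^ 2) := by
    intro z
    set X := clip B z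
    have h1 : |X| ≤ B := abs_clip_le hB.le z
    have h2 : X ^ 2 ≤ z ^ 2 := sq_le_sq.2 (abs_clip_le_abs hB.le z)
    have h3 : |X - z| ≤ z ^ 2 / B := abs_clip_sub_le hB z
    have h4 : |l * (X - μ)| ≤ 1 := by
      rw [abs_mul]
      refine le_trans ?_ hl
      gcongr
      exact (abs_sub X μ).trans (add_le_add h1 hμ)
    have h5 := (abs_le.1 (Real.abs_exp_sub_one_sub_id_le h4)).2
    have h6 : l * (X - z) ≤ |l| * (z ^ 2 / B) :=
      (le_abs_self _).trans (by rw [abs_mul]; gcongr)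
    have h7 : (X - μ) ^ 2 ≤ 2 * z ^ 2 + 2 := by
      have : μ ^ 2 ≤ 1 := (sq_le_one_iff_abs_le_one μ).2 hμ
      nlinarith [sq_nonneg (X + μ)]
    have h8 : (l * (X - μ)) ^ 2 ≤ l ^ 2 * (2 * z ^ 2 + 2) := by
      rw [mul_pow]
      gcongr
    have h9 : |l| * (z ^ 2 / B) = |l| / B * z ^ 2 := by ring
    nlinarith
  refine (Sampler.expect_le_expect hpt).trans ?_
  rw [Sampler.expect_add, Sampler.expect_add, Sampler.expect_const_mul T l (fun z => z),
    Sampler.expect_const_mul T _ (fun z => z ^ 2), Sampler.expect_const, hT]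
  have hc : 0 ≤ |l| / B + 2 * l ^ 2 := by positivity
  have h1 := mul_le_mul_of_nonneg_left hT2 hc
  have h2 := Real.add_one_le_exp (3 * |l| / B + 8 * l ^ 2)
  have h3 : (|l| / B + 2 * l ^ 2) * 3 = 3 * |l| / B + 6 * l ^ 2 := by ring
  linarith

open SpectralDensity

variable {n : ℕ} {G : SimpleGraph (Fin n)} {L : Fin n → List (Fin n)} {m : ℕ}

theorem bernsteinPolynomial_eval_nonneg {x : ℝ} (h0 : 0 ≤ x) (h1 : x ≤ 1) (t j : ℕ) :
    0 ≤ (bernsteinPolynomial ℝ t j).eval x := by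
  have : 0 ≤ 1 - x := by linarith
  simp only [bernsteinPolynomial, Polynomial.eval_mul, Polynomial.eval_pow, Polynomial.eval_sub,
    Polynomial.eval_one, Polynomial.eval_X, Polynomial.eval_natCast]
  positivity

theorem half_eigenvalues_mem (hL : IsAdjacencyList G L) (i : Fin n) :
    0 ≤ (1 + (normalizedAdjacency_isHermitian G).eigenvalues i) / 2 ∧
      (1 + (normalizedAdjacency_isHermitian G).eigenvalues i) / 2 ≤ 1 := by
  have h := abs_le.1 (abs_eigenvalues_le_one G hL i)
  constructor <;> linarith

theorem bernsteinMass_nonneg (hL : IsAdjacencyList G L) (m j : ℕ) : 0 ≤ bernsteinMass G m j :=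
  div_nonneg (Finset.sum_nonneg fun i _ => bernsteinPolynomial_eval_nonneg
    (half_eigenvalues_mem hL i).1 (half_eigenvalues_mem hL i).2 _ _) (Nat.cast_nonneg n)

theorem sum_bernsteinPolynomial_eval (m : ℕ) (x : ℝ) :
    ∑ j ∈ Finset.range (m + 1), (bernsteinPolynomial ℝ m j).eval x = 1 := by
  rw [← Polynomial.eval_finsetSum, bernsteinPolynomial.sum, Polynomial.eval_one]

theorem sum_bernsteinMass (G : SimpleGraph (Fin n)) (hn : 0 < n) (m : ℕ) :
    ∑ j ∈ Finset.range (m + 1), bernsteinMass G m j = 1 := by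
  have hn' : (n : ℝ) ≠ 0 := by positivity
  simp only [bernsteinMass]
  rw [← Finset.sum_div, Finset.sum_comm]
  simp only [sum_bernsteinPolynomial_eval]
  simp [hn']

theorem abs_bernsteinMass_le_one (hL : IsAdjacencyList G L) (hn : 0 < n) {j : ℕ}
    (hj : j < m + 1) : |bernsteinMass G m j| ≤ 1 := by
  rw [abs_of_nonneg (bernsteinMass_nonneg hL m j), ← sum_bernsteinMass G hn m]
  exact Finset.single_le_sum (f := fun j => bernsteinMass G m j)
    (fun j _ => bernsteinMass_nonneg hL m j) (Finset.mem_range.2 hj)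

/-- The mean and the second moment bound of a trial hold whatever memory it starts from, so
conditionally on the earlier trials each one contributes a factor. -/
theorem expect_exp_acc_le (hL : IsAdjacencyList G L) (hm : m ≠ 0) (hn : 0 < n) {j : ℕ}
    (hj : j < m + 1) {B : ℕ} (hB : 0 < B) {l : ℝ} (hl : |l| * (B + 1) ≤ 1) (a : Mem)
    (ha : a 3 j = 0) (N : ℕ) :
    (Sampler.iter N (fun _ => trialStep L m B) a).expect
      (fun b => Real.exp (l * (b 3 j - N * bernsteinMass G m j))) ≤
        Real.exp (N * (3 * |l| / B + 8 * l ^ 2)) := by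
  induction N with
  | zero => simp [ha]
  | succ N ih =>
    set μ := bernsteinMass G m j
    have hB' : (0 : ℝ) < B := Nat.cast_pos.2 hB
    rw [Sampler.iter_succ, Sampler.expect_bind]
    have hstep : ∀ b : Mem, (trialStep L m B b).expect
        (fun b => Real.exp (l * (b 3 j - (N + 1 : ℕ) * μ))) ≤
          Real.exp (3 * |l| / B + 8 * l ^ 2) * Real.exp (l * (b 3 j - N * μ)) := by
      intro b
      rw [expect_trialStep B (fun z => Real.exp (l * (z - (N + 1 : ℕ) * μ))) b hj,
        mul_comm (Real.exp _)]
      have h1 : (fun z => Real.exp (l * (b 3 j + clip B z - (N + 1 : ℕ) * μ))) =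
          fun z => Real.exp (l * (b 3 j - N * μ)) * Real.exp (l * (clip B z - μ)) := by
        funext z
        rw [← Real.exp_add]
        congr 1
        push_cast
        ring
      rw [h1, Sampler.expect_const_mul]
      gcongr
      exact expect_exp_clip_le (expect_trialLaw hL hm hn hj b) (expect_trialLaw_sq hL hm hn hj b)
        (abs_bernsteinMass_le_one hL hn hj) hB' hl
    refine (Sampler.expect_le_expect hstep).trans ?_
    rw [Sampler.expect_const_mul]
    calc _ ≤ Real.exp (3 * |l| / B + 8 * l ^ 2) * Real.exp (N * (3 * |l| / B + 8 * l ^ 2)) := by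
          gcongr
      _ = _ := by
          rw [← Real.exp_add]
          congr 1
          push_cast
          ring

open Classical in
/-- The probability that some accumulated estimate is off by more than `12 / B` per trial. -/
theorem expect_bad_le (hL : IsAdjacencyList G L) (hm : m ≠ 0) (hn : 0 < n) {B : ℕ} (hB : 0 < B)
    (a : Mem) (ha : ∀ j, a 3 j = 0) (N : ℕ) :
    (Sampler.iter N (fun _ => trialStep L m B) a).expect (fun b =>
      if ∃ j < m + 1, N * (12 / B : ℝ) < |b 3 j - N * bernsteinMass G m j| then 1 else 0) ≤
        2 * (m + 1) * Real.exp (-(9 * N / (4 * B ^ 2))) := by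
  have hB' : (1 : ℝ) ≤ B := by exact_mod_cast hB
  have hB0 : (0 : ℝ) < B := by linarith
  -- Beyond the bias `3 / B` the threshold leaves a margin `9 / B`. The exponent per trial is `-9 l
  -- / B + 8 l ^ 2`, which equals `-9 / (4 B ^ 2)` here; `B ≥ 1` gives `l (B + 1) ≤ 1`.
  set l : ℝ := 3 / (8 * B) with hl
  have hl0 : 0 < l := by positivity
  have hl1 : |l| * (B + 1) ≤ 1 := by
    rw [abs_of_pos hl0, hl, div_mul_eq_mul_div, div_le_one (by positivity)]
    linarith
  set w : ℝ := Real.exp (-(l * (N * (12 / B)))) with hw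
  have hw0 : 0 < w := Real.exp_pos _
  -- Markov's inequality for the exponentials, with a union bound over the cells and over both
  -- signs.
  have hpt : ∀ b : Mem, (if ∃ j < m + 1, N * (12 / B : ℝ) < |b 3 j - N * bernsteinMass G m j|
      then (1 : ℝ) else 0) ≤ w * ∑ j ∈ Finset.range (m + 1),
        (Real.exp (l * (b 3 j - N * bernsteinMass G m j)) +
          Real.exp (-l * (b 3 j - N * bernsteinMass G m j))) := by
    intro b
    split_ifs with h
    · obtain ⟨j, hj, h⟩ := h
      have h1 : 1 ≤ w * (Real.exp (l * (b 3 j - N * bernsteinMass G m j)) +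
          Real.exp (-l * (b 3 j - N * bernsteinMass G m j))) := by
        rw [mul_add, hw, ← Real.exp_add, ← Real.exp_add]
        rcases lt_abs.1 h with h | h
        · have : 1 ≤ Real.exp (-(l * (N * (12 / B))) + l * (b 3 j - N * bernsteinMass G m j)) :=
            Real.one_le_exp (by nlinarith)
          linarith [Real.exp_pos (-(l * (N * (12 / B))) + -l * (b 3 j - N * bernsteinMass G m j))]
        · have : 1 ≤ Real.exp (-(l * (N * (12 / B))) + -l * (b 3 j - N * bernsteinMass G m j)) :=
            Real.one_le_exp (by nlinarith)
          linarith [Real.exp_pos (-(l * (N * (12 / B))) + l * (b 3 j - N * bernsteinMass G m j))]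
      refine h1.trans (mul_le_mul_of_nonneg_left ?_ hw0.le)
      exact Finset.single_le_sum (f := fun j =>
        Real.exp (l * (b 3 j - N * bernsteinMass G m j)) +
          Real.exp (-l * (b 3 j - N * bernsteinMass G m j)))
        (fun j _ => by positivity) (Finset.mem_range.2 hj)
    · positivity
  refine (Sampler.expect_le_expect hpt).trans ?_
  rw [Sampler.expect_const_mul, Sampler.expect_sum]
  simp only [Sampler.expect_add]
  calc _ ≤ w * ∑ _j ∈ Finset.range (m + 1), (2 * Real.exp (N * (3 * |l| / B + 8 * l ^ 2))) := by
        gcongr with j hj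
        rw [two_mul]
        refine add_le_add (expect_exp_acc_le hL hm hn (Finset.mem_range.1 hj) hB hl1 a (ha j) N) ?_
        have h := expect_exp_acc_le hL hm hn (Finset.mem_range.1 hj) hB (l := -l)
          (by rwa [abs_neg]) a (ha j) N
        rwa [abs_neg, neg_sq] at h
    _ = _ := by
        rw [Finset.sum_const, Finset.card_range, nsmul_eq_mul, abs_of_pos hl0]
        have h2 : w * Real.exp (N * (3 * l / B + 8 * l ^ 2)) =
            Real.exp (-(9 * N / (4 * B ^ 2))) := by
          rw [hw, ← Real.exp_add]
          congr 1
          rw [hl]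
          field_simp
          ring
        rw [← h2]
        push_cast
        ring

theorem all_iter_trialStep (B N : ℕ) (a : Mem) :
    (Sampler.iter N (fun _ => trialStep L m B) a).All
      (fun b => ∀ x, x = 0 ∨ x = 4 → b x = a x) := by
  refine Sampler.All_iter (P := fun _ (b : Mem) => ∀ x, x = 0 ∨ x = 4 → b x = a x)
    (fun _ _ => rfl) fun _ _ b hb => (all_trialStep B b).mono fun b' h x hx => ?_
  exact (h x hx).trans (hb x hx)

end RAM

/-! ## The output stage -/

namespace RAM

variable {m : ℕ}

/-- The value of the Chebyshev polynomial of degree `k` at `x`. -/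
def cheb (k : ℕ) (x : ℝ) : ℝ := (Polynomial.Chebyshev.T ℝ (k : ℤ)).eval x

theorem cheb_zero (x : ℝ) : cheb 0 x = 1 := by simp [cheb]

theorem cheb_one (x : ℝ) : cheb 1 x = x := by simp [cheb]

theorem cheb_add_two (k : ℕ) (x : ℝ) : cheb (k + 2) x = 2 * x * cheb (k + 1) x - cheb k x := by
  simp only [cheb]
  push_cast
  rw [Polynomial.Chebyshev.T_add_two]
  simp

theorem cheb_cos (k : ℕ) (θ : ℝ) : cheb k (Real.cos θ) = Real.cos (k * θ) := by
  simp [cheb, Polynomial.Chebyshev.T_real_cos]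

/-- The Fourier coefficients of the Fejér kernel. -/
def fejer (m k : ℕ) : ℝ := if k = 0 then 1 else 2 * (1 - (k : ℝ) / m)

/-- The points at which the approximate spectral density lives. -/
def node (m j : ℕ) : ℝ := 2 * j / m - 1

theorem total_eq (N : ℕ) (a : Mem) : ∃ b, Sampler.iter N totalStep a = .pure b ∧
    b 4 0 = a 4 0 + ∑ j ∈ Finset.range N, |a 3 j| ∧ ∀ x, x ≠ 4 → b x = a x := by
  induction N with
  | zero => exact ⟨a, rfl, by simp, by simp⟩
  | succ N ih =>
    obtain ⟨b, hb, h1, h2⟩ := ih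
    refine ⟨upd b 4 0 (b 4 0 + |b 3 N|), by rw [Sampler.iter_succ, hb]; rfl, ?_, fun x hx => ?_⟩
    · rw [upd_self, h1, h2 3 (by norm_num), Finset.sum_range_succ, add_assoc]
    · rw [upd_array_ne _ _ _ hx, h2 x hx]

/-- A loop invariant in which the Chebyshev values are one index ahead of the coefficients that have
been updated. -/
theorem cheb_eq (j K : ℕ) (a : Mem) (h0 : a 5 0 = 1) (h1 : a 5 1 = node m j) :
    ∃ b, Sampler.iter K (chebStep m j) a = .pure b ∧
      (∀ k ≤ K + 1, b 5 k = cheb k (node m j)) ∧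
      (∀ k, b 0 k = a 0 k + if 1 ≤ k ∧ k ≤ K then
        fejer m k * (|a 3 j| / a 4 0) * cheb k (node m j) else 0) ∧
      b 3 = a 3 ∧ b 4 = a 4 := by
  induction K with
  | zero =>
    refine ⟨a, rfl, fun k hk => ?_, fun k => ?_, rfl, rfl⟩
    · interval_cases k
      · rw [h0, cheb_zero]
      · rw [h1, cheb_one]
    · rw [if_neg (by omega), add_zero]
  | succ K ih =>
    obtain ⟨b, hb, hT, hc, h3, h4⟩ := ih
    refine ⟨_, by rw [Sampler.iter_succ, hb]; rfl, fun k hk => ?_, fun k => ?_, ?_, ?_⟩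
    · rcases Nat.lt_or_ge k (K + 2) with h | h
      · rw [upd_cell_ne _ _ _ (by omega), upd_array_ne _ _ _ (by norm_num), hT k (by omega)]
      · obtain rfl : k = K + 2 := by omega
        rw [upd_self, upd_array_ne _ _ _ (by norm_num), hT _ le_rfl, hT _ (by omega),
          cheb_add_two, node]
    · rw [upd_array_ne _ _ _ (by norm_num), upd_apply]
      by_cases h : k = K + 1
      · subst h
        rw [if_pos ⟨rfl, rfl⟩, if_pos (by omega), hc, if_neg (by omega), hT _ le_rfl, h3, h4,
          fejer, if_neg (by omega), add_zero]
      · rw [if_neg (by omega), hc]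
        congr 1
        exact if_congr (by omega) rfl rfl
    · rw [upd_array_ne _ _ _ (by norm_num), upd_array_ne _ _ _ (by norm_num), h3]
    · rw [upd_array_ne _ _ _ (by norm_num), upd_array_ne _ _ _ (by norm_num), h4]

theorem nodes_eq (J : ℕ) (a : Mem) :
    ∃ b, Sampler.iter J (nodeStep m) a = .pure b ∧
      (∀ k, b 0 k = a 0 k + if 1 ≤ k ∧ k ≤ m - 1 then ∑ j ∈ Finset.range J,
        fejer m k * (|a 3 j| / a 4 0) * cheb k (node m j) else 0) ∧
      b 3 = a 3 ∧ b 4 = a 4 := by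
  induction J with
  | zero => exact ⟨a, rfl, by simp, rfl, rfl⟩
  | succ J ih =>
    obtain ⟨b, hb, hc, h3, h4⟩ := ih
    obtain ⟨d, hd, -, hdc, hd3, hd4⟩ := cheb_eq (m := m) J (m - 1)
      (upd (upd b 5 0 1) 5 1 (2 * J / m - 1))
      (by rw [upd_cell_ne _ _ _ (by norm_num), upd_self]) (by rw [upd_self, node])
    refine ⟨d, ?_, fun k => ?_, ?_, ?_⟩
    · rw [Sampler.iter_succ, hb]
      exact hd
    · rw [hdc, upd_array_ne _ _ _ (by norm_num), upd_array_ne _ _ _ (by norm_num),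
        upd_array_ne _ _ _ (by norm_num), upd_array_ne _ _ _ (by norm_num),
        upd_array_ne _ _ _ (by norm_num), upd_array_ne _ _ _ (by norm_num), hc, h3, h4,
        Finset.sum_range_succ]
      split_ifs <;> ring
    · rw [hd3, upd_array_ne _ _ _ (by norm_num), upd_array_ne _ _ _ (by norm_num), h3]
    · rw [hd4, upd_array_ne _ _ _ (by norm_num), upd_array_ne _ _ _ (by norm_num), h4]

/-- The normalized weights of the nodes. -/
def weight (m : ℕ) (acc : ℕ → ℝ) (j : ℕ) : ℝ := |acc j| / ∑ i ∈ Finset.range (m + 1), |acc i|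

/-- The coefficients that the output stage computes. -/
def coeff (m : ℕ) (w : ℕ → ℝ) (k : ℕ) : ℝ :=
  if k = 0 then 1 else ∑ j ∈ Finset.range (m + 1), fejer m k * w j * cheb k (node m j)

theorem output_eq (a : Mem) (h0 : ∀ k, a 0 k = 0) (h4 : a 4 0 = 0) :
    ∃ b, outputStep m a = .pure b ∧ ∀ k < m, b 0 k = coeff m (weight m (a 3)) k := by
  obtain ⟨b, hb, hs, hx⟩ := total_eq (m + 1) a
  obtain ⟨d, hd, hc, -, -⟩ := nodes_eq (m := m) (m + 1) (upd b 0 0 1)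
  refine ⟨d, ?_, fun k hk => ?_⟩
  · rw [outputStep, hb]
    exact hd
  · rw [hc, coeff, upd_array_ne (y := 3) _ _ _ (by norm_num),
      upd_array_ne (y := 4) _ _ _ (by norm_num), hs, h4,
      zero_add, hx 3 (by norm_num)]
    rcases Nat.eq_zero_or_pos k with rfl | hk0
    · rw [upd_self, if_neg (by omega), if_pos rfl, add_zero]
    · rw [upd_cell_ne _ _ _ (by omega), hx 0 (by norm_num), h0, zero_add, if_pos (by omega),
        if_neg (by omega)]
      rfl

/-! ## The Fejér kernel in Chebyshev polynomials -/

/-- Both sides are the squared modulus of `∑ exp (i k α)`, expanded on the right by differences of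
indices. Dividing by `m` gives the Fejér kernel, which is therefore nonnegative. -/
theorem sq_add_sq_sum_cos_sin (m : ℕ) (α : ℝ) :
    (∑ k ∈ Finset.range m, Real.cos (k * α)) ^ 2 + (∑ k ∈ Finset.range m, Real.sin (k * α)) ^ 2 =
      m + 2 * ∑ k ∈ Finset.range m, (if k = 0 then 0 else (m - k : ℝ)) * Real.cos (k * α) := by
  induction m with
  | zero => simp
  | succ m ih =>
    have h1 : ∑ k ∈ Finset.range m, Real.cos ((m - k : ℝ) * α) =
        ∑ k ∈ Finset.range (m + 1), (if k = 0 then 0 else 1) * Real.cos (k * α) := by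
      rw [Finset.sum_range_succ', if_pos rfl, zero_mul, add_zero, ← Finset.sum_range_reflect]
      refine Finset.sum_congr rfl fun k hk => ?_
      have hk' := Finset.mem_range.1 hk
      rw [if_neg (by omega), one_mul]
      congr 2
      rw [Nat.sub_sub, Nat.cast_sub (by omega)]
      push_cast
      ring
    have h2 : ∑ k ∈ Finset.range m, Real.cos ((m - k : ℝ) * α) =
        Real.cos (m * α) * ∑ k ∈ Finset.range m, Real.cos (k * α) +
          Real.sin (m * α) * ∑ k ∈ Finset.range m, Real.sin (k * α) := by
      rw [Finset.mul_sum, Finset.mul_sum, ← Finset.sum_add_distrib]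
      refine Finset.sum_congr rfl fun k _ => ?_
      rw [sub_mul, Real.cos_sub]
    have h3 : ∑ k ∈ Finset.range (m + 1), (if k = 0 then 0 else ((m + 1 : ℕ) - k : ℝ)) *
        Real.cos (k * α) =
        ∑ k ∈ Finset.range m, (if k = 0 then 0 else (m - k : ℝ)) * Real.cos (k * α) +
          ∑ k ∈ Finset.range (m + 1), (if k = 0 then 0 else 1) * Real.cos (k * α) := by
      have h4 : ∑ k ∈ Finset.range m, (if k = 0 then 0 else (m - k : ℝ)) * Real.cos (k * α) =
          ∑ k ∈ Finset.range (m + 1), (if k = 0 then 0 else (m - k : ℝ)) * Real.cos (k * α) := by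
        rw [Finset.sum_range_succ]
        simp
      rw [h4, ← Finset.sum_add_distrib]
      refine Finset.sum_congr rfl fun k _ => ?_
      split_ifs
      · ring
      · push_cast
        ring
    rw [h3, ← h1, h2, Finset.sum_range_succ, Finset.sum_range_succ]
    have := Real.sin_sq_add_cos_sq (m * α)
    push_cast
    nlinarith

theorem sum_fejer_cos_nonneg (m : ℕ) (hm : 0 < m) (α : ℝ) :
    0 ≤ ∑ k ∈ Finset.range m, fejer m k * Real.cos (k * α) := by
  have hm' : (0 : ℝ) < m := Nat.cast_pos.2 hm
  have h := sq_add_sq_sum_cos_sin m α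
  have h1 : m * ∑ k ∈ Finset.range m, fejer m k * Real.cos (k * α) =
      m + 2 * ∑ k ∈ Finset.range m, (if k = 0 then 0 else (m - k : ℝ)) * Real.cos (k * α) := by
    obtain ⟨r, rfl⟩ : ∃ r, m = r + 1 := ⟨m - 1, by omega⟩
    rw [Finset.sum_range_succ', Finset.sum_range_succ', mul_add, Finset.mul_sum, mul_add,
      Finset.mul_sum]
    simp only [fejer, if_true, Nat.cast_zero, zero_mul, Real.cos_zero, mul_one, mul_zero, add_zero]
    rw [add_comm]
    congr 1
    refine Finset.sum_congr rfl fun k _ => ?_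
    rw [if_neg (by omega), if_neg (by omega)]
    field_simp
  have h2 : 0 ≤ m * ∑ k ∈ Finset.range m, fejer m k * Real.cos (k * α) := by
    rw [h1, ← h]
    positivity
  exact nonneg_of_mul_nonneg_right h2 hm'

/-- The Fejér kernel for Chebyshev expansions. -/
def fejerKernel (m : ℕ) (x y : ℝ) : ℝ :=
  ∑ k ∈ Finset.range m, fejer m k * cheb k x * cheb k y

/-- With `x = cos θ`, `y = cos φ`, the product formula for cosines writes the kernel as the mean of
two values of the Fejér kernel, at `θ + φ` and `θ - φ`. -/
theorem fejerKernel_nonneg {m : ℕ} (hm : 0 < m) {x y : ℝ} (hx : x ∈ Set.Icc (-1 : ℝ) 1)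
    (hy : y ∈ Set.Icc (-1 : ℝ) 1) : 0 ≤ fejerKernel m x y := by
  rw [← Real.cos_arccos hx.1 hx.2, ← Real.cos_arccos hy.1 hy.2]
  set θ := Real.arccos x
  set φ := Real.arccos y
  have h : fejerKernel m (Real.cos θ) (Real.cos φ) =
      (∑ k ∈ Finset.range m, fejer m k * Real.cos (k * (θ + φ)) +
        ∑ k ∈ Finset.range m, fejer m k * Real.cos (k * (θ - φ))) / 2 := by
    rw [fejerKernel, ← Finset.sum_add_distrib, Finset.sum_div]
    refine Finset.sum_congr rfl fun k _ => ?_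
    rw [cheb_cos, cheb_cos, mul_add, mul_sub, Real.cos_add, Real.cos_sub]
    ring
  rw [h]
  have h1 := sum_fejer_cos_nonneg m hm (θ + φ)
  have h2 := sum_fejer_cos_nonneg m hm (θ - φ)
  positivity

end RAM

/-! ## Integrals against the Chebyshev weight -/

namespace RAM

open Polynomial.Chebyshev (measureT integrable_measureT)

theorem continuous_cheb (k : ℕ) : Continuous (cheb k) := by
  unfold cheb
  fun_prop

theorem integral_cheb_zero : ∫ x, cheb 0 x ∂measureT = Real.pi :=
  Polynomial.Chebyshev.integral_eval_T_real_measureT_zero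

theorem integral_cheb_mul_self {k : ℕ} (hk : k ≠ 0) :
    ∫ x, cheb k x * cheb k x ∂measureT = Real.pi / 2 :=
  Polynomial.Chebyshev.integral_T_real_mul_self_measureT_of_ne_zero hk

theorem integral_cheb_mul_of_ne {k l : ℕ} (h : k ≠ l) :
    ∫ x, cheb k x * cheb l x ∂measureT = 0 :=
  Polynomial.Chebyshev.integral_eval_T_real_mul_eval_T_real_measureT_of_ne h

theorem continuous_fejerKernel (m : ℕ) (y : ℝ) : Continuous (fun x => fejerKernel m x y) := by
  unfold fejerKernel
  have := continuous_cheb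
  fun_prop

/-- The Fejér kernel acts diagonally on Chebyshev polynomials. -/
theorem integral_cheb_mul_fejerKernel {m l : ℕ} (hl : l < m) (y : ℝ) :
    ∫ x, cheb l x * fejerKernel m x y ∂measureT =
      Real.pi * (if l = 0 then 1 else 1 - (l : ℝ) / m) * cheb l y := by
  have hc := continuous_cheb
  have h1 : ∀ x, cheb l x * fejerKernel m x y =
      ∑ k ∈ Finset.range m, (fejer m k * cheb k y) * (cheb l x * cheb k x) := by
    intro x
    rw [fejerKernel, Finset.mul_sum]
    refine Finset.sum_congr rfl fun k _ => ?_
    ring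
  simp only [h1]
  rw [integral_finsetSum _ fun k _ => integrable_measureT (by fun_prop)]
  simp only [integral_const_mul]
  rw [Finset.sum_eq_single l]
  · rcases eq_or_ne l 0 with rfl | h
    · have : ∀ x, cheb 0 x * cheb 0 x = cheb 0 x := fun x => by rw [cheb_zero, one_mul]
      simp only [this, integral_cheb_zero, fejer, if_true]
      ring
    · rw [integral_cheb_mul_self h, fejer, if_neg h, if_neg h]
      ring
  · intro k _ hk
    rw [integral_cheb_mul_of_ne hk.symm, mul_zero]
  · intro h
    exact absurd (Finset.mem_range.2 hl) h

theorem integral_fejerKernel {m : ℕ} (hm : 0 < m) (y : ℝ) :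
    ∫ x, fejerKernel m x y ∂measureT = Real.pi := by
  have h := integral_cheb_mul_fejerKernel hm y
  simpa [cheb_zero] using h

/-- Expand `(x - y) ^ 2` in Chebyshev polynomials of degree at most `2` in `x`; the multipliers `1 -
l / m` leave exactly `π / m`, independently of `y`. All three degrees must be below `m`. -/
theorem integral_sq_sub_fejerKernel {m : ℕ} (hm : 2 < m) (y : ℝ) :
    ∫ x, (x - y) ^ 2 * fejerKernel m x y ∂measureT = Real.pi / m := by
  have hc := continuous_cheb
  have hf := continuous_fejerKernel m y
  have h1 := integral_cheb_mul_fejerKernel (show 0 < m by omega) y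
  have h2 := integral_cheb_mul_fejerKernel (show 1 < m by omega) y
  have h3 := integral_cheb_mul_fejerKernel (show 2 < m by omega) y
  have hx : ∀ x, (x - y) ^ 2 * fejerKernel m x y = (1 / 2) * (cheb 2 x * fejerKernel m x y) +
      ((-2 * y) * (cheb 1 x * fejerKernel m x y) +
        (1 / 2 + y ^ 2) * (cheb 0 x * fejerKernel m x y)) := by
    intro x
    rw [cheb_add_two 0, cheb_one, cheb_zero]
    ring
  simp only [hx]
  rw [integral_add (integrable_measureT (by fun_prop)) (integrable_measureT (by fun_prop)),
    integral_add (integrable_measureT (by fun_prop)) (integrable_measureT (by fun_prop)),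
    integral_const_mul, integral_const_mul, integral_const_mul, h1, h2, h3, cheb_add_two 0,
    cheb_one, cheb_zero]
  have : (m : ℝ) ≠ 0 := by
    have : m ≠ 0 := by omega
    exact_mod_cast this
  simp
  field_simp
  ring

theorem ae_mem_measureT : ∀ᵐ x ∂measureT, x ∈ Set.Icc (-1 : ℝ) 1 := by
  rw [measureT]
  filter_upwards [ae_restrict_mem measurableSet_Ioc] with x hx
  exact ⟨hx.1.le, hx.2⟩

/-- `|x| ≤ t / 2 + x ^ 2 / (2 t)`. -/
theorem abs_le_half_add {t : ℝ} (ht : 0 < t) (x : ℝ) : |x| ≤ t / 2 + x ^ 2 / (2 * t) := by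
  have h : 0 ≤ (t - |x|) ^ 2 / (2 * t) := by positivity
  have h2 : (t - |x|) ^ 2 / (2 * t) = t / 2 + x ^ 2 / (2 * t) - |x| := by
    rw [sub_sq, sq_abs]
    field_simp
    ring
  linarith

/-- Smoothing by the Fejér kernel moves mass by a distance `1 / √m` on average. -/
theorem integral_mul_fejerKernel_le {m : ℕ} (hm : 2 < m) {f : ℝ → ℝ} (hf : LipschitzWith 1 f)
    {y : ℝ} (hy : y ∈ Set.Icc (-1 : ℝ) 1) {t : ℝ} (ht : 0 < t) :
    (∫ x, f x * fejerKernel m x y ∂measureT) / Real.pi ≤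
      f y + (t / 2 + 1 / (2 * t * m)) := by
  have hk := continuous_fejerKernel m y
  have hfc := hf.continuous
  rw [div_le_iff₀ Real.pi_pos]
  have h1 : ∫ x, f x * fejerKernel m x y ∂measureT ≤
      ∫ x, ((f y + t / 2) * fejerKernel m x y +
        (1 / (2 * t)) * ((x - y) ^ 2 * fejerKernel m x y)) ∂measureT := by
    refine integral_mono_ae (integrable_measureT (by fun_prop)) (integrable_measureT (by fun_prop))
      ?_
    filter_upwards [ae_mem_measureT] with x hx
    have hnn := fejerKernel_nonneg (show 0 < m by omega) hx hy
    have hfx : f x ≤ f y + (t / 2 + (x - y) ^ 2 / (2 * t)) := by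
      have h := hf.dist_le_mul x y
      rw [NNReal.coe_one, one_mul, Real.dist_eq, Real.dist_eq] at h
      linarith [le_abs_self (f x - f y), abs_le_half_add ht (x - y)]
    calc f x * fejerKernel m x y ≤ (f y + (t / 2 + (x - y) ^ 2 / (2 * t))) * fejerKernel m x y := by
          gcongr
      _ = _ := by ring
  rw [integral_add (integrable_measureT (by fun_prop)) (integrable_measureT (by fun_prop)),
    integral_const_mul, integral_const_mul, integral_fejerKernel (by omega),
    integral_sq_sub_fejerKernel hm] at h1
  refine h1.trans (le_of_eq ?_)
  have hm' : (m : ℝ) ≠ 0 := by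
    have : m ≠ 0 := by omega
    exact_mod_cast this
  field_simp
  ring

/-! ## The output density -/

/-- The polynomial part of the output. -/
def outPoly (m : ℕ) (w : ℕ → ℝ) (x : ℝ) : ℝ := ∑ k ∈ Finset.range m, coeff m w k * cheb k x

/-- The zeroth coefficient is always `1`, so mass missing from the weights goes to the constant
polynomial. In particular zero weights, which arise from `0 / 0` when all accumulators vanish, still
give a density. -/
theorem outPoly_eq {m : ℕ} (hm : 0 < m) (w : ℕ → ℝ) (x : ℝ) : outPoly m w x =
    (1 - ∑ j ∈ Finset.range (m + 1), w j) +
      ∑ j ∈ Finset.range (m + 1), w j * fejerKernel m x (node m j) := by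
  obtain ⟨r, hr⟩ : ∃ r, m = r + 1 := ⟨m - 1, by omega⟩
  have h1 : ∀ y, fejerKernel m x y =
      (∑ k ∈ Finset.range r, fejer m (k + 1) * cheb (k + 1) x * cheb (k + 1) y) + 1 := by
    intro y
    rw [fejerKernel]
    nth_rewrite 1 [hr]
    rw [Finset.sum_range_succ', cheb_zero, cheb_zero, fejer, if_pos rfl]
    norm_num
  have h2 : outPoly m w x =
      (∑ k ∈ Finset.range r, coeff m w (k + 1) * cheb (k + 1) x) + 1 := by
    rw [outPoly]
    nth_rewrite 1 [hr]
    rw [Finset.sum_range_succ', cheb_zero, coeff, if_pos rfl, one_mul]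
  simp only [h1, mul_add, mul_one, Finset.sum_add_distrib]
  rw [h2]
  have h3 : ∑ k ∈ Finset.range r, coeff m w (k + 1) * cheb (k + 1) x =
      ∑ j ∈ Finset.range (m + 1), w j *
        ∑ k ∈ Finset.range r, fejer m (k + 1) * cheb (k + 1) x * cheb (k + 1) (node m j) := by
    simp only [coeff, if_neg (Nat.succ_ne_zero _), Finset.sum_mul, Finset.mul_sum]
    rw [Finset.sum_comm]
    refine Finset.sum_congr rfl fun j _ => Finset.sum_congr rfl fun k _ => ?_
    ring
  rw [h3]
  ring

theorem node_mem {m j : ℕ} (hm : 0 < m) (hj : j < m + 1) : node m j ∈ Set.Icc (-1 : ℝ) 1 := by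
  have hm' : (0 : ℝ) < m := Nat.cast_pos.2 hm
  have hj' : (j : ℝ) ≤ m := by exact_mod_cast Nat.lt_succ_iff.1 hj
  have h1 : 2 * (j : ℝ) / m ≤ 2 := by
    rw [div_le_iff₀ hm']
    linarith
  have h2 : 0 ≤ 2 * (j : ℝ) / m := by positivity
  constructor <;> simp only [node] <;> linarith

theorem outPoly_nonneg {m : ℕ} (hm : 0 < m) {w : ℕ → ℝ} (hw : ∀ j, 0 ≤ w j)
    (hw1 : ∑ j ∈ Finset.range (m + 1), w j ≤ 1) {x : ℝ} (hx : x ∈ Set.Icc (-1 : ℝ) 1) :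
    0 ≤ outPoly m w x := by
  rw [outPoly_eq hm]
  refine add_nonneg (by linarith) (Finset.sum_nonneg fun j hj => mul_nonneg (hw j) ?_)
  exact fejerKernel_nonneg hm hx (node_mem hm (Finset.mem_range.1 hj))

theorem continuous_outPoly (m : ℕ) (w : ℕ → ℝ) : Continuous (outPoly m w) := by
  unfold outPoly
  have := continuous_cheb
  fun_prop

theorem integral_outPoly {m : ℕ} (hm : 0 < m) (w : ℕ → ℝ) :
    ∫ x, outPoly m w x ∂measureT = Real.pi := by
  have hk := continuous_fejerKernel m
  simp only [outPoly_eq hm]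
  have h1 : ∫ _x, (1 : ℝ) ∂measureT = Real.pi := by
    simpa only [cheb_zero] using integral_cheb_zero
  have h2 : ∀ x, ((1 - ∑ j ∈ Finset.range (m + 1), w j) +
      ∑ j ∈ Finset.range (m + 1), w j * fejerKernel m x (node m j)) =
      (1 - ∑ j ∈ Finset.range (m + 1), w j) * 1 +
      ∑ j ∈ Finset.range (m + 1), w j * fejerKernel m x (node m j) := fun x => by rw [mul_one]
  simp only [h2]
  rw [integral_add (integrable_measureT (by fun_prop)) (integrable_measureT (by fun_prop)),
    integral_const_mul, h1, integral_finsetSum _ fun k _ => integrable_measureT (by fun_prop)]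
  simp only [integral_const_mul, integral_fejerKernel hm]
  rw [← Finset.sum_mul]
  ring

/-- The function that the output represents. -/
def outDensity (m : ℕ) (w : ℕ → ℝ) (x : ℝ) : ℝ := outPoly m w x / (Real.pi * √(1 - x ^ 2))

theorem integral_mul_density (f p : ℝ → ℝ) :
    ∫ x in Set.Icc (-1 : ℝ) 1, f x * (p x / (Real.pi * √(1 - x ^ 2))) =
      (∫ x, f x * p x ∂measureT) / Real.pi := by
  rw [Polynomial.Chebyshev.integral_measureT, integral_Icc_eq_integral_Ioc,
    ← intervalIntegral.integral_of_le (by norm_num), ← intervalIntegral.integral_div]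
  refine intervalIntegral.integral_congr fun x _ => ?_
  simp only [Real.sqrt_inv, div_eq_mul_inv, mul_inv]
  ring

theorem integrable_density {p : ℝ → ℝ} (hp : Continuous p) :
    IntegrableOn (fun x => p x / (Real.pi * √(1 - x ^ 2))) (Set.Icc (-1) 1) := by
  have h := Polynomial.Chebyshev.intervalIntegrable_sqrt_one_sub_sq_inv.continuousOn_mul
    (hp.continuousOn (s := Set.uIcc (-1 : ℝ) 1))
  rw [intervalIntegrable_iff_integrableOn_Icc_of_le (by norm_num)] at h
  refine (h.div_const Real.pi).congr (Filter.Eventually.of_forall fun x => ?_)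
  simp only [Real.sqrt_inv]
  rw [div_mul_eq_div_div_swap]
  rfl

theorem isDensity_outDensity {m : ℕ} (hm : 0 < m) {w : ℕ → ℝ} (hw : ∀ j, 0 ≤ w j)
    (hw1 : ∑ j ∈ Finset.range (m + 1), w j ≤ 1) : SpectralDensity.IsDensity (outDensity m w) := by
  refine ⟨fun x hx => div_nonneg (outPoly_nonneg hm hw hw1 hx) (by positivity),
    integrable_density (continuous_outPoly m w), ?_⟩
  have h := integral_mul_density (fun _ => 1) (outPoly m w)
  simp only [one_mul, integral_outPoly hm, div_self Real.pi_ne_zero] at h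
  exact h

end RAM

/-! ## The Wasserstein distance of the output -/

namespace RAM

open Polynomial.Chebyshev (measureT integrable_measureT)
open SpectralDensity

variable {n : ℕ} {G : SimpleGraph (Fin n)} {L : Fin n → List (Fin n)} {m : ℕ}

/-- The Bernstein approximation moves mass by a distance `1 / √m` on average. -/
theorem sum_bernstein_le (hm : 0 < m) {f : ℝ → ℝ} (hf : LipschitzWith 1 f) {y : ℝ}
    (h0 : 0 ≤ (1 + y) / 2) (h1 : (1 + y) / 2 ≤ 1) {t : ℝ} (ht : 0 < t) :
    ∑ j ∈ Finset.range (m + 1), (bernsteinPolynomial ℝ m j).eval ((1 + y) / 2) * f (node m j) ≤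
      f y + (t / 2 + 1 / (2 * t * m)) := by
  have hm' : (0 : ℝ) < m := Nat.cast_pos.2 hm
  set b : ℕ → ℝ := fun j => (bernsteinPolynomial ℝ m j).eval ((1 + y) / 2) with hb
  have hb0 : ∀ j, 0 ≤ b j := fun j => bernsteinPolynomial_eval_nonneg h0 h1 m j
  have hb1 : ∑ j ∈ Finset.range (m + 1), b j = 1 := sum_bernsteinPolynomial_eval m _
  have hvar : ∑ j ∈ Finset.range (m + 1), b j * (node m j - y) ^ 2 ≤ 1 / m := by
    have h := congrArg (Polynomial.eval ((1 + y) / 2)) (bernsteinPolynomial.variance ℝ m)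
    simp only [Polynomial.eval_finsetSum, Polynomial.eval_mul, Polynomial.eval_pow,
      Polynomial.eval_sub, Polynomial.eval_X, Polynomial.eval_natCast,
      Polynomial.eval_one, nsmul_eq_mul] at h
    have h2 : ∑ j ∈ Finset.range (m + 1), b j * (node m j - y) ^ 2 =
        (4 / m ^ 2) * ∑ j ∈ Finset.range (m + 1), (m * ((1 + y) / 2) - j) ^ 2 * b j := by
      rw [Finset.mul_sum]
      refine Finset.sum_congr rfl fun j _ => ?_
      rw [node]
      field_simp
      ring
    rw [h2, h]
    have h3 : 4 / (m : ℝ) ^ 2 * (m * ((1 + y) / 2) * (1 - (1 + y) / 2)) =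
        (1 - y ^ 2) / m := by
      field_simp
      ring
    rw [h3]
    gcongr
    nlinarith [sq_nonneg y]
  have hpt : ∀ j, b j * f (node m j) ≤ b j * (f y + t / 2) +
      b j * (node m j - y) ^ 2 * (1 / (2 * t)) := by
    intro j
    have h := hf.dist_le_mul (node m j) y
    rw [NNReal.coe_one, one_mul, Real.dist_eq, Real.dist_eq] at h
    have h2 : f (node m j) ≤ f y + (t / 2 + (node m j - y) ^ 2 / (2 * t)) := by
      linarith [le_abs_self (f (node m j) - f y), abs_le_half_add ht (node m j - y)]
    calc b j * f (node m j) ≤ b j * (f y + (t / 2 + (node m j - y) ^ 2 / (2 * t))) :=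
          mul_le_mul_of_nonneg_left h2 (hb0 j)
      _ = _ := by ring
  calc ∑ j ∈ Finset.range (m + 1), b j * f (node m j) ≤
      ∑ j ∈ Finset.range (m + 1), (b j * (f y + t / 2) +
        b j * (node m j - y) ^ 2 * (1 / (2 * t))) := Finset.sum_le_sum fun j _ => hpt j
    _ = (f y + t / 2) +
        (∑ j ∈ Finset.range (m + 1), b j * (node m j - y) ^ 2) * (1 / (2 * t)) := by
        rw [Finset.sum_add_distrib, ← Finset.sum_mul, ← Finset.sum_mul, hb1, one_mul]
    _ ≤ (f y + t / 2) + 1 / m * (1 / (2 * t)) := by gcongr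
    _ = _ := by
        field_simp
        ring

theorem sum_bernsteinMass_mul_le (hL : IsAdjacencyList G L) (hn : 0 < n) (hm : 0 < m)
    {f : ℝ → ℝ} (hf : LipschitzWith 1 f) {t : ℝ} (ht : 0 < t) :
    ∑ j ∈ Finset.range (m + 1), bernsteinMass G m j * f (node m j) ≤
      (∑ i, f ((normalizedAdjacency_isHermitian G).eigenvalues i)) / n +
        (t / 2 + 1 / (2 * t * m)) := by
  have hn' : (0 : ℝ) < n := Nat.cast_pos.2 hn
  set ev := (normalizedAdjacency_isHermitian G).eigenvalues
  have h1 : ∑ j ∈ Finset.range (m + 1), bernsteinMass G m j * f (node m j) =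
      (∑ i, ∑ j ∈ Finset.range (m + 1),
        (bernsteinPolynomial ℝ m j).eval ((1 + ev i) / 2) * f (node m j)) / n := by
    rw [Finset.sum_comm, Finset.sum_div]
    refine Finset.sum_congr rfl fun j _ => ?_
    rw [bernsteinMass, ← Finset.sum_mul]
    ring
  rw [h1]
  calc _ ≤ (∑ i, (f (ev i) + (t / 2 + 1 / (2 * t * m)))) / n := by
        gcongr with i
        exact sum_bernstein_le hm hf (half_eigenvalues_mem hL i).1 (half_eigenvalues_mem hL i).2 ht
    _ = _ := by
        rw [Finset.sum_add_distrib, add_div]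
        simp only [Finset.sum_const, Finset.card_univ, Fintype.card_fin, nsmul_eq_mul]
        field_simp

theorem integral_spectralDensity {A : Matrix (Fin n) (Fin n) ℝ} (hA : A.IsHermitian)
    (f : ℝ → ℝ) : ∫ x, f x ∂(spectralDensity hA) = (∑ i, f (hA.eigenvalues i)) / n := by
  rw [spectralDensity, integral_smul_measure,
    integral_finsetSum_measure fun i _ => integrable_dirac (by simp)]
  simp only [integral_dirac, smul_eq_mul, ENNReal.toReal_inv, ENNReal.toReal_natCast]
  ring

theorem integral_densityMeasure (hm : 0 < m) {w : ℕ → ℝ} (hw : ∀ j, 0 ≤ w j)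
    (hw1 : ∑ j ∈ Finset.range (m + 1), w j ≤ 1) (f : ℝ → ℝ) :
    ∫ x, f x ∂(densityMeasure (outDensity m w)) =
      (∫ x, f x * outPoly m w x ∂measureT) / Real.pi := by
  have hq : Measurable (outDensity m w) := by
    have := continuous_outPoly m w
    unfold outDensity
    fun_prop
  rw [densityMeasure, integral_withDensity_eq_integral_toReal_smul (by fun_prop) (by simp),
    ← integral_mul_density]
  refine setIntegral_congr_fun measurableSet_Icc fun x hx => ?_
  simp only [smul_eq_mul]
  rw [ENNReal.toReal_ofReal ((isDensity_outDensity hm hw hw1).1 x hx), mul_comm]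
  rfl

/-- Three contributions: Fejér smoothing of the atoms, the error in the weights, and the Bernstein
approximation of the spectral density. -/
theorem wasserstein1_le (hL : IsAdjacencyList G L) (hn : 0 < n) (hm : 2 < m) {w : ℕ → ℝ}
    (hw : ∀ j, 0 ≤ w j) (hw1 : ∑ j ∈ Finset.range (m + 1), w j = 1) {η t : ℝ} (ht : 0 < t)
    (hη : ∑ j ∈ Finset.range (m + 1), |w j - bernsteinMass G m j| ≤ η) :
    wasserstein1 (densityMeasure (outDensity m w))
      (spectralDensity (normalizedAdjacency_isHermitian G)) ≤
        ENNReal.ofReal (2 * (t / 2 + 1 / (2 * t * m)) + η) := by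
  have hm0 : 0 < m := by omega
  refine iSup₂_le fun f hf => ENNReal.ofReal_le_ofReal ?_
  have hfc := hf.continuous
  have hk := continuous_fejerKernel m
  rw [integral_densityMeasure hm0 hw hw1.le, integral_spectralDensity]
  have h1 : (∫ x, f x * outPoly m w x ∂measureT) / Real.pi =
      ∑ j ∈ Finset.range (m + 1), w j *
        ((∫ x, f x * fejerKernel m x (node m j) ∂measureT) / Real.pi) := by
    have h : ∀ x, f x * outPoly m w x =
        ∑ j ∈ Finset.range (m + 1), w j * (f x * fejerKernel m x (node m j)) := by
      intro x
      rw [outPoly_eq hm0, hw1, sub_self, zero_add, Finset.mul_sum]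
      refine Finset.sum_congr rfl fun j _ => ?_
      ring
    simp only [h]
    rw [integral_finsetSum _ fun k _ => integrable_measureT (by fun_prop), Finset.sum_div]
    simp only [integral_const_mul, mul_div_assoc]
  have h2 : ∑ j ∈ Finset.range (m + 1), w j *
      ((∫ x, f x * fejerKernel m x (node m j) ∂measureT) / Real.pi) ≤
      ∑ j ∈ Finset.range (m + 1), w j * f (node m j) + (t / 2 + 1 / (2 * t * m)) := by
    calc _ ≤ ∑ j ∈ Finset.range (m + 1), w j * (f (node m j) + (t / 2 + 1 / (2 * t * m))) := by
          refine Finset.sum_le_sum fun j hj => mul_le_mul_of_nonneg_left ?_ (hw j)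
          exact integral_mul_fejerKernel_le hm hf (node_mem hm0 (Finset.mem_range.1 hj)) ht
      _ = _ := by
          simp only [mul_add, Finset.sum_add_distrib]
          rw [← Finset.sum_mul, ← Finset.sum_mul, hw1]
          ring
  have h3 : ∑ j ∈ Finset.range (m + 1), w j * f (node m j) ≤
      ∑ j ∈ Finset.range (m + 1), bernsteinMass G m j * f (node m j) + η := by
    -- Both families of weights have total mass `1`, so `f` may be replaced by `f - f 0`, which is
    -- bounded by `1` on the nodes.
    have h4 : ∑ j ∈ Finset.range (m + 1), w j * f (node m j) -
        ∑ j ∈ Finset.range (m + 1), bernsteinMass G m j * f (node m j) =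
        ∑ j ∈ Finset.range (m + 1), (w j - bernsteinMass G m j) * (f (node m j) - f 0) := by
      simp only [mul_sub, sub_mul, Finset.sum_sub_distrib, ← Finset.sum_mul, hw1,
        sum_bernsteinMass G hn]
      ring
    have h5 : ∑ j ∈ Finset.range (m + 1), (w j - bernsteinMass G m j) * (f (node m j) - f 0) ≤
        ∑ j ∈ Finset.range (m + 1), |w j - bernsteinMass G m j| := by
      refine Finset.sum_le_sum fun j hj => (le_abs_self _).trans ?_
      rw [abs_mul]
      refine mul_le_of_le_one_right (abs_nonneg _) ?_
      have h := hf.dist_le_mul (node m j) 0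
      rw [NNReal.coe_one, one_mul, Real.dist_eq, Real.dist_eq, sub_zero] at h
      exact h.trans (abs_le.2 (node_mem hm0 (Finset.mem_range.1 hj)))
    linarith
  have h6 := sum_bernsteinMass_mul_le hL hn hm0 hf ht
  rw [h1]
  linarith

/-- Accurate accumulated estimates give accurate normalized weights. -/
theorem sum_abs_weight_sub_le {acc μ : ℕ → ℝ} {N η : ℝ} (hN : 0 < N) (hη : η < 1)
    (hμ : ∀ j, 0 ≤ μ j) (hμ1 : ∑ j ∈ Finset.range (m + 1), μ j = 1)
    (h : ∑ j ∈ Finset.range (m + 1), |acc j - N * μ j| ≤ N * η) :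
    ∑ j ∈ Finset.range (m + 1), weight m acc j = 1 ∧
      ∑ j ∈ Finset.range (m + 1), |weight m acc j - μ j| ≤ 2 * η := by
  set S := ∑ j ∈ Finset.range (m + 1), |acc j| with hS
  have h1 : ∑ j ∈ Finset.range (m + 1), |(|acc j| - N * μ j)| ≤ N * η := by
    refine (Finset.sum_le_sum fun j _ => ?_).trans h
    have := abs_abs_sub_abs_le_abs_sub (acc j) (N * μ j)
    rwa [abs_of_nonneg (mul_nonneg hN.le (hμ j))] at this
  have h2 : |S - N| ≤ N * η := by
    refine le_trans ?_ h1
    have : S - N = ∑ j ∈ Finset.range (m + 1), (|acc j| - N * μ j) := by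
      rw [Finset.sum_sub_distrib, ← Finset.mul_sum, hμ1, mul_one]
    rw [this]
    exact Finset.abs_sum_le_sum_abs _ _
  -- It is here that `η < 1` is needed: `S ≥ N (1 - η)`.
  have hS0 : 0 < S := by
    have := (abs_le.1 h2).1
    nlinarith
  refine ⟨?_, ?_⟩
  · simp only [weight]
    rw [← Finset.sum_div, div_self hS0.ne']
  · have h3 : ∀ j, N * |weight m acc j - μ j| ≤ |acc j| * (|S - N| / S) +
        |(|acc j| - N * μ j)| := by
      intro j
      -- The first term is the error of normalizing by `S` instead of `N`, the second the error of
      -- the accumulator; each sums to at most `N η`.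
      have h4 : N * (weight m acc j - μ j) = |acc j| * ((N - S) / S) + (|acc j| - N * μ j) := by
        rw [weight, ← hS]
        field_simp
        ring
      have h5 : N * |weight m acc j - μ j| = |N * (weight m acc j - μ j)| := by
        rw [abs_mul, abs_of_pos hN]
      rw [h5, h4]
      refine (abs_add_le _ _).trans (le_of_eq ?_)
      rw [abs_mul, abs_abs, abs_div, abs_of_pos hS0, abs_sub_comm]
    have h6 : N * ∑ j ∈ Finset.range (m + 1), |weight m acc j - μ j| ≤ N * (2 * η) := by
      rw [Finset.mul_sum]
      refine (Finset.sum_le_sum fun j _ => h3 j).trans ?_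
      rw [Finset.sum_add_distrib, ← Finset.sum_mul, ← hS, mul_div_cancel₀ _ hS0.ne']
      linarith
    exact le_of_mul_le_mul_left h6 hN

theorem weight_nonneg (acc : ℕ → ℝ) (j : ℕ) : 0 ≤ weight m acc j :=
  div_nonneg (abs_nonneg _) (Finset.sum_nonneg fun _ _ => abs_nonneg _)

theorem sum_weight_le_one (acc : ℕ → ℝ) : ∑ j ∈ Finset.range (m + 1), weight m acc j ≤ 1 := by
  simp only [weight]
  rw [← Finset.sum_div]
  exact div_self_le_one _

end RAM

/-! ## The running time and the guarantee -/

namespace RAM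

open SpectralDensity

variable {n : ℕ} {G : SimpleGraph (Fin n)} {L : Fin n → List (Fin n)} {m : ℕ}

theorem degreeFor_le {a Y : ℕ} (ha : a ≤ Y) : degreeFor a ≤ 16 * Y ^ 2 := by
  rw [degreeFor, ← sq]
  gcongr

/-- Since `n, Y ≥ 1`, every lower-order term can be raised to the leading monomial; the other cost
bounds proceed likewise. -/
theorem layerCost_le {Y : ℕ} (hY : 1 ≤ Y) (hn : 1 ≤ n) (hm : m ≤ 16 * Y ^ 2) :
    layerCost n m ≤ 3033 * n * Y ^ 4 := by
  have h2 : 1 ≤ Y ^ 2 := Nat.one_le_pow _ _ hY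
  have h4 : 1 ≤ n * Y ^ 4 := Nat.mul_pos hn (Nat.one_le_pow _ _ hY)
  have h6 : 6 ≤ 6 * (n * Y ^ 2) := by nlinarith [Nat.mul_le_mul hn h2]
  have hm1 : m + 1 ≤ 17 * Y ^ 2 := by omega
  calc layerCost n m
      ≤ 17 * Y ^ 2 * (n * (10 * (16 * Y ^ 2) + 8 * Y ^ 2) + 6 * (n * Y ^ 2)) +
          17 * Y ^ 2 * n * (4 * Y ^ 2) + 7 * (n * Y ^ 4) := by
        unfold layerCost
        gcongr <;> omega
    _ = 3033 * n * Y ^ 4 := by ring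

theorem trialCost_le {Y : ℕ} (hY : 1 ≤ Y) (hn : 1 ≤ n) (hm : m ≤ 16 * Y ^ 2) :
    trialCost n m + 3 ≤ 48734 * n * Y ^ 6 := by
  have h2 : 1 ≤ Y ^ 2 := Nat.one_le_pow _ _ hY
  have h4 : 1 ≤ Y ^ 4 := Nat.one_le_pow _ _ hY
  have h4n : 1 ≤ n * Y ^ 4 := Nat.mul_pos hn h4
  have h6 : 1 ≤ n * Y ^ 6 := Nat.mul_pos hn (Nat.one_le_pow _ _ hY)
  have hm2 : m + 2 ≤ 18 * Y ^ 2 := by omega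
  have hm1 : m + 1 ≤ 17 * Y ^ 2 := by omega
  calc trialCost n m + 3
      ≤ 18 * Y ^ 2 * n * (4 * Y ^ 4) + 16 * Y ^ 2 * (3033 * n * Y ^ 4 + 3 * (n * Y ^ 4)) +
          17 * Y ^ 2 * (4 * (n * Y ^ 4)) + 15 * (n * Y ^ 6) + 3 * (n * Y ^ 6) := by
        unfold trialCost
        gcongr
        · omega
        · exact layerCost_le hY hn hm
        all_goals omega
    _ = 48734 * n * Y ^ 6 := by ring

theorem trialsFor_le {a b Y : ℕ} (hY : 1 ≤ Y) (ha : a ≤ Y) (hb : b ≤ Y) :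
    trialsFor a b ≤ 10357760 * Y ^ 8 := by
  have h2 : 1 ≤ Y ^ 2 := Nat.one_le_pow _ _ hY
  have hm : degreeFor a + 1 ≤ 17 * Y ^ 2 := by
    have := degreeFor_le ha
    omega
  have hbY : b ≤ Y ^ 2 := hb.trans (Nat.le_self_pow two_ne_zero Y)
  calc trialsFor a b
      ≤ 1024 * ((Y * (17 * Y ^ 2)) * (Y * (17 * Y ^ 2))) * (2 * (17 * Y ^ 2) + Y ^ 2) := by
        unfold trialsFor
        gcongr
    _ = 10357760 * Y ^ 8 := by ring

theorem outputCost_le {Y : ℕ} (hY : 1 ≤ Y) (hm : m ≤ 16 * Y ^ 2) :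
    outputCost m ≤ 1879 * Y ^ 4 := by
  have h2 : 1 ≤ Y ^ 2 := Nat.one_le_pow _ _ hY
  have h4 : 1 ≤ Y ^ 4 := Nat.one_le_pow _ _ hY
  have hm1 : m + 1 ≤ 17 * Y ^ 2 := by omega
  calc outputCost m ≤ 17 * Y ^ 2 * (4 * Y ^ 2) +
          17 * Y ^ 2 * (16 * Y ^ 2 * 6 + 10 * Y ^ 2) + 9 * Y ^ 4 := by
        unfold outputCost
        gcongr <;> omega
    _ = 1879 * Y ^ 4 := by ring

/-- The exponent `14` is `8` from the number of trials plus `6` from the cost of a trial. -/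
theorem densityCost_le {a b Y : ℕ} (hY : 1 ≤ Y) (hn : 1 ≤ n) (ha : a ≤ Y) (hb : b ≤ Y) :
    densityCost n a b ≤ 504775077745 * n * Y ^ 14 := by
  have hm := degreeFor_le ha
  have h1 : 1 ≤ n * Y ^ 14 := Nat.mul_pos hn (Nat.one_le_pow _ _ hY)
  have h2 : Y ≤ n * Y ^ 14 :=
    (Nat.le_self_pow (by norm_num) Y).trans (Nat.le_mul_of_pos_left _ hn)
  have h3 : Y ^ 4 ≤ n * Y ^ 14 :=
    (Nat.pow_le_pow_right hY (by norm_num)).trans (Nat.le_mul_of_pos_left _ hn)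
  have h4 : outputCost (degreeFor a) ≤ 1879 * (n * Y ^ 14) :=
    (outputCost_le hY hm).trans (by gcongr)
  calc densityCost n a b ≤ 10357760 * Y ^ 8 * (48734 * n * Y ^ 6) + 1879 * (n * Y ^ 14) +
          n * Y ^ 14 * 2 + n * Y ^ 14 * 4 + 20 * (n * Y ^ 14) := by
        unfold densityCost
        gcongr
        · exact trialsFor_le hY ha hb
        · exact trialCost_le hY hn hm
        · exact ha.trans h2
        · exact hb.trans h2
        · omega
    _ = 504775077745 * n * Y ^ 14 := by ring

theorem densityCost_ceil_le {ε δ : ℝ} (hε : ε ∈ Set.Ioo (0 : ℝ) 1) (hδ : δ ∈ Set.Ioo (0 : ℝ) 1)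
    (hn : 1 ≤ n) : (densityCost n ⌈1 / ε⌉₊ ⌈Real.logb 2 (1 / δ)⌉₊ : ℝ) ≤
      504775077745 * 3 ^ 14 * n * ((1 + Real.log (1 / δ)) / ε) ^ 14 := by
  set X := (1 + Real.log (1 / δ)) / ε with hX
  have hl : 0 ≤ Real.log (1 / δ) := Real.log_nonneg (by rw [le_div_iff₀ hδ.1]; linarith [hδ.2])
  have h1 : 1 / ε ≤ X := by
    rw [hX]
    gcongr
    · exact hε.1.le
    · linarith
  have h2 : 1 + Real.log (1 / δ) ≤ X := by
    rw [hX, le_div_iff₀ hε.1]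
    nlinarith [hε.2]
  have hX1 : 1 ≤ X := by linarith
  set Y := max ⌈1 / ε⌉₊ ⌈Real.logb 2 (1 / δ)⌉₊ with hYdef
  have hY1 : 1 ≤ Y := le_max_of_le_left (Nat.ceil_pos.2 (one_div_pos.2 hε.1))
  have ha : (⌈1 / ε⌉₊ : ℝ) ≤ 3 * X := by
    have := Nat.ceil_lt_add_one (one_div_pos.2 hε.1).le
    linarith
  have hb : (⌈Real.logb 2 (1 / δ)⌉₊ : ℝ) ≤ 3 * X := by
    have h0 : Real.logb 2 (1 / δ) ≤ 2 * Real.log (1 / δ) := by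
      rw [Real.logb, div_le_iff₀ (Real.log_pos one_lt_two)]
      nlinarith [Real.log_two_gt_d9]
    have := Nat.ceil_lt_add_one (a := Real.logb 2 (1 / δ))
      (div_nonneg hl (Real.log_nonneg one_le_two))
    linarith
  have hYX : (Y : ℝ) ≤ 3 * X := by
    rw [hYdef, Nat.cast_max]
    exact max_le ha hb
  calc (densityCost n ⌈1 / ε⌉₊ ⌈Real.logb 2 (1 / δ)⌉₊ : ℝ)
      ≤ ((504775077745 * n * Y ^ 14 : ℕ) : ℝ) :=
        Nat.cast_le.2 (densityCost_le hY1 hn (le_max_left _ _) (le_max_right _ _))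
    _ = 504775077745 * n * (Y : ℝ) ^ 14 := by push_cast; rfl
    _ ≤ 504775077745 * n * (3 * X) ^ 14 := by gcongr
    _ = 504775077745 * 3 ^ 14 * n * X ^ 14 := by ring

/-- The first cells of real array `0` are the coefficients of the density computed from the
accumulated values `acc`. -/
def Represents (m : ℕ) (acc : ℕ → ℝ) (b : Mem) : Prop :=
  ∀ k < m, b 0 k = coeff m (weight m acc) k

theorem Represents.output_eq {acc : ℕ → ℝ} {σ : Store} (h : Represents m acc σ.rarr)
    (hm : σ.nvar 0 = m) : output σ = outDensity m (weight m acc) := by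
  funext x
  rw [output, outDensity, outPoly, hm]
  congr 1
  exact Finset.sum_congr rfl fun k hk => by rw [h k (Finset.mem_range.1 hk), cheb]

theorem all_outputStep {a : Mem} (ha : ∀ x, x = 0 ∨ x = 4 → a x = fun _ => 0) :
    (outputStep m a).All (Represents m (a 3)) := by
  obtain ⟨b, hb, h⟩ := RAM.output_eq (m := m) a (fun k => by rw [ha 0 (Or.inl rfl)])
    (by rw [ha 4 (Or.inr rfl)])
  rw [hb]
  exact h

theorem all_mainStep (N B : ℕ) :
    (mainStep L m N B (fun _ _ => 0)).All (fun b => ∃ acc, Represents m acc b) :=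
  Sampler.All_bind (all_iter_trialStep B N _) fun a ha =>
    (all_outputStep ha).mono fun _ h => ⟨a 3, h⟩

open Classical in
theorem le_expect_mainStep (hL : IsAdjacencyList G L) (hm : m ≠ 0) (hn : 0 < n) {B : ℕ}
    (hB : 0 < B) (N : ℕ) :
    1 - 2 * (m + 1) * Real.exp (-(9 * N / (4 * B ^ 2))) ≤
      (mainStep L m N B (fun _ _ => 0)).expect (fun b => if ∃ acc,
        (∀ j < m + 1, |acc j - N * bernsteinMass G m j| ≤ N * (12 / B : ℝ)) ∧
          Represents m acc b then 1 else 0) := by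
  have h := expect_bad_le hL hm hn hB (fun _ _ => 0) (fun _ => rfl) N
  rw [mainStep, Sampler.expect_bind]
  refine (sub_le_sub_left h 1).trans ?_
  rw [← Sampler.expect_const (Sampler.iter N (fun _ => trialStep L m B) (fun _ _ => 0)) 1,
    ← Sampler.expect_sub]
  refine Sampler.expect_mono (all_iter_trialStep B N _) fun a ha => ?_
  by_cases hbad : ∃ j < m + 1, N * (12 / B : ℝ) < |a 3 j - N * bernsteinMass G m j|
  · rw [if_pos hbad, Sampler.expect_const, sub_self]
    exact Sampler.expect_nonneg fun b => by split_ifs <;> norm_num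
  · rw [if_neg hbad, sub_zero, Sampler.expect_const]
    push Not at hbad
    rw [Sampler.expect_congr (g := fun _ => 1) (all_outputStep ha)
      fun b hb => if_pos ⟨a 3, hbad, hb⟩, Sampler.expect_const]

/-- The failure probability for the chosen parameters. -/
theorem failure_le {a b : ℕ} (ha : 0 < a) {δ : ℝ} (hδ : δ ∈ Set.Ioo (0 : ℝ) 1)
    (hb : Real.logb 2 (1 / δ) ≤ b) :
    2 * (degreeFor a + 1) * Real.exp (-(9 * trialsFor a b / (4 * boundFor a ^ 2))) ≤ δ := by
  set M : ℝ := (degreeFor a : ℝ) + 1 with hM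
  have ha' : (0 : ℝ) < a := Nat.cast_pos.2 ha
  have hM0 : 0 < M := by positivity
  -- The constants in `trialsFor` and `boundFor` are matched: `9 * 1024 = 4 * 48 ^ 2`.
  have h1 : (9 * trialsFor a b / (4 * boundFor a ^ 2) : ℝ) = 2 * M + b := by
    have h2 : (trialsFor a b : ℝ) = 1024 * ((a * M) * (a * M)) * (2 * M + b) := by
      simp [trialsFor, hM]
    have h3 : (boundFor a : ℝ) = 48 * (a * M) := by simp [boundFor, hM]
    rw [h2, h3]
    field_simp
    norm_num
  -- The part `2 M` of the exponent absorbs the union bound, leaving `exp (-b) ≤ δ`, as `log (1 / δ)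
  -- ≤ logb 2 (1 / δ) ≤ b`.
  have h4 : 2 * M * Real.exp (-(2 * M)) ≤ 1 := by
    rw [Real.exp_neg, ← div_eq_mul_inv, div_le_one (Real.exp_pos _)]
    linarith [Real.add_one_le_exp (2 * M)]
  have h5 : Real.exp (-b) ≤ δ := by
    rw [← Real.le_log_iff_exp_le hδ.1, neg_le, ← Real.log_inv, ← one_div]
    refine le_trans ?_ hb
    have hl : 0 ≤ Real.log (1 / δ) :=
      Real.log_nonneg (by rw [le_div_iff₀ hδ.1]; linarith [hδ.2])
    rw [Real.logb, le_div_iff₀ (Real.log_pos one_lt_two)]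
    nlinarith [Real.log_two_lt_d9]
  rw [h1, neg_add, Real.exp_add, ← mul_assoc]
  calc _ ≤ 1 * Real.exp (-b) := by gcongr
    _ ≤ δ := by rwa [one_mul]

theorem wasserstein1_output_le (hL : IsAdjacencyList G L) (hn : 0 < n) {a : ℕ} (ha : 0 < a)
    {N : ℝ} (hN : 0 < N) {acc : ℕ → ℝ} (hacc : ∀ j < degreeFor a + 1,
      |acc j - N * bernsteinMass G (degreeFor a) j| ≤ N * (12 / boundFor a : ℝ)) :
    wasserstein1 (densityMeasure (outDensity (degreeFor a) (weight (degreeFor a) acc)))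
      (spectralDensity (normalizedAdjacency_isHermitian G)) ≤ ENNReal.ofReal (1 / a) := by
  have ha' : (1 : ℝ) ≤ a := Nat.one_le_cast.2 ha
  have hm : (degreeFor a : ℝ) = 16 * (a * a) := by simp [degreeFor]
  have hm2 : 2 < degreeFor a := by
    have := Nat.mul_pos ha ha
    rw [degreeFor]
    omega
  have hB : (boundFor a : ℝ) = 48 * (a * (degreeFor a + 1)) := by simp [boundFor]
  have hsum : ∑ j ∈ Finset.range (degreeFor a + 1),
      |acc j - N * bernsteinMass G (degreeFor a) j| ≤ N * (1 / (4 * a)) := by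
    refine (Finset.sum_le_sum fun j hj => hacc j (Finset.mem_range.1 hj)).trans (le_of_eq ?_)
    rw [Finset.sum_const, Finset.card_range, nsmul_eq_mul, hB]
    push_cast
    field_simp
    norm_num
  have hη : 1 / (4 * (a : ℝ)) < 1 := by
    rw [div_lt_one (by positivity)]
    linarith
  obtain ⟨h1, h2⟩ := sum_abs_weight_sub_le hN hη (bernsteinMass_nonneg hL _)
    (sum_bernsteinMass G hn _) hsum
  -- With `m = 16 a ^ 2` and `t = 1 / √m = 1 / (4 a)`, each of the two approximations costs `1 / (4
  -- a)` and the weights cost `2 / (4 a)`, in total `1 / a`.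
  refine (wasserstein1_le hL hn hm2 (weight_nonneg acc) h1
    (t := 1 / (4 * a)) (by positivity) h2).trans (le_of_eq ?_)
  rw [hm]
  congr 1
  field_simp
  norm_num

-- No accuracy of the estimates is used: any accumulated values yield nonnegative weights with sum
-- at most `1`, hence a density.
open Classical in
theorem haltProb_density {P : Prog} {ε δ : ℝ} {M N B : ℕ} {U : Sampler Store} (hm : 0 < m)
    (hU : Runs L P (inputStore n ε δ) M U) (hU0 : U.All (fun σ => σ.nvar 0 = m))
    (hUr : U.map Store.rarr = mainStep L m N B (fun _ _ => 0)) :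
    haltProb P L ε δ {σ | IsDensity (output σ)} = 1 := by
  refine le_antisymm (haltProb_le_one _) (le_trans (le_of_eq ?_) (hU.le_haltProb _))
  have h := all_mainStep (L := L) (m := m) N B
  rw [← hUr, Sampler.All_map_iff] at h
  rw [Sampler.expect_congr (g := fun _ => 1) (hU0.and h) fun σ hσ => if_pos ?_,
    Sampler.expect_const, ENNReal.ofReal_one]
  obtain ⟨hσ0, acc, hacc⟩ := hσ
  rw [Set.mem_ofPred_eq, hacc.output_eq hσ0]
  exact isDensity_outDensity hm (weight_nonneg acc) (sum_weight_le_one acc)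

open Classical in
theorem le_haltProb_accurate (hL : IsAdjacencyList G L) (hn : 0 < n) {P : Prog} {ε δ : ℝ}
    {M a b : ℕ} {U : Sampler Store} (ha : 0 < a) (haε : 1 / ε ≤ a) (hε : 0 < ε)
    (hδ : δ ∈ Set.Ioo (0 : ℝ) 1) (hb : Real.logb 2 (1 / δ) ≤ b)
    (hU : Runs L P (inputStore n ε δ) M U) (hU0 : U.All (fun σ => σ.nvar 0 = degreeFor a))
    (hUr : U.map Store.rarr = mainStep L (degreeFor a) (trialsFor a b) (boundFor a)
      (fun _ _ => 0)) :
    ENNReal.ofReal (1 - δ) ≤ haltProb P L ε δ {σ | IsDensity (output σ) ∧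
      wasserstein1 (densityMeasure (output σ))
        (spectralDensity (normalizedAdjacency_isHermitian G)) ≤ ENNReal.ofReal ε} := by
  have hm : 0 < degreeFor a := by
    unfold degreeFor
    positivity
  have hB : 0 < boundFor a := by
    unfold boundFor
    positivity
  have hN : (0 : ℝ) < trialsFor a b := by
    unfold trialsFor
    positivity
  have hX := le_expect_mainStep hL hm.ne' hn hB (trialsFor a b)
  rw [← hUr, Sampler.expect_map] at hX
  refine (ENNReal.ofReal_le_ofReal ?_).trans (hU.le_haltProb _)
  refine (sub_le_sub_left (failure_le ha hδ hb) 1).trans (hX.trans ?_)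
  refine Sampler.expect_mono hU0 fun σ hσ => ?_
  split_ifs with h1 h2
  · exact le_rfl
  · obtain ⟨acc, hacc, hrep⟩ := h1
    refine absurd ?_ h2
    rw [Set.mem_ofPred_eq, hrep.output_eq hσ]
    refine ⟨isDensity_outDensity hm (weight_nonneg acc) (sum_weight_le_one acc),
      (wasserstein1_output_le hL hn ha hN hacc).trans (ENNReal.ofReal_le_ofReal ?_)⟩
    exact (one_div_le hε (Nat.cast_pos.2 ha)).1 haε
  · exact zero_le_one
  · exact le_rfl

end RAM

end

theorem theorem3 :
    ∃ (P : RAM.Prog) (C : ℝ) (k : ℕ),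
      ∀ (n : ℕ) (_ : 1 ≤ n) (G : SimpleGraph (Fin n)) (L : Fin n → List (Fin n))
        (_ : RAM.IsAdjacencyList G L) (ε δ : ℝ) (_ : ε ∈ Set.Ioo (0 : ℝ) 1)
        (_ : δ ∈ Set.Ioo (0 : ℝ) 1),
        RAM.expectedTime P L ε δ ≤
            ENNReal.ofReal (C * n * ((1 + Real.log (1 / δ)) / ε) ^ k) ∧
          RAM.haltProb P L ε δ {σ | SpectralDensity.IsDensity (RAM.output σ)} = 1 ∧
          ENNReal.ofReal (1 - δ) ≤ RAM.haltProb P L ε δ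
            {σ | SpectralDensity.IsDensity (RAM.output σ) ∧
              SpectralDensity.wasserstein1
                (SpectralDensity.densityMeasure (RAM.output σ))
                (SpectralDensity.spectralDensity
                  (SpectralDensity.normalizedAdjacency_isHermitian G)) ≤ ENNReal.ofReal ε} := by
  refine ⟨RAM.densityProg, 504775077745 * 3 ^ 14, 14, fun n hn G L hL ε δ hε hδ => ?_⟩
  have ha : 0 < ⌈1 / ε⌉₊ := Nat.ceil_pos.2 (one_div_pos.2 hε.1)
  obtain ⟨U, hU, hU0, hUr⟩ := RAM.runs_densityProg (L := L) hε.1 hδ.1 rfl rfl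
  refine ⟨hU.expectedTime_le.trans ?_, RAM.haltProb_density ?_ hU hU0 hUr,
    RAM.le_haltProb_accurate hL hn ha (Nat.le_ceil _) hε.1 hδ (Nat.le_ceil _) hU hU0 hUr⟩
  · rw [← ENNReal.ofReal_natCast]
    exact ENNReal.ofReal_le_ofReal (RAM.densityCost_ceil_le hε hδ hn)
  · unfold RAM.degreeFor
    positivity
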